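/- **Fox–Neuwirth cochains of $\mathcal A_4$.** For a sequence $\Gamma=[a_1,a_2,a_3]$ of non-negative integers put $|\Gamma|=a_1+a_2+a_3$. A configuration of four distinct points in $\mathbb R^\infty$ (listed in the dictionary order of coordinates) respects $\Gamma$ if its $i$-th and $(i+1)$-st points share their first $a_i$ coordinates but not the next one, for $i=1,2,3$. Then points $p<q$ share exactly $\min_{p\le j<q}a_j$ first coordinates. Let $\Gamma\langle i\rangle$ be obtained from $\Gamma$ by adding $1$ to $a_i$. Let $\mathrm{Sh}(\Gamma,i)$ be the set of permutations $\pi$ of the four points that, in a configuration respecting $\Gamma\langle i\rangle$, keep the order of any two points $p<q$ except possibly when $p\le i<q$ and they share at least $a_i+1$ coordinates, and that send any two consecutive points sharing at least $a_i+2$ coordinates to consecutive positions (these are the shuffles of the blocks on the two sides of $i$). Write $\pi\cdot\Gamma\langle i\rangle$ for the sequence of the rearranged points (any two points share as many coordinates as before). Let $\mathrm{FNA}_4^n$ be the $\mathbb F_2$-vector space on the charged sequences $\Gamma^{+},\Gamma^{-}$ with $|\Gamma|=n$, with differential $$\delta(\Gamma^{\varepsilon})=\sum_{i=1}^{3}\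 \sum_{\pi\in \mathrm{Sh}(\Gamma,i)}\bigl(\pi\cdot\Gamma\langle i\rangle\bigr)^{\varepsilon\cdot\operatorname{sign}\pi},$$ and write $\Gamma^{o}=\Gamma^{+}+\Gamma^{-}$. This is the complex of $\mathcal A_4$-invariant $\mathbb F_2$-valued cochains of the complex of free $\mathbb F_2[\mathcal A_4]$-modules spanned by the labelled cells $(\Gamma,\sigma)$, $\sigma\in\mathcal S_4$ ($\sigma(p)$ being the label of the $p$-th point, $g(\Gamma,\sigma)=(\Gamma,g\sigma)$, and $(\Gamma,\sigma)$ having charge $\operatorname{sign}\sigma$), which is a resolution of the trivial module $\mathbb F_2$. Thus $H^*(\mathrm{FNA}_4^*)\cong H^*(B\mathcal A_4;\mathbb F_2)$ by comparison of resolutions, and a cocycle of $\mathrm{FNA}_4^*$ is said to represent the corresponding class. **Proposition.** There are unique classes $$\gamma_{1,2;2}\in H^2(B\mathcal A_4;\mathbb F_2),\qquad \gamma_{2,1}^{+},\ \gamma_{2,1}^{-}\in H^3(B\mathcal A_4;\mathbb F_2)$$ represented by $[1,0,1]^{o}$, by $[1,1,1]^{+}+[2,0,1]^{o}$ and by $[1,1,1]^{-}+[2,0,1]^{o}$,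 respectively. They generate the $\mathbb F_2$-algebra $H^*(B\mathcal A_4;\mathbb F_2)$ (with the cup product), they satisfy $$\gamma_{2,1}^{+}\,\gamma_{2,1}^{-}=(\gamma_{2,1}^{+})^2+(\gamma_{2,1}^{-})^2+\gamma_{1,2;2}^{3},$$ and this is the only relation: sending $A,B_+,B_-$ to $\gamma_{1,2;2},\gamma_{2,1}^{+},\gamma_{2,1}^{-}$ induces an isomorphism of $\mathbb F_2$-algebras $$\mathbb F_2[A,B_+,B_-]\big/\bigl(B_+B_- - (B_+^2+B_-^2+A^3)\bigr)\;\cong\; H^*(B\mathcal A_4;\mathbb F_2).$$ Moreover there is an isomorphism of $\mathbb F_2$-algebras $H^*(B\mathcal A_4;\mathbb F_2)\cong\mathbb F_2[x_1,x_2]^{C_3}$, where $C_3$ permutes $x_1,\ x_2,\ x_1+x_2$ cyclically, that sends $$\gamma_{1,2;2}\mapsto x_1^2+x_1x_2+x_2^2,\qquad \gamma_{2,1}^{+}\mapsto x_1^3+x_1^2x_2+x_2^3,\qquad \gamma_{2,1}^{-}\mapsto x_1^3+x_1x_2^2+x_2^3 .$$ -/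

import Mathlib

open CategoryTheory

/-! ## Cochains of a group and their cup product -/

namespace GroupCup

universe u

section Cochains

variable {k G : Type u} [CommRing k] [Group G]

/-- The differential of the complex of inhomogeneous cochains of `G` with trivial coefficients `k`:
`(df)(g₀,…,gₙ) = f(g₁,…,gₙ) + ∑ⱼ (-1)^(j+1) f(…,gⱼgⱼ₊₁,…)`, the last term being
`(-1)^(n+1) f(g₀,…,gₙ₋₁)`. -/
def cd (n : ℕ) : ((Fin n → G) → k) →ₗ[k] ((Fin (n + 1) → G) → k) where
  toFun f g := f (fun i => g i.succ) +
    ∑ j : Fin (n + 1), (-1 : k) ^ ((j : ℕ) + 1) * f (Fin.contractNth j (· * ·) g)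
  map_add' f g := by
    ext x
    simp [Finset.sum_add_distrib, add_add_add_comm, mul_add]
  map_smul' r f := by
    ext x
    simp [Finset.mul_sum, mul_add, mul_left_comm]

/-- The cup product of cochains,
`(f ∪ f')(g₁,…,g_{p+q}) = f(g₁,…,g_p) f'(g_{p+1},…,g_{p+q})`. -/
def cupC {p q n : ℕ} (h : p + q = n) (f : (Fin p → G) → k) (f' : (Fin q → G) → k) :
    (Fin n → G) → k :=
  fun x => f (fun i => x (Fin.cast h (Fin.castAdd q i))) *
    f' (fun i => x (Fin.cast h (Fin.natAdd p i)))

theorem leibniz {p q n : ℕ} (h : p + q = n) (h₁ : (p + 1) + q = n + 1) (h₂ : p + (q + 1) = n + 1)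
    (f : (Fin p → G) → k) (f' : (Fin q → G) → k) :
    cd n (cupC h f f') = cupC h₁ (cd p f) f' + (-1 : k) ^ p • cupC h₂ f (cd q f') := by
  subst h
  funext x
  have e1 : ∀ i : Fin p, cupC rfl f f' (Fin.contractNth (Fin.castAdd (q + 1) i) (· * ·) x) =
      f (Fin.contractNth i.castSucc (· * ·) fun i => x (Fin.cast h₁ (Fin.castAdd q i))) *
        f' (fun i => x (Fin.cast h₁ (Fin.natAdd (p + 1) i))) := by
    intro i
    refine congrArg₂ (· * ·) rfl (congrArg f' (funext fun a => ?_))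
    rw [Fin.contractNth_apply_of_gt _ _ _ _ (by simp; omega)]
    refine congrArg x (Fin.ext ?_)
    simp
    omega
  have e2 : ∀ j : Fin (q + 1), cupC rfl f f' (Fin.contractNth (Fin.natAdd p j) (· * ·) x) =
      f (fun i => x (Fin.cast h₂ (Fin.castAdd (q + 1) i))) *
        f' (Fin.contractNth j (· * ·) fun i => x (Fin.cast h₂ (Fin.natAdd p i))) := by
    intro j
    refine congrArg₂ (· * ·) (congrArg f (funext fun a => ?_))
      (congrArg f' (funext fun a => ?_))
    · rw [Fin.contractNth_apply_of_lt _ _ _ _ (by simp; omega)]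
      rfl
    · simp only [Fin.contractNth, Fin.val_natAdd, Fin.val_cast, add_lt_add_iff_left,
        add_right_inj]
      rfl
  have e3 : cupC rfl f f' (fun i => x i.succ) =
      f (fun i => x (Fin.cast h₁ (Fin.castAdd q i.succ))) *
        f' (fun i => x (Fin.cast h₁ (Fin.natAdd (p + 1) i))) := by
    refine congrArg₂ (· * ·) rfl (congrArg f' (funext fun a => congrArg x (Fin.ext ?_)))
    simp
    omega
  have e4 : Fin.contractNth (Fin.last p) (· * ·)
      (fun i => x (Fin.cast h₁ (Fin.castAdd q i))) =
      fun i => x (Fin.cast h₂ (Fin.castAdd (q + 1) i)) := by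
    funext a
    rw [Fin.contractNth_apply_of_lt _ _ _ _ (by simp)]
    rfl
  have e5 : (fun i => x (Fin.cast h₁ (Fin.natAdd (p + 1) i))) =
      fun i : Fin q => x (Fin.cast h₂ (Fin.natAdd p i.succ)) := by
    refine funext fun a => congrArg x (Fin.ext ?_)
    simp
    omega
  have s : ∑ j : Fin (p + q + 1), (-1 : k) ^ ((j : ℕ) + 1) *
        cupC rfl f f' (Fin.contractNth j (· * ·) x) =
      (∑ i : Fin p, (-1 : k) ^ ((i : ℕ) + 1) *
        cupC rfl f f' (Fin.contractNth (Fin.castAdd (q + 1) i) (· * ·) x)) +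
      ∑ j : Fin (q + 1), (-1 : k) ^ (p + (j : ℕ) + 1) *
        cupC rfl f f' (Fin.contractNth (Fin.natAdd p j) (· * ·) x) :=
    Fin.sum_univ_add fun j : Fin (p + (q + 1)) => (-1 : k) ^ ((j : ℕ) + 1) *
        cupC rfl f f' (Fin.contractNth j (· * ·) x)
  change cupC rfl f f' (fun i => x i.succ) + ∑ j : Fin (p + q + 1), _ = 
    (_ + ∑ j : Fin (p + 1), _) * _ + (-1 : k) ^ p * (_ * (_ + ∑ j : Fin (q + 1), _))
  rw [s, Fin.sum_univ_castSucc (n := p)]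
  simp only [e1, e2, e3, e4, ← e5, Fin.val_castSucc, Fin.val_last]
  simp only [mul_add, add_mul, Finset.mul_sum, Finset.sum_mul, pow_add]
  ring_nf

theorem cd_eq (n : ℕ) (f : (Fin n → G) → k) :
    (inhomogeneousCochains.d (Rep.trivial k G k) n).hom f = cd n f := by
  funext x
  simp [inhomogeneousCochains.d_hom_apply, cd]

/-- The cocycles of degree `n`, as a submodule of the cochains. -/
def Z (k G : Type u) [CommRing k] [Group G] (n : ℕ) : Submodule k ((Fin n → G) → k) :=
  LinearMap.ker (cd n)

end Cochains

/-- The cohomology `Hⁿ(BG; k)`, that is, the group cohomology of `G` with coefficients in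
the trivial representation `k`. -/
def H (k G : Type u) [CommRing k] [Group G] (n : ℕ) : Type u :=
  groupCohomology (Rep.trivial k G k) n

section

variable (k G : Type u) [CommRing k] [Group G]

noncomputable instance (n : ℕ) : AddCommGroup (H k G n) :=
  inferInstanceAs (AddCommGroup (groupCohomology (Rep.trivial k G k) n))

noncomputable instance (n : ℕ) : Module k (H k G n) :=
  inferInstanceAs (Module k (groupCohomology (Rep.trivial k G k) n))

/-- The cohomology class of a cocycle. -/
noncomputable def cls (n : ℕ) : Z k G n →ₗ[k] H k G n where
  toFun z := groupCohomology.π (Rep.trivial k G k) n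
    (groupCohomology.cocyclesMk (A := Rep.trivial k G k) z.1 ((cd_eq n z.1).trans z.2))
  map_add' z w := by
    refine Eq.trans ?_ (map_add (groupCohomology.π (Rep.trivial k G k) n).hom _ _)
    refine congrArg (groupCohomology.π (Rep.trivial k G k) n) ?_
    apply (ModuleCat.mono_iff_injective (groupCohomology.iCocycles _ n)).1 inferInstance
    rw [groupCohomology.iCocycles_mk]
    refine Eq.trans ?_ (map_add (groupCohomology.iCocycles (Rep.trivial k G k) n).hom _ _).symm
    exact (congrArg₂ (· + ·) (groupCohomology.iCocycles_mk (A := Rep.trivial k G k) z.1 _)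
      (groupCohomology.iCocycles_mk (A := Rep.trivial k G k) w.1 _)).symm
  map_smul' r z := by
    rw [RingHom.id_apply]
    refine Eq.trans ?_ (map_smul (groupCohomology.π (Rep.trivial k G k) n).hom r _)
    refine congrArg (groupCohomology.π (Rep.trivial k G k) n) ?_
    apply (ModuleCat.mono_iff_injective (groupCohomology.iCocycles _ n)).1 inferInstance
    rw [groupCohomology.iCocycles_mk]
    refine Eq.trans ?_ (map_smul (groupCohomology.iCocycles (Rep.trivial k G k) n).hom r _).symm
    refine congrArg (r • ·) (groupCohomology.iCocycles_mk (A := Rep.trivial k G k) z.1 _).symm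

theorem cls_surjective (n : ℕ) : Function.Surjective (cls k G n) := by
  intro c
  induction c using groupCohomology_induction_on with | h y => ?_
  have hy : inhomogeneousCochains.d (Rep.trivial k G k) n
      (groupCohomology.iCocycles (Rep.trivial k G k) n y) = 0 := by
    rw [← groupCohomology.inhomogeneousCochains.d_def]
    exact congrArg (fun φ => φ.hom y)
      ((groupCohomology.inhomogeneousCochains (Rep.trivial k G k)).iCycles_d n (n + 1))
  refine ⟨⟨groupCohomology.iCocycles (Rep.trivial k G k) n y, (cd_eq n _).symm.trans hy⟩, ?_⟩
  refine congrArg (groupCohomology.π (Rep.trivial k G k) n) ?_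
  apply (ModuleCat.mono_iff_injective (groupCohomology.iCocycles _ n)).1 inferInstance
  exact groupCohomology.iCocycles_mk _ _

/-- A cochain is a coboundary if it is the differential of a cochain of one degree lower. -/
def IsCob {k G : Type u} [CommRing k] [Group G] {n : ℕ} (z : (Fin n → G) → k) : Prop :=
  z = 0 ∨ ∃ (m : ℕ) (h : m + 1 = n) (f : (Fin m → G) → k), z = fun x => cd m f (x ∘ Fin.cast h)

theorem cls_eq_zero_iff (n : ℕ) (z : Z k G n) : cls k G n z = 0 ↔ IsCob z.1 := by
  set K := groupCohomology.inhomogeneousCochains (Rep.trivial k G k)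
  constructor
  · intro h
    have key : ∀ j, (ComplexShape.up ℕ).prev n = j → ∃ f : K.X j, z.1 = (K.d j n).hom f := by
      intro j hj
      have hex : (ShortComplex.mk _ _ (K.toCycles_comp_homologyπ j n)).Exact :=
        ShortComplex.exact_of_g_is_cokernel _ (K.homologyIsCokernel _ n hj)
      rw [ShortComplex.moduleCat_exact_iff] at hex
      obtain ⟨f, hf⟩ := hex _ h
      refine ⟨f, ?_⟩
      rw [← K.toCycles_i]
      refine (groupCohomology.iCocycles_mk (A := Rep.trivial k G k) z.1
        ((cd_eq n z.1).trans z.2)).symm.trans ?_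
      exact (congrArg (groupCohomology.iCocycles (Rep.trivial k G k) n) hf).symm
    obtain _ | m := n
    · left
      obtain ⟨f, hf⟩ := key _ rfl
      rw [hf, K.shape _ _ (by simp)]
      rfl
    · right
      obtain ⟨f, hf⟩ := key m (by simp)
      refine ⟨m, rfl, f, ?_⟩
      rw [hf, groupCohomology.inhomogeneousCochains.d_def, cd_eq]
      rfl
  · rintro (h | ⟨m, rfl, f, h⟩)
    · obtain rfl : z = 0 := Subtype.ext h
      exact map_zero _
    · refine Eq.trans (congrArg (groupCohomology.π (Rep.trivial k G k) (m + 1)) ?_)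
        (congrArg (fun φ => φ.hom f) (K.toCycles_comp_homologyπ m (m + 1)))
      apply (ModuleCat.mono_iff_injective (groupCohomology.iCocycles _ (m + 1))).1 inferInstance
      rw [groupCohomology.iCocycles_mk]
      refine Eq.trans ?_ (congrArg (fun φ => φ.hom f) (K.toCycles_i m (m + 1))).symm
      rw [groupCohomology.inhomogeneousCochains.d_def, cd_eq, h]
      rfl

end

section Cup

variable {k G : Type u} [CommRing k]

theorem cupC_zero_left {p q n : ℕ} (h : p + q = n) (w : (Fin q → G) → k) :
    cupC h (0 : (Fin p → G) → k) w = 0 := by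
  funext x
  simp [cupC]

theorem cupC_zero_right {p q n : ℕ} (h : p + q = n) (z : (Fin p → G) → k) :
    cupC h z (0 : (Fin q → G) → k) = 0 := by
  funext x
  simp [cupC]

variable [Group G]

theorem cupC_mem {p q n : ℕ} (h : p + q = n) (z : Z k G p) (w : Z k G q) :
    cupC h z.1 w.1 ∈ Z k G n := by
  have hz : cd p z.1 = 0 := z.2
  have hw : cd q w.1 = 0 := w.2
  change cd n _ = 0
  rw [leibniz h (by omega) (by omega), hz, hw, cupC_zero_left, cupC_zero_right]
  simp

/-- The cup product of cocycles. -/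
def cupZ {p q n : ℕ} (h : p + q = n) : Z k G p →ₗ[k] Z k G q →ₗ[k] Z k G n :=
  LinearMap.mk₂ k (fun z w => ⟨cupC h z.1 w.1, cupC_mem h z w⟩)
    (fun z z' w => Subtype.ext (funext fun x => by simp [cupC, add_mul]))
    (fun r z w => Subtype.ext (funext fun x => by simp [cupC, mul_assoc]))
    (fun z w w' => Subtype.ext (funext fun x => by simp [cupC, mul_add]))
    (fun r z w => Subtype.ext (funext fun x => by simp [cupC, mul_left_comm]))

theorem cls_cupZ_left {p q n : ℕ} (h : p + q = n) (z : Z k G p) (w : Z k G q)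
    (hz : cls k G p z = 0) : cls k G n (cupZ h z w) = 0 := by
  rw [cls_eq_zero_iff] at hz ⊢
  have hw : cd q w.1 = 0 := w.2
  change IsCob (cupC h z.1 w.1)
  rcases hz with hz | ⟨m, rfl, f, hz⟩
  · left
    rw [hz, cupC_zero_left]
  · right
    obtain rfl : n = m + q + 1 := by omega
    refine ⟨m + q, rfl, cupC rfl f w.1, ?_⟩
    change _ = cd (m + q) (cupC rfl f w.1)
    rw [leibniz rfl h rfl, hw, cupC_zero_right, hz]
    simp only [smul_zero, add_zero]
    rfl

theorem cls_cupZ_right {p q n : ℕ} (h : p + q = n) (z : Z k G p) (w : Z k G q)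
    (hw : cls k G q w = 0) : cls k G n (cupZ h z w) = 0 := by
  rw [cls_eq_zero_iff] at hw ⊢
  have hz : cd p z.1 = 0 := z.2
  change IsCob (cupC h z.1 w.1)
  rcases hw with hw | ⟨m, rfl, f, hw⟩
  · left
    rw [hw, cupC_zero_right]
  · right
    obtain rfl : n = p + m + 1 := by omega
    refine ⟨p + m, rfl, (-1 : k) ^ p • cupC rfl z.1 f, ?_⟩
    change _ = cd (p + m) ((-1 : k) ^ p • cupC rfl z.1 f)
    rw [map_smul, leibniz rfl (by omega) h, hz, cupC_zero_left, hw, zero_add, smul_smul,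
      ← mul_pow]
    simp only [mul_neg, mul_one, neg_neg, one_pow, one_smul]
    rfl

/-- Descend a linear map on cocycles that kills coboundaries to cohomology. -/
noncomputable def liftH {M : Type*} [AddCommGroup M] [Module k M] (p : ℕ) (l : Z k G p →ₗ[k] M)
    (hl : ∀ z, cls k G p z = 0 → l z = 0) : H k G p →ₗ[k] M :=
  (LinearMap.ker (cls k G p)).liftQ l hl ∘ₗ
    ((cls k G p).quotKerEquivOfSurjective (cls_surjective k G p)).symm.toLinearMap

theorem liftH_cls {M : Type*} [AddCommGroup M] [Module k M] (p : ℕ) (l : Z k G p →ₗ[k] M)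
    (hl : ∀ z, cls k G p z = 0 → l z = 0) (z : Z k G p) : liftH p l hl (cls k G p z) = l z := by
  have : ((cls k G p).quotKerEquivOfSurjective (cls_surjective k G p)).symm (cls k G p z) =
      Submodule.Quotient.mk z := by
    rw [LinearEquiv.symm_apply_eq]
    rfl
  rw [liftH, LinearMap.comp_apply, LinearEquiv.coe_coe, this]
  exact Submodule.liftQ_apply _ _ _

/-- The cup product in cohomology, induced by the cup product of cocycles. -/
noncomputable def cup {p q n : ℕ} (h : p + q = n) : H k G p →ₗ[k] H k G q →ₗ[k] H k G n :=
  liftH p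
    { toFun := fun z => liftH q (cls k G n ∘ₗ cupZ h z) (fun w hw => cls_cupZ_right h z w hw)
      map_add' := fun z z' => LinearMap.ext fun c => by
        obtain ⟨w, rfl⟩ := cls_surjective k G q c
        simp [liftH_cls]
      map_smul' := fun r z => LinearMap.ext fun c => by
        obtain ⟨w, rfl⟩ := cls_surjective k G q c
        simp [liftH_cls] }
    (fun z hz => LinearMap.ext fun c => by
      obtain ⟨w, rfl⟩ := cls_surjective k G q c
      simpa [liftH_cls] using cls_cupZ_left h z w hz)

theorem cup_cls {p q n : ℕ} (h : p + q = n) (z : Z k G p) (w : Z k G q) :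
    cup h (cls k G p z) (cls k G q w) = cls k G n (cupZ h z w) := by
  simp [cup, liftH_cls]

/-- The unit class in `H⁰`: the class of the constant cochain `1`. -/
noncomputable def one (k G : Type u) [CommRing k] [Group G] : H k G 0 :=
  cls k G 0 ⟨fun _ => 1, by
    change cd 0 _ = 0
    funext x
    simp [cd]⟩

theorem mk_cls_eq {n n' : ℕ} (h : n' = n) (z : Z k G n) (z' : Z k G n')
    (hz : ∀ x : Fin n → G, z.1 x = z'.1 (x ∘ Fin.cast h)) :
    (GradedMonoid.mk n (cls k G n z) : GradedMonoid (H k G)) =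
      GradedMonoid.mk n' (cls k G n' z') := by
  subst h
  obtain rfl : z = z' := Subtype.ext (funext hz)
  rfl

noncomputable instance : GradedMonoid.GMul (H k G) where
  mul a b := cup rfl a b

noncomputable instance : GradedMonoid.GOne (H k G) where
  one := one k G

/-- Cohomology with the cup product as a graded monoid. -/
noncomputable instance : GradedMonoid.GMonoid (H k G) where
  one_mul := by
    rintro ⟨n, c⟩
    obtain ⟨z, rfl⟩ := cls_surjective k G n c
    refine (congrArg (GradedMonoid.mk (0 + n)) (cup_cls rfl _ z)).trans
      (mk_cls_eq (by omega) _ _ fun x => ?_)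
    change 1 * z.1 _ = z.1 _
    rw [one_mul]
    refine congrArg z.1 (funext fun i => congrArg x (Fin.ext ?_))
    simp
  mul_one := by
    rintro ⟨n, c⟩
    obtain ⟨z, rfl⟩ := cls_surjective k G n c
    refine (congrArg (GradedMonoid.mk (n + 0)) (cup_cls rfl z _)).trans
      (mk_cls_eq (by omega) _ _ fun x => ?_)
    change z.1 _ * 1 = z.1 _
    rw [mul_one]
    rfl
  mul_assoc := by
    rintro ⟨a, x⟩ ⟨b, y⟩ ⟨c, w⟩
    obtain ⟨x, rfl⟩ := cls_surjective k G a x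
    obtain ⟨y, rfl⟩ := cls_surjective k G b y
    obtain ⟨w, rfl⟩ := cls_surjective k G c w
    refine (congrArg (GradedMonoid.mk (a + b + c))
      ((congrArg (fun t => cup rfl t (cls k G c w)) (cup_cls rfl x y)).trans
        (cup_cls rfl _ w))).trans (Eq.trans ?_ (congrArg (GradedMonoid.mk (a + (b + c)))
      ((congrArg (fun t => cup rfl (cls k G a x) t) (cup_cls rfl y w)).trans
        (cup_cls rfl x _))).symm)
    refine mk_cls_eq (by omega) _ _ fun g => ?_
    refine (mul_assoc (x.1 _) (y.1 _) (w.1 _)).trans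
      (congrArg₂ (· * ·) rfl (congrArg₂ (· * ·) rfl ?_))
    refine congrArg w.1 (funext fun i => congrArg g (Fin.ext ?_))
    simp [Nat.add_assoc]

/-- Cohomology with the cup product as a graded ring. -/
noncomputable instance : DirectSum.GRing (H k G) where
  mul_zero a := map_zero (cup rfl a)
  zero_mul b := LinearMap.map_zero₂ (cup rfl) b
  mul_add a b c := map_add (cup rfl a) b c
  add_mul a b c := LinearMap.map_add₂ (cup rfl) a b c
  natCast n := n • one k G
  natCast_zero := zero_smul _ _
  natCast_succ n := succ_nsmul _ n
  intCast n := n • one k G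
  intCast_ofNat n := natCast_zsmul _ n
  intCast_negSucc_ofNat n := negSucc_zsmul _ n

theorem gmul_def {p q : ℕ} (a : H k G p) (b : H k G q) :
    (GradedMonoid.GMul.mul a b : H k G (p + q)) = cup rfl a b := rfl

theorem mk_smul_eq {n n' : ℕ} (r : k) {a : H k G n} {b : H k G n'}
    (h : (GradedMonoid.mk n a : GradedMonoid (H k G)) = GradedMonoid.mk n' b) :
    (GradedMonoid.mk n (r • a) : GradedMonoid (H k G)) = GradedMonoid.mk n' (r • b) := by
  obtain ⟨rfl, h⟩ := Sigma.mk.inj_iff.1 h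
  rw [eq_of_heq h]

theorem smul_one_mul (r : k) (x : GradedMonoid (H k G)) :
    GradedMonoid.mk 0 (r • one k G) * x = r • x := by
  obtain ⟨n, c⟩ := x
  refine (congrArg (GradedMonoid.mk (0 + n)) (LinearMap.map_smul₂ (cup rfl) r (one k G) c)).trans ?_
  exact mk_smul_eq r (one_mul (GradedMonoid.mk n c : GradedMonoid (H k G)))

theorem mul_smul_one (r : k) (x : GradedMonoid (H k G)) :
    x * GradedMonoid.mk 0 (r • one k G) = r • x := by
  obtain ⟨n, c⟩ := x
  refine (congrArg (GradedMonoid.mk (n + 0)) (map_smul (cup rfl c) r (one k G))).trans ?_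
  exact mk_smul_eq r (mul_one (GradedMonoid.mk n c : GradedMonoid (H k G)))

/-- The cohomology ring is an algebra over the coefficient ring. -/
noncomputable instance : DirectSum.GAlgebra k (H k G) where
  toFun := (LinearMap.toSpanSingleton k (H k G 0) (one k G)).toAddMonoidHom
  map_one := one_smul _ _
  map_mul r s := by
    refine Eq.trans ?_ (smul_one_mul r (GradedMonoid.mk 0 (s • one k G))).symm
    exact congrArg (GradedMonoid.mk 0) (mul_smul r s (one k G))
  commutes r x := (smul_one_mul r x).trans (mul_smul_one r x).symm
  smul_def r x := (smul_one_mul r x).symm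

end Cup

/-- The cohomology ring `H*(BG; k) = ⨁ₙ Hⁿ(BG; k)`, with the cup product. -/
abbrev HRing (k G : Type u) [CommRing k] [Group G] : Type u := DirectSum ℕ (H k G)

end GroupCup

/-! ## Fox-Neuwirth cochains

Throughout, a configuration has `m + 1` points, listed in the dictionary order of their
coordinates, and a sequence `Γ = [a₁,…,a_m]` is a function `Fin m → ℕ`: the entry at `j` is the
number of first coordinates that the consecutive points `j.castSucc` and `j.succ` share. -/

namespace FoxNeuwirth

variable {m : ℕ}

/-- The degree `|Γ|`, the sum of the entries. -/
def deg (Γ : Fin m → ℕ) : ℕ := ∑ j, Γ j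

/-- The number of first coordinates shared by the points in positions `p` and `q` of a
configuration respecting `Γ`: the minimum of the entries between `p` and `q` (and `⊤` if `p = q`).
Points `p`, `q` belong to the same `ℓ`-block when `ℓ < shared Γ p q`. -/
def shared (Γ : Fin m → ℕ) (p q : Fin (m + 1)) : WithTop ℕ :=
  (Finset.univ.filter fun j : Fin m => min p q ≤ j.castSucc ∧ j.succ ≤ max p q).inf
    fun j => (Γ j : WithTop ℕ)

/-- The sequence `Γ⟨i⟩` obtained from `Γ` by adding one to its `i`-th entry. -/
def bump (Γ : Fin m → ℕ) (i : Fin m) : Fin m → ℕ := Function.update Γ i (Γ i + 1)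

/-- `π`, moving the point in position `p` to position `π p`, is one of the shuffles `Sh(Γ, i)`.
Let `a = Γ i` and let `Λ` be the set of points in the `a`-block of `Γ⟨i⟩` around the entry `i`. It is
divided in the points up to `i.castSucc` and those from `i.succ` on. A shuffle can invert two points
only if they are in `Λ`, on different sides of this division, and it moves each `(a + 1)`-block of
`Γ⟨i⟩` as a whole. -/
structure IsShuffle (Γ : Fin m → ℕ) (i : Fin m) (π : Equiv.Perm (Fin (m + 1))) : Prop where
  order : ∀ p q, p < q → π q < π p →
    p ≤ i.castSucc ∧ i.succ ≤ q ∧ (Γ i : WithTop ℕ) < shared (bump Γ i) p q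
  block : ∀ j : Fin m, Γ i + 1 < bump Γ i j → (π j.succ : ℕ) = (π j.castSucc : ℕ) + 1

/-- `Γ'` is the sequence `π · Γ⟨i⟩` for a shuffle `π` in `Sh(Γ, i)`: any two points share, after they
are permuted by `π`, as many coordinates as before. -/
def IsTerm (Γ : Fin m → ℕ) (i : Fin m) (π : Equiv.Perm (Fin (m + 1))) (Γ' : Fin m → ℕ) : Prop :=
  IsShuffle Γ i π ∧
    ∀ j : Fin m, (Γ' j : WithTop ℕ) = shared (bump Γ i) (π.symm j.castSucc) (π.symm j.succ)

open Classical in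
/-- The finite set of all `(Γ, i, π)` with `π ∈ Sh(Γ, i)` and `π · Γ⟨i⟩ = Γ'`. -/
noncomputable def incidences (Γ' : Fin m → ℕ) :
    Finset ((Fin m → ℕ) × Fin m × Equiv.Perm (Fin (m + 1))) :=
  ((Finset.univ.piAntidiag (deg Γ' - 1)) ×ˢ Finset.univ ×ˢ Finset.univ).filter
    fun t => IsTerm t.1 t.2.1 t.2.2 Γ'

/-- Mod-two Fox-Neuwirth cochains for the alternating group on `m + 1` letters, as the functions
giving the coefficient of every charged sequence `Γ^ε`, where `ε = 1` is the positive charge and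
`ε = -1` the negative one. -/
abbrev Cochain (m : ℕ) : Type := (Fin m → ℕ) × ℤˣ → ZMod 2

/-- The charged sequence `Γ^ε`, as a cochain. -/
def charged (Γ : Fin m → ℕ) (ε : ℤˣ) : Cochain m := Pi.single (Γ, ε) 1

/-- The differential of Fox-Neuwirth cochains:
`δ(Γ^ε) = ∑ᵢ ∑_{π ∈ Sh(Γ,i)} (π · Γ⟨i⟩)^(ε · sign π)`. The sign of `π` is its sign as a permutation of
the points of the configuration. -/
noncomputable def delta (f : Cochain m) : Cochain m :=
  fun x => ∑ t ∈ incidences x.1, f (t.1, x.2 * Equiv.Perm.sign t.2.2)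

/-- The Fox-Neuwirth cells of the space of labelled configurations: `(Γ, σ)` is the cell of the
configurations respecting `Γ` for which the point in position `p` has the label `σ p`. A permutation
`g` of the labels acts by `g (Γ, σ) = (Γ, g σ)`. The orbits under the alternating group are the charged
sequences, `(Γ, σ)` having the charge `sign σ`. -/
abbrev Cell (m : ℕ) : Type := (Fin m → ℕ) × Equiv.Perm (Fin (m + 1))

/-- The complex spanned by the labelled cells, with boundary
`∂(Γ', σ) = ∑ (Γ, σ π)` over all `(Γ, i, π)` with `π · Γ⟨i⟩ = Γ'`, is a resolution of `𝔽₂` by free modules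
over the alternating group, whose equivariant cochains are the Fox-Neuwirth cochains. A family `ψ`
is a comparison map if, in degrees up to `n`, it is an equivariant augmented chain map from this
complex to the standard resolution of `𝔽₂`. Only the degrees up to `n` matter for cohomology
classes of degree `n`, and there such a map is unique up to chain homotopy. -/
structure IsComparison (n : ℕ)
    (ψ : (d : ℕ) → Cell m →
      MonoidAlgebra (ZMod 2) (Fin (d + 1) → alternatingGroup (Fin (m + 1)))) : Prop where
  equivariant : ∀ d ≤ n, ∀ x : Cell m, deg x.1 = d →
    ∀ (g : alternatingGroup (Fin (m + 1))) (v : Fin (d + 1) → alternatingGroup (Fin (m + 1))),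
      (ψ d (x.1, (g : Equiv.Perm (Fin (m + 1))) * x.2)).coeff (fun i => g * v i) = (ψ d x).coeff v
  augmented : ∀ x : Cell m, deg x.1 = 0 → (ψ 0 x).coeff.sum (fun _ r => r) = 1
  boundary : ∀ d < n, ∀ x : Cell m, deg x.1 = d + 1 →
    Rep.standardComplex.d (ZMod 2) (alternatingGroup (Fin (m + 1))) (d + 1) (ψ (d + 1) x) =
      ∑ t ∈ incidences x.1, ψ d (t.1, x.2 * t.2.2)

/-- The value of an inhomogeneous cochain `z` on a chain of the standard resolution; on
`(g₀,…,gₙ)` it is `z(g₀⁻¹g₁,…,gₙ₋₁⁻¹gₙ)`. -/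
noncomputable def eval {G : Type} [Group G] {n : ℕ} (z : (Fin n → G) → ZMod 2)
    (c : MonoidAlgebra (ZMod 2) (Fin (n + 1) → G)) : ZMod 2 :=
  c.coeff.sum fun g r => r * z fun i => (g i.castSucc)⁻¹ * g i.succ

/-- The class `c` in the cohomology of the alternating group on `m + 1` letters is represented by
the Fox-Neuwirth cochain `f`: the pull-back along a comparison map of a cocycle in the class `c`
differs from `f` by a Fox-Neuwirth coboundary. -/
def Represents {n : ℕ} (f : Cochain m)
    (c : GroupCup.H (ZMod 2) (alternatingGroup (Fin (m + 1))) n) : Prop :=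
  ∃ ψ, IsComparison n ψ ∧
    ∃ z : GroupCup.Z (ZMod 2) (alternatingGroup (Fin (m + 1))) n,
      GroupCup.cls (ZMod 2) (alternatingGroup (Fin (m + 1))) n z = c ∧
      ∃ h : Cochain m, ∀ x : Cell m, deg x.1 = n →
        eval z.1 (ψ n x) =
          f (x.1, Equiv.Perm.sign x.2) + delta h (x.1, Equiv.Perm.sign x.2)

end FoxNeuwirth

/-- The automorphism `x₁ ↦ x₂`, `x₂ ↦ x₁ + x₂` of `𝔽₂[x₁, x₂]`. It permutes `x₁`, `x₂`, `x₁ + x₂`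
cyclically, and generates the action of the cyclic group `C₃`. -/
noncomputable def cyclicShift :
    MvPolynomial (Fin 2) (ZMod 2) →ₐ[ZMod 2] MvPolynomial (Fin 2) (ZMod 2) :=
  MvPolynomial.aeval ![MvPolynomial.X 1, MvPolynomial.X 0 + MvPolynomial.X 1]

/-- The ring of invariants `𝔽₂[x₁, x₂]^{C₃}`. -/
noncomputable def invariantsC3 : Subalgebra (ZMod 2) (MvPolynomial (Fin 2) (ZMod 2)) :=
  AlgHom.equalizer cyclicShift (AlgHom.id (ZMod 2) (MvPolynomial (Fin 2) (ZMod 2)))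

/-! The subgroup `V` of `𝒜₄` generated by the commuting involutions `s`, `t` has odd index 3, so
`H*(B𝒜₄)` should be the `C₃`-invariant part of `H*(BV) = 𝔽₂[x₁, x₂]`. The proof makes restriction to
`V` explicit on cochains. The element `u = x₁(s + 1) + x₂(t + 1)` of the group algebra over `𝔽₂[x₁,
x₂]` has augmentation zero and square zero. Hence evaluating inhomogeneous cochains on the tensor
powers of `u` kills coboundaries (`phi_cd`) and turns cup products into products (`phi_cupC`), which
gives the algebra homomorphism `phiRing`.

A family of functionals on `𝔽₂[x₁, x₂]`, indexed by cells and satisfying `IsTwisting`, produces an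
equivariant chain map to the standard resolution. The pull-back of a cocycle `z` along this map
depends only on the polynomial `phi z` (`evalL_psi`). On the standard resolution itself such a map
is homotopic to the identity, so `z` is cohomologous to a cocycle determined by `phi z`
(`cls_eq_cls_stdCocycle`) and `phiRing` is injective. Applying `phi` to that cocycle yields the
trace over `C₃` of the polynomial (`phi_stdCochain`); since 3 is odd, the traces are exactly the
invariants.

The polynomial ring is spanned over the Dickson algebra `𝔽₂[qA, qD]` by six monomials, whose traces
are `0`, `1`, `qA` and `qBp`; this gives generators of the invariants (`invariantsC3_eq`). As `qBm =
qD + qBp`, the relation is a monic quadratic equation for `qBp` over the Dickson algebra. Exchanging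
the variables shows that `1` and `qBp` are independent over it, so there is no further relation
(`ker_evGen`).

For the Fox–Neuwirth cells, `twistSupport` lists a twisting datum in degrees up to three, checked by
finite computation. Its comparison map pulls the three invariants back to exactly the three given
cochains. Any other comparison map is homotopic to it, so a represented invariant is known up to a
coboundary. Evaluation on `[1,0,1]⁺ + [0,0,2]⁺ + [2,0,0]⁺` and on `[1,1,1]^±`, which are cycles
modulo two, recovers it. -/

section

/-! ### The standard resolution over `𝔽₂` and its contracting cones. -/

namespace StdComplex

variable {G : Type} [Group G]

/-- The chains of degree `n` of the standard resolution of `𝔽₂` over the group `G`. -/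
abbrev Chain (G : Type) (n : ℕ) : Type := MonoidAlgebra (ZMod 2) (Fin (n + 1) → G)

/-- The linear extension of a function on a basis. -/
noncomputable def linExt {ι M : Type} [AddCommGroup M] [Module (ZMod 2) M] (f : ι → M) :
    MonoidAlgebra (ZMod 2) ι →ₗ[ZMod 2] M :=
  (Finsupp.lift M (ZMod 2) ι f) ∘ₗ (MonoidAlgebra.coeffLinearEquiv (ZMod 2)).toLinearMap

@[simp]
theorem linExt_single {ι M : Type} [AddCommGroup M] [Module (ZMod 2) M] (f : ι → M) (i : ι)
    (r : ZMod 2) : linExt f (.single i r) = r • f i := by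
  simp [linExt]

theorem linExt_apply {ι M : Type} [AddCommGroup M] [Module (ZMod 2) M] (f : ι → M)
    (c : MonoidAlgebra (ZMod 2) ι) : linExt f c = c.coeff.sum fun i r => r • f i := by
  simp [linExt]

theorem linExt_ext {ι M : Type} [AddCommGroup M] [Module (ZMod 2) M]
    {f g : MonoidAlgebra (ZMod 2) ι →ₗ[ZMod 2] M}
    (h : ∀ i, f (.single i 1) = g (.single i 1)) : f = g :=
  MonoidAlgebra.lhom_ext' fun i => LinearMap.ext_ring (by simpa using h i)

/-- The boundary of the standard resolution. -/
noncomputable abbrev bd (n : ℕ) : Chain G (n + 1) →ₗ[ZMod 2] Chain G n :=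
  Rep.standardComplex.d (ZMod 2) G (n + 1)

theorem bd_single {n : ℕ} (v : Fin (n + 2) → G) :
    bd n (.single v 1) = ∑ p : Fin (n + 2), .single (v ∘ p.succAbove) 1 := by
  rw [bd, Rep.standardComplex.d_of]
  simp [ZMod.neg_eq_self_mod_two]

theorem bd_bd {n : ℕ} (c : Chain G (n + 2)) : bd n (bd (n + 1) c) = 0 := by
  rw [bd, bd, ← Rep.standardComplex.d_apply, ← Rep.standardComplex.d_apply]
  have h := (Rep.standardComplex (ZMod 2) G).d_comp_d (n + 2) (n + 1) n
  exact congrArg (fun f => f.hom c) h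

/-- The diagonal action on chains. -/
noncomputable def act {n : ℕ} (g : G) : Chain G n →ₗ[ZMod 2] Chain G n :=
  linExt fun v => .single (fun i => g * v i) 1

@[simp]
theorem act_single {n : ℕ} (g : G) (v : Fin (n + 1) → G) :
    act g (.single v 1) = .single (fun i => g * v i) 1 := by
  simp [act]

theorem act_act {n : ℕ} (g h : G) (c : Chain G n) : act g (act h c) = act (g * h) c := by
  have : act g ∘ₗ act h = act (n := n) (g * h) := linExt_ext fun v => by simp [mul_assoc]
  exact LinearMap.congr_fun this c

theorem act_bd {n : ℕ} (g : G) (c : Chain G (n + 1)) : bd n (act g c) = act g (bd n c) := by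
  have : bd n ∘ₗ act g = act (n := n) g ∘ₗ bd n := linExt_ext fun v => by
    simp only [LinearMap.comp_apply, act_single, bd_single, map_sum]
    rfl
  exact LinearMap.congr_fun this c

theorem coeff_act {n : ℕ} (g : G) (c : Chain G n) (v : Fin (n + 1) → G) :
    (act g c).coeff (fun i => g * v i) = c.coeff v := by
  induction c using MonoidAlgebra.induction_linear with
  | zero => simp
  | add x y hx hy => simp [hx, hy]
  | single w r =>
    rw [act, linExt_single, MonoidAlgebra.smul_single, MonoidAlgebra.coeff_single,
      MonoidAlgebra.coeff_single, smul_eq_mul, mul_one]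
    classical
    rw [Finsupp.single_apply, Finsupp.single_apply]
    congr 1
    simp [funext_iff]

/-- The augmentation. -/
noncomputable def aug : Chain G 0 →ₗ[ZMod 2] ZMod 2 := linExt fun _ => 1

@[simp]
theorem aug_single (v : Fin 1 → G) (r : ZMod 2) : aug (.single v r) = r := by simp [aug]

theorem aug_act (g : G) (c : Chain G 0) : aug (act g c) = aug c := by
  have : aug ∘ₗ act g = aug := linExt_ext fun v => by
    rw [LinearMap.comp_apply, act_single, aug_single, aug_single]
  exact LinearMap.congr_fun this c

/-- The cone with apex `g`. -/
noncomputable def cone {n : ℕ} (g : G) : Chain G n →ₗ[ZMod 2] Chain G (n + 1) :=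
  linExt fun v => .single (Fin.cons g v : Fin (n + 2) → G) 1

@[simp]
theorem cone_single {n : ℕ} (g : G) (v : Fin (n + 1) → G) :
    cone g (.single v 1) = .single (Fin.cons g v : Fin (n + 2) → G) 1 := by
  simp [cone]

theorem act_cone {n : ℕ} (g h : G) (c : Chain G n) : act g (cone h c) = cone (g * h) (act g c) := by
  have : act g ∘ₗ cone h = cone (n := n) (g * h) ∘ₗ act g := linExt_ext fun v => by
    simp only [LinearMap.comp_apply, act_single, cone_single]
    congr 1
    funext i
    refine Fin.cases ?_ (fun i => ?_) i <;> simp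
  exact LinearMap.congr_fun this c

/-- Deleting the apex gives back the chain, and deleting any other vertex gives the cone over a
face. Signs play no role modulo two. -/
theorem bd_cone {n : ℕ} (g : G) (c : Chain G (n + 1)) :
    bd (n + 1) (cone g c) = c + cone g (bd n c) := by
  have : bd (n + 1) ∘ₗ cone g = LinearMap.id + cone (n := n) g ∘ₗ bd n := linExt_ext fun v => by
    simp only [LinearMap.comp_apply, LinearMap.add_apply, LinearMap.id_apply, cone_single,
      bd_single, map_sum]
    rw [Fin.sum_univ_succ]
    congr 1
    refine Finset.sum_congr rfl fun p _ => ?_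
    congr 1
    funext i
    refine Fin.cases ?_ (fun i => ?_) i <;> simp
  exact LinearMap.congr_fun this c

/-- Deleting the only vertex of a 0-simplex leaves the apex alone, so the augmentation replaces the
boundary. -/
theorem bd_cone_zero (g : G) (c : Chain G 0) :
    bd 0 (cone g c) = c + aug c • .single (fun _ => g) 1 := by
  have : bd 0 ∘ₗ cone g =
      LinearMap.id + (LinearMap.toSpanSingleton (ZMod 2) (Chain G 0) (.single (fun _ => g) 1)) ∘ₗ
        aug := linExt_ext fun v => by
    simp only [LinearMap.comp_apply, LinearMap.add_apply, LinearMap.id_apply, cone_single,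
      bd_single]
    rw [Fin.sum_univ_two]
    congr 1
    rw [aug_single, LinearMap.toSpanSingleton_apply, one_smul]
    congr 1
    funext i
    fin_cases i
    rfl
  exact LinearMap.congr_fun this c

/-- The evaluation of an inhomogeneous cochain, as a linear map. -/
noncomputable def evalL {n : ℕ} (z : (Fin n → G) → ZMod 2) : Chain G n →ₗ[ZMod 2] ZMod 2 :=
  linExt fun v => z fun i => (v i.castSucc)⁻¹ * v i.succ

theorem evalL_apply {n : ℕ} (z : (Fin n → G) → ZMod 2) (c : Chain G n) :
    evalL z c = FoxNeuwirth.eval z c := linExt_apply _ _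

theorem evalL_act {n : ℕ} (z : (Fin n → G) → ZMod 2) (g : G) (c : Chain G n) :
    evalL z (act g c) = evalL z c := by
  have : evalL z ∘ₗ act g = evalL z := linExt_ext fun v => by
    simp [evalL, mul_assoc]
  exact LinearMap.congr_fun this c

/-- Passage from homogeneous to inhomogeneous coordinates: invariant functions need only be tested
on tuples of partial products. -/
theorem eq_smul_partialProd {n : ℕ} (v : Fin (n + 1) → G) :
    v = fun i => v 0 * Fin.partialProd (fun i : Fin n => (v i.castSucc)⁻¹ * v i.succ) i := by
  have := Fin.partialProd_left_inv v
  exact this.symm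

theorem evalL_partialProd {n : ℕ} (z : (Fin n → G) → ZMod 2) (w : Fin n → G) :
    evalL z (.single (Fin.partialProd w) 1) = z w := by
  simp only [evalL, linExt_single, one_smul]
  congr 1
  funext i
  exact Fin.partialProd_right_inv w i

theorem partialProd_comp_succ {n : ℕ} (w : Fin (n + 1) → G) :
    Fin.partialProd w ∘ (0 : Fin (n + 2)).succAbove =
      fun i => w 0 * Fin.partialProd (fun i => w i.succ) i := by
  funext i
  simp only [Function.comp, Fin.succAbove_zero]
  exact Fin.partialProd_succ' w i

/-- Deleting the first vertex leaves a tuple starting at `w 0`, hence the translate. Deleting a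
later one multiplies two adjacent letters or, for the last vertex, drops the last letter. -/
theorem bd_partialProd {n : ℕ} (w : Fin (n + 1) → G) :
    bd n (.single (Fin.partialProd w) 1) =
      act (w 0) (.single (Fin.partialProd fun i => w i.succ) 1) +
        ∑ j : Fin (n + 1), .single (Fin.partialProd (Fin.contractNth j (· * ·) w)) 1 := by
  rw [bd_single, Fin.sum_univ_succ, partialProd_comp_succ, act_single]
  simp only [Fin.partialProd_contractNth]

theorem evalL_bd {n : ℕ} (z : (Fin n → G) → ZMod 2) (c : Chain G (n + 1)) :
    evalL z (bd n c) = evalL (GroupCup.cd n z) c := by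
  have : evalL z ∘ₗ bd n = evalL (GroupCup.cd n z) := linExt_ext fun v => by
    rw [LinearMap.comp_apply, eq_smul_partialProd v, ← act_single, act_bd, evalL_act, evalL_act,
      bd_partialProd, map_add, evalL_act, map_sum, evalL_partialProd]
    simp only [evalL_partialProd]
    simp [GroupCup.cd, ZMod.neg_eq_self_mod_two]
  exact LinearMap.congr_fun this c

end StdComplex

/-! ### Free cell complexes and uniqueness of chain maps up to homotopy. -/

open StdComplex

/-- A set of cells with a free action of `G`, the freeness being witnessed by the equivariant maps
`ρ` to `G`. The boundary of a cell `x` of degree `d + 1` is the sum of its faces over `I d x`. The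
cells of degree `d` are those elements of `X d` which satisfy `P d`. -/
structure CellComplex (G : Type) [Group G] where
  X : ℕ → Type
  P : ∀ d, X d → Prop
  act : ∀ d, G → X d → X d
  J : ℕ → Type
  I : ∀ d, X (d + 1) → Finset (J d)
  face : ∀ d, X (d + 1) → J d → X d
  ρ : ∀ d, X d → G
  P_act : ∀ d g x, P d x → P d (act d g x)
  P_face : ∀ d x, P (d + 1) x → ∀ j ∈ I d x, P d (face d x j)
  mul_act : ∀ d g h x, act d (g * h) x = act d g (act d h x)
  I_act : ∀ d g x, I d (act (d + 1) g x) = I d x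
  face_act : ∀ d g x j, face d (act (d + 1) g x) j = act d g (face d x j)
  ρ_act : ∀ d g x, ρ d (act d g x) = g * ρ d x

namespace CellComplex

variable {G : Type} [Group G] (C : CellComplex G)

/-- The boundary squares to zero on cells of degree at most `N`. -/
def IsComplex (N : ℕ) : Prop :=
  ∀ d, d + 2 ≤ N → ∀ x, C.P (d + 2) x → ∀ F : C.X d → ZMod 2,
    ∑ j ∈ C.I (d + 1) x, ∑ j' ∈ C.I d (C.face (d + 1) x j), F (C.face d (C.face (d + 1) x j) j') = 0

/-- The family `ψ` is an equivariant augmented chain map to the standard resolution in degrees up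
to `N`. -/
structure IsMap (N : ℕ) (ψ : ∀ d, C.X d → Chain G d) : Prop where
  equivariant : ∀ d ≤ N, ∀ x, C.P d x → ∀ g, ψ d (C.act d g x) = StdComplex.act g (ψ d x)
  augmented : ∀ x, C.P 0 x → aug (ψ 0 x) = 1
  boundary : ∀ d < N, ∀ x, C.P (d + 1) x → bd d (ψ (d + 1) x) = ∑ j ∈ C.I d x, ψ d (C.face d x j)

variable {C}

theorem IsComplex.chain {N : ℕ} (hC : C.IsComplex N) {d : ℕ} (hd : d + 2 ≤ N) {x : C.X (d + 2)}
    (hx : C.P (d + 2) x) {n : ℕ} (F : C.X d → Chain G n) :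
    ∑ j ∈ C.I (d + 1) x, ∑ j' ∈ C.I d (C.face (d + 1) x j),
      F (C.face d (C.face (d + 1) x j) j') = 0 := by
  apply MonoidAlgebra.coeff_injective
  ext v
  simpa using hC d hd x hx fun y => (F y).coeff v

/-- The chain homotopy between two chain maps to the standard resolution. -/
noncomputable def homotopy (ψ ψ' : ∀ d, C.X d → Chain G d) : ∀ d, C.X d → Chain G (d + 1)
  | 0, x => cone (C.ρ 0 x) (ψ 0 x + ψ' 0 x)
  | d + 1, x => cone (C.ρ (d + 1) x) (ψ (d + 1) x + ψ' (d + 1) x +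
      ∑ j ∈ C.I d x, homotopy ψ ψ' d (C.face d x j))

variable {N : ℕ} {ψ ψ' : ∀ d, C.X d → Chain G d}

/-- The apex `C.ρ d x` of the cone moves along with the cell. This is where freeness of the action
enters. -/
theorem homotopy_act (h : C.IsMap N ψ) (h' : C.IsMap N ψ') : ∀ d ≤ N, ∀ x, C.P d x → ∀ g,
    homotopy ψ ψ' d (C.act d g x) = StdComplex.act g (homotopy ψ ψ' d x)
  | 0, hd, x, hx, g => by
    simp only [homotopy, act_cone, C.ρ_act, map_add, h.equivariant 0 hd x hx,
      h'.equivariant 0 hd x hx]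
  | d + 1, hd, x, hx, g => by
    have e : ∑ j ∈ C.I d x, homotopy ψ ψ' d (C.act d g (C.face d x j)) =
        StdComplex.act g (∑ j ∈ C.I d x, homotopy ψ ψ' d (C.face d x j)) := by
      rw [map_sum]
      exact Finset.sum_congr rfl fun j hj =>
        homotopy_act h h' d (by omega) _ (C.P_face d x hx j hj) g
    simp only [homotopy, act_cone, C.ρ_act, C.I_act, C.face_act, e, h.equivariant _ hd x hx,
      h'.equivariant _ hd x hx, ← map_add]

/-- Both maps have augmentation one, so their sum has augmentation zero and the apex term
disappears. -/
theorem bd_homotopy_zero (h : C.IsMap N ψ) (h' : C.IsMap N ψ') (x : C.X 0) (hx : C.P 0 x) :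
    bd 0 (homotopy ψ ψ' 0 x) = ψ 0 x + ψ' 0 x := by
  rw [homotopy, bd_cone_zero, map_add, h.augmented x hx, h'.augmented x hx,
    show (1 + 1 : ZMod 2) = 0 from rfl, zero_smul, add_zero]

theorem chain_add_self {n : ℕ} (c : Chain G n) : c + c = 0 := by
  rw [← two_smul (ZMod 2) c, show (2 : ZMod 2) = 0 from rfl, zero_smul]

/-- Inductively, the chain under the cone is a cycle, so only the first term of `bd_cone` survives.
-/
theorem bd_homotopy_succ (hC : C.IsComplex N) (h : C.IsMap N ψ) (h' : C.IsMap N ψ') :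
    ∀ d, d + 1 ≤ N → ∀ x, C.P (d + 1) x → bd (d + 1) (homotopy ψ ψ' (d + 1) x) =
      ψ (d + 1) x + ψ' (d + 1) x + ∑ j ∈ C.I d x, homotopy ψ ψ' d (C.face d x j) := by
  intro d
  induction d with
  | zero =>
    intro hd x hx
    have e : bd 0 (ψ (0 + 1) x + ψ' (0 + 1) x +
        ∑ j ∈ C.I 0 x, homotopy ψ ψ' 0 (C.face 0 x j)) = 0 := by
      rw [map_add, map_add, map_sum, h.boundary 0 hd x hx,
        h'.boundary 0 hd x hx, Finset.sum_congr rfl fun j hj =>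
          bd_homotopy_zero h h' _ (C.P_face 0 x hx j hj), Finset.sum_add_distrib, chain_add_self]
    rw [homotopy, bd_cone, e, map_zero, add_zero]
  | succ d ih =>
    intro hd x hx
    have e : bd (d + 1) (ψ (d + 1 + 1) x + ψ' (d + 1 + 1) x +
        ∑ j ∈ C.I (d + 1) x, homotopy ψ ψ' (d + 1) (C.face (d + 1) x j)) = 0 := by
      rw [map_add, map_add, map_sum, h.boundary _ hd x hx,
        h'.boundary _ hd x hx, Finset.sum_congr rfl fun j hj =>
          ih (by omega) _ (C.P_face _ x hx j hj), Finset.sum_add_distrib, Finset.sum_add_distrib,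
        hC.chain hd hx, add_zero, chain_add_self]
    rw [homotopy, bd_cone, e, map_zero, add_zero]

theorem evalL_eq_zero (h : C.IsMap N ψ) (h' : C.IsMap N ψ') (z : GroupCup.Z (ZMod 2) G 0)
    (x : C.X 0) (hx : C.P 0 x) : evalL z.1 (ψ 0 x) = evalL z.1 (ψ' 0 x) := by
  have hz : GroupCup.cd 0 z.1 = 0 := z.2
  have := evalL_bd z.1 (homotopy ψ ψ' 0 x)
  rw [hz, bd_homotopy_zero h h' x hx, map_add,
    show evalL (0 : (Fin 1 → G) → ZMod 2) = 0 from linExt_ext fun v => by simp [evalL]] at this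
  exact CharTwo.add_eq_zero.1 this

/-- The pull-backs of a cocycle along two chain maps differ by the coboundary of an invariant
cochain. -/
theorem exists_evalL_eq_succ (hC : C.IsComplex N) (h : C.IsMap N ψ) (h' : C.IsMap N ψ') (n : ℕ)
    (hn : n + 1 ≤ N) (z : GroupCup.Z (ZMod 2) G (n + 1)) :
    ∃ f : C.X n → ZMod 2, (∀ g x, C.P n x → f (C.act n g x) = f x) ∧
      ∀ x, C.P (n + 1) x → evalL z.1 (ψ (n + 1) x) =
        evalL z.1 (ψ' (n + 1) x) + ∑ j ∈ C.I n x, f (C.face n x j) := by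
  -- The cochain is the pull-back of `z` along the homotopy; a cocycle vanishes on the boundary of
  -- the homotopy one degree higher.
  refine ⟨fun x => evalL z.1 (homotopy ψ ψ' n x), fun g x hx => ?_, fun x hx => ?_⟩
  · change evalL z.1 (homotopy ψ ψ' n (C.act n g x)) = evalL z.1 (homotopy ψ ψ' n x)
    rw [homotopy_act h h' n (by omega) x hx, evalL_act]
  · have hz : GroupCup.cd (n + 1) z.1 = 0 := z.2
    have := evalL_bd z.1 (homotopy ψ ψ' (n + 1) x)
    rw [hz, bd_homotopy_succ hC h h' n hn x hx, map_add, map_add, map_sum,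
      show evalL (0 : (Fin (n + 2) → G) → ZMod 2) = 0 from linExt_ext fun v => by simp [evalL],
      LinearMap.zero_apply, add_assoc] at this
    exact CharTwo.add_eq_zero.1 this

end CellComplex

end

/-! ### Maurer–Cartan elements of group algebras and the ring homomorphism they induce. -/

section

open StdComplex

theorem Fin.sum_univ_cons {G M : Type} [Fintype G] [AddCommMonoid M] {n : ℕ}
    (F : (Fin (n + 1) → G) → M) : ∑ w, F w = ∑ a : G, ∑ w : Fin n → G, F (Fin.cons a w) := by
  rw [← (Fin.consEquiv fun _ => G).sum_comp, Fintype.sum_prod_type]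
  rfl

theorem Fin.sum_univ_append {G M : Type} [Fintype G] [AddCommMonoid M] {p q : ℕ}
    (F : (Fin (p + q) → G) → M) :
    ∑ w, F w = ∑ a : Fin p → G, ∑ b : Fin q → G, F (Fin.append a b) := by
  rw [← (Fin.appendEquiv p q).sum_comp, Fintype.sum_prod_type]
  rfl

theorem Fin.contractNth_zero_cons_cons {G : Type} [Mul G] {n : ℕ} (a b : G) (w : Fin n → G) :
    Fin.contractNth 0 (· * ·) (Fin.cons a (Fin.cons b w : Fin (n + 1) → G) : Fin (n + 2) → G) =
      (Fin.cons (a * b) w : Fin (n + 1) → G) := by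
  funext i
  refine Fin.cases ?_ (fun i => ?_) i
  · simp [Fin.contractNth]
  · simp [Fin.contractNth]

theorem Fin.contractNth_succ_cons {G : Type} [Mul G] {n : ℕ} (j : Fin (n + 1)) (a : G)
    (w : Fin (n + 1) → G) :
    Fin.contractNth j.succ (· * ·) (Fin.cons a w : Fin (n + 2) → G) =
      (Fin.cons a (Fin.contractNth j (· * ·) w) : Fin (n + 1) → G) := by
  funext i
  refine Fin.cases ?_ (fun i => ?_) i
  · simp [Fin.contractNth]
  · simp [Fin.contractNth]

/-- A Maurer-Cartan element of the group algebra of `G` over `R`: an element of the augmentation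
ideal whose square is zero. -/
structure IsMaurerCartan {G R : Type} [Group G] [Fintype G] [CommRing R] (u : G → R) : Prop where
  sum_eq_zero : ∑ g, u g = 0
  sum_mul_eq_zero : ∀ g, ∑ a, u a * u (a⁻¹ * g) = 0

namespace IsMaurerCartan

variable {G R : Type} [Group G] [Fintype G] [CommRing R] [Algebra (ZMod 2) R] {u : G → R}

/-- The product of the values of `u` on a word. -/
def wt (u : G → R) {n : ℕ} (w : Fin n → G) : R := ∏ i, u (w i)

theorem wt_cons {n : ℕ} (a : G) (w : Fin n → G) :
    wt u (Fin.cons a w : Fin (n + 1) → G) = u a * wt u w := by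
  simp [wt, Fin.prod_univ_succ]

theorem wt_append {p q : ℕ} (a : Fin p → G) (b : Fin q → G) :
    wt u (Fin.append a b) = wt u a * wt u b := by
  simp [wt, Fin.prod_univ_add]

/-- Contracting two neighbours produces the coefficients of `u²`; contracting in the last place
drops the last letter and leaves the augmentation of `u`. Both vanish. Values of `F` are linear maps
so that the induction can absorb the first letter and its weight into `F`. -/
theorem sum_contractNth (hu : IsMaurerCartan u) {M : Type} [AddCommGroup M] [Module (ZMod 2) M] :
    ∀ (n : ℕ) (j : Fin (n + 1)) (F : (Fin n → G) → R →ₗ[ZMod 2] M),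
      ∑ w : Fin (n + 1) → G, F (Fin.contractNth j (· * ·) w) (wt u w) = 0
  | 0, j, F => by
    rw [Fin.sum_univ_cons]
    have h : ∀ w : Fin 0 → G, w = default := fun w => Subsingleton.elim _ _
    simp only [wt_cons, h, Fintype.sum_unique]
    rw [← map_sum, ← Finset.sum_mul, hu.sum_eq_zero, zero_mul, map_zero]
  | n + 1, j, F => by
    refine Fin.cases ?_ (fun j => ?_) j
    · rw [Fin.sum_univ_cons]
      have e : ∀ a : G, ∑ w : Fin (n + 1) → G, F (Fin.contractNth 0 (· * ·)
          (Fin.cons a w : Fin (n + 2) → G)) (wt u (Fin.cons a w : Fin (n + 2) → G)) =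
          ∑ g : G, ∑ w : Fin n → G, F (Fin.cons g w) (u a * u (a⁻¹ * g) * wt u w) := by
        intro a
        rw [Fin.sum_univ_cons, ← Equiv.sum_comp (Equiv.mulLeft a⁻¹)]
        simp only [Fin.contractNth_zero_cons_cons, wt_cons, Equiv.coe_mulLeft,
          mul_inv_cancel_left, mul_assoc]
      simp only [e]
      rw [Finset.sum_comm]
      refine Finset.sum_eq_zero fun g _ => ?_
      rw [Finset.sum_comm]
      refine Finset.sum_eq_zero fun w _ => ?_
      rw [← map_sum, ← Finset.sum_mul, hu.sum_mul_eq_zero, zero_mul, map_zero]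
    · rw [Fin.sum_univ_cons]
      refine Finset.sum_eq_zero fun a _ => ?_
      simp only [Fin.contractNth_succ_cons, wt_cons]
      exact sum_contractNth hu n j fun y => F (Fin.cons a y) ∘ₗ LinearMap.mulLeft (ZMod 2) (u a)

/-- The evaluation of a cochain on all tensor powers of `u`. -/
def phi (u : G → R) (n : ℕ) : ((Fin n → G) → ZMod 2) →ₗ[ZMod 2] R where
  toFun z := ∑ w, z w • wt u w
  map_add' z z' := by simp [add_smul, Finset.sum_add_distrib]
  map_smul' r z := by simp [mul_smul, Finset.smul_sum]

theorem phi_apply {n : ℕ} (z : (Fin n → G) → ZMod 2) : phi u n z = ∑ w, z w • wt u w := rfl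

/-- The contraction terms vanish by `sum_contractNth`; the remaining term ignores the first letter,
so it is a multiple of the augmentation of `u`. -/
theorem phi_cd (hu : IsMaurerCartan u) {n : ℕ} (f : (Fin n → G) → ZMod 2) :
    phi u (n + 1) (GroupCup.cd n f) = 0 := by
  have e : ∀ w : Fin (n + 1) → G, GroupCup.cd n f w =
      f (fun i => w i.succ) + ∑ j : Fin (n + 1), f (Fin.contractNth j (· * ·) w) := by
    intro w
    simp [GroupCup.cd, ZMod.neg_eq_self_mod_two]
  simp only [phi_apply, e, add_smul, Finset.sum_smul, Finset.sum_add_distrib]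
  have e' : ∀ j : Fin (n + 1), ∑ w, f (Fin.contractNth j (· * ·) w) • wt u w = 0 := fun j =>
    hu.sum_contractNth n j fun y => LinearMap.lsmul (ZMod 2) R (f y)
  rw [Finset.sum_comm (s := Finset.univ) (t := (Finset.univ : Finset (Fin (n + 1)))),
    Finset.sum_eq_zero fun j _ => e' j, add_zero, Fin.sum_univ_cons, Finset.sum_comm]
  refine Finset.sum_eq_zero fun w _ => ?_
  simp only [Fin.cons_succ, wt_cons]
  rw [← Finset.smul_sum, ← Finset.sum_mul, hu.sum_eq_zero, zero_mul, smul_zero]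

theorem phi_cupC {p q n : ℕ} (h : p + q = n) (z : (Fin p → G) → ZMod 2)
    (z' : (Fin q → G) → ZMod 2) :
    phi u n (GroupCup.cupC h z z') = phi u p z * phi u q z' := by
  subst h
  rw [phi_apply, phi_apply, phi_apply, Fin.sum_univ_append, Finset.sum_mul_sum]
  refine Finset.sum_congr rfl fun a _ => Finset.sum_congr rfl fun b _ => ?_
  simp [GroupCup.cupC, wt_append, mul_smul]
  rw [smul_comm]

/-- The map on cohomology induced by `phi`. -/
noncomputable def phiH (hu : IsMaurerCartan u) (n : ℕ) :
    GroupCup.H (ZMod 2) G n →ₗ[ZMod 2] R :=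
  GroupCup.liftH n (phi u n ∘ₗ (GroupCup.Z (ZMod 2) G n).subtype) fun z hz => by
    rw [GroupCup.cls_eq_zero_iff] at hz
    rcases hz with hz | ⟨m, rfl, f, hz⟩
    · simp [hz]
    · have : z.1 = GroupCup.cd m f := hz
      simp [this, hu.phi_cd]

theorem phiH_cls (hu : IsMaurerCartan u) {n : ℕ} (z : GroupCup.Z (ZMod 2) G n) :
    hu.phiH n (GroupCup.cls (ZMod 2) G n z) = phi u n z.1 :=
  GroupCup.liftH_cls _ _ _ _

/-- The ring homomorphism from the cohomology ring induced by `phi`. -/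
noncomputable def phiRing (hu : IsMaurerCartan u) :
    GroupCup.HRing (ZMod 2) G →ₐ[ZMod 2] R :=
  DirectSum.toAlgebra (ZMod 2) (GroupCup.H (ZMod 2) G) hu.phiH
    (by
      refine (hu.phiH_cls _).trans ?_
      simp [phi_apply, wt])
    (by
      intro p q a b
      obtain ⟨z, rfl⟩ := GroupCup.cls_surjective _ _ _ a
      obtain ⟨w, rfl⟩ := GroupCup.cls_surjective _ _ _ b
      rw [GroupCup.gmul_def, GroupCup.cup_cls, phiH_cls, phiH_cls, phiH_cls]
      exact phi_cupC rfl _ _)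

theorem phiRing_of (hu : IsMaurerCartan u) {n : ℕ} (c : GroupCup.H (ZMod 2) G n) :
    hu.phiRing (DirectSum.of (GroupCup.H (ZMod 2) G) n c) = hu.phiH n c :=
  DirectSum.toAddMonoid_of (fun n => (hu.phiH n).toAddMonoidHom) n c

end IsMaurerCartan

open IsMaurerCartan

/-! ### Chain maps to the standard resolution from twisting data. -/

namespace CellComplex

variable {G R : Type} [Group G] [Fintype G] [CommRing R] [Algebra (ZMod 2) R] {u : G → R}
  (C : CellComplex G)

/-- A family of functionals on `R` indexed by cells which is a twisting datum for `u`: it is the same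
as an equivariant augmented chain map from `C` to the complex dual to `R` with the boundary given by
the multiplication with the Maurer-Cartan element `u`. -/
structure IsTwisting (N : ℕ) (u : G → R) (K : ∀ d, C.X d → R →ₗ[ZMod 2] ZMod 2) : Prop where
  augmented : ∀ x, C.P 0 x → ∑ g, K 0 (C.act 0 g x) 1 = 1
  boundary : ∀ d < N, ∀ x, C.P (d + 1) x → ∀ p,
    ∑ j ∈ C.I d x, K d (C.face d x j) p = ∑ v, K (d + 1) (C.act (d + 1) v x) (u v * p)

variable {C}

/-- The chain map to the standard resolution given by a twisting datum. -/
noncomputable def psi (u : G → R) (K : ∀ d, C.X d → R →ₗ[ZMod 2] ZMod 2) (d : ℕ) (x : C.X d) :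
    Chain G d :=
  ∑ g, StdComplex.act g⁻¹
    (∑ w : Fin d → G, K d (C.act d g x) (wt u w) • .single (Fin.partialProd w) 1)

/-- The point of the construction: the pull-back of `z` is a function of `phi u d z` alone. -/
theorem evalL_psi (K : ∀ d, C.X d → R →ₗ[ZMod 2] ZMod 2) {d : ℕ} (x : C.X d)
    (z : (Fin d → G) → ZMod 2) :
    evalL z (psi u K d x) = ∑ g, K d (C.act d g x) (phi u d z) := by
  simp only [psi, map_sum, evalL_act, map_smul, evalL_partialProd, phi_apply]
  refine Finset.sum_congr rfl fun g _ => Finset.sum_congr rfl fun w _ => ?_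
  simp [mul_comm]

theorem psi_act (K : ∀ d, C.X d → R →ₗ[ZMod 2] ZMod 2) {d : ℕ} (x : C.X d) (h : G) :
    psi u K d (C.act d h x) = StdComplex.act h (psi u K d x) := by
  rw [psi, psi, map_sum]
  refine Eq.trans ?_ (Equiv.sum_comp (Equiv.mulRight h) _)
  refine Finset.sum_congr rfl fun g _ => ?_
  rw [act_act, Equiv.coe_mulRight, C.mul_act, mul_inv_rev, mul_inv_cancel_left]

/-- Faces that contract letters cancel by `sum_contractNth`. The face dropping the first letter `v`
leaves a factor `u v` and a translation by `v`; the sum over the group absorbs the translation,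
after which the twisting identity applies. -/
theorem IsTwisting.bd_psi {N : ℕ} (hu : IsMaurerCartan u) {K : ∀ d, C.X d → R →ₗ[ZMod 2] ZMod 2}
    (hK : C.IsTwisting N u K) {d : ℕ} (hd : d < N) (x : C.X (d + 1)) (hx : C.P (d + 1) x) :
    bd d (psi u K (d + 1) x) = ∑ j ∈ C.I d x, psi u K d (C.face d x j) := by
  have e₁ : ∀ y : C.X (d + 1), ∑ w : Fin (d + 1) → G, K (d + 1) y (wt u w) •
        bd d (.single (Fin.partialProd w) 1) =
      ∑ v, StdComplex.act v (∑ w : Fin d → G, K (d + 1) y (u v * wt u w) •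
        .single (Fin.partialProd w) 1) := by
    intro y
    have h : ∀ j : Fin (d + 1), ∑ w : Fin (d + 1) → G, K (d + 1) y (wt u w) •
        (.single (Fin.partialProd (Fin.contractNth j (· * ·) w)) 1 : Chain G d) = 0 := fun j =>
      hu.sum_contractNth d j fun w =>
        (LinearMap.toSpanSingleton (ZMod 2) (Chain G d) (.single (Fin.partialProd w) 1)) ∘ₗ
          K (d + 1) y
    simp only [bd_partialProd, smul_add, Finset.sum_add_distrib, Finset.smul_sum]
    rw [Finset.sum_comm (s := Finset.univ) (t := (Finset.univ : Finset (Fin (d + 1)))),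
      Finset.sum_eq_zero fun j _ => h j, add_zero, Fin.sum_univ_cons]
    refine Finset.sum_congr rfl fun v _ => ?_
    simp only [map_sum, map_smul, wt_cons, Fin.cons_zero, Fin.cons_succ]
  have e₂ : ∀ g, ∑ v, ∑ w : Fin d → G, K (d + 1) (C.act (d + 1) v (C.act (d + 1) g x))
        (u v * wt u w) • (.single (Fin.partialProd w) 1 : Chain G d) =
      ∑ j ∈ C.I d x, ∑ w : Fin d → G, K d (C.act d g (C.face d x j)) (wt u w) •
        .single (Fin.partialProd w) 1 := by
    intro g
    rw [Finset.sum_comm, Finset.sum_comm (s := C.I d x)]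
    refine Finset.sum_congr rfl fun w _ => ?_
    rw [← Finset.sum_smul, ← Finset.sum_smul, ← hK.boundary d hd _ (C.P_act _ g x hx), C.I_act]
    simp only [C.face_act]
  calc bd d (psi u K (d + 1) x)
      = ∑ g, ∑ v, StdComplex.act (g⁻¹ * v) (∑ w : Fin d → G,
          K (d + 1) (C.act (d + 1) g x) (u v * wt u w) • .single (Fin.partialProd w) 1) := by
        rw [psi, map_sum]
        refine Finset.sum_congr rfl fun g _ => ?_
        rw [act_bd, map_sum]
        simp only [map_smul]
        rw [e₁, map_sum]
        simp only [act_act]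
    _ = ∑ g, StdComplex.act g⁻¹ (∑ v, ∑ w : Fin d → G,
          K (d + 1) (C.act (d + 1) v (C.act (d + 1) g x)) (u v * wt u w) •
            .single (Fin.partialProd w) 1) := by
        simp_rw [map_sum (StdComplex.act _) _ (Finset.univ : Finset G)]
        rw [Finset.sum_comm]
        refine Eq.trans (Finset.sum_congr rfl fun v _ => ?_) Finset.sum_comm
        -- Replacing `g` by `v * g` turns the translation by `g⁻¹ * v` into one by `g⁻¹`.
        refine (Equiv.sum_comp (Equiv.mulLeft v) _).symm.trans ?_
        refine Finset.sum_congr rfl fun g _ => ?_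
        rw [Equiv.coe_mulLeft, mul_inv_rev, inv_mul_cancel_right, C.mul_act]
    _ = _ := by
        simp only [e₂, map_sum (StdComplex.act _) _ (C.I d x)]
        rw [Finset.sum_comm]
        rfl

theorem IsTwisting.isMap {N : ℕ} (hu : IsMaurerCartan u) {K : ∀ d, C.X d → R →ₗ[ZMod 2] ZMod 2}
    (hK : C.IsTwisting N u K) : C.IsMap N (psi u K) where
  equivariant d _ x _ g := psi_act K x g
  augmented x hx := by
    rw [← hK.augmented x hx]
    simp [psi, wt, aug_act]
  boundary d hd x hx := hK.bd_psi hu hd x hx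

end CellComplex

end

/-! ### The standard resolution as a cell complex, and explicit cochains on it. -/

section

open StdComplex

/-- The cells of the standard resolution. -/
def stdCells (G : Type) [Group G] : CellComplex G where
  X d := Fin (d + 1) → G
  P _ _ := True
  act _ g x i := g * x i
  J d := Fin (d + 2)
  I _ _ := Finset.univ
  face _ x p := x ∘ p.succAbove
  ρ _ x := x 0
  P_act _ _ _ _ := trivial
  P_face _ _ _ _ _ := trivial
  mul_act _ _ _ _ := funext fun _ => mul_assoc _ _ _
  I_act _ _ _ := rfl
  face_act _ _ _ _ := rfl
  ρ_act _ _ _ := rfl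

theorem stdCells_isComplex (G : Type) [Group G] (N : ℕ) : (stdCells G).IsComplex N := by
  intro d _ x _ F
  change (Fin (d + 1) → G) → ZMod 2 at F
  change Fin (d + 3) → G at x
  have h := congrArg (linExt F) (bd_bd (.single x 1))
  simp only [bd_single, map_sum, linExt_single, one_smul, map_zero] at h
  exact h

theorem stdCells_isMap_single (G : Type) [Group G] (N : ℕ) :
    (stdCells G).IsMap N fun _ x => .single x 1 where
  equivariant _ _ _ _ _ := (act_single _ _).symm
  augmented _ _ := aug_single _ _
  boundary _ _ _ _ := bd_single _

/-! ### Cochains on tuples -/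

section Tuples

variable {Y : Type}

/-- The coboundary of a function on tuples. -/
def cob {n : ℕ} (F : (Fin (n + 1) → Y) → ZMod 2) (y : Fin (n + 2) → Y) : ZMod 2 :=
  ∑ p : Fin (n + 2), F (y ∘ p.succAbove)

/-- The cup product of the coboundary of `b` with `F`. -/
def deltaCup {n : ℕ} (b : Y → ZMod 2) (F : (Fin (n + 1) → Y) → ZMod 2) (y : Fin (n + 2) → Y) :
    ZMod 2 :=
  (b (y 0) + b (y 1)) * F (Fin.tail y)

/-- The Leibniz rule: only the face omitting `y 0` has a different first entry, which accounts for
the term with `δ f`. -/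
theorem cob_mul {n : ℕ} (f : Y → ZMod 2) (F : (Fin (n + 1) → Y) → ZMod 2) (y : Fin (n + 2) → Y) :
    cob (fun y => f (y 0) * F y) y = f (y 0) * cob F y + deltaCup f F y := by
  have h2 : (2 : ZMod 2) = 0 := rfl
  simp only [cob, deltaCup, Fin.sum_univ_succ (n := n + 1)]
  have h : ∀ p : Fin (n + 1), (y ∘ p.succ.succAbove) 0 = y 0 := fun p => by simp
  simp only [h, ← Finset.mul_sum]
  have h' : y ∘ (0 : Fin (n + 2)).succAbove = Fin.tail y := by
    funext i
    simp [Fin.tail]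
  rw [h', show Fin.tail y 0 = y 1 from rfl]
  linear_combination (-f (y 0) * F (Fin.tail y)) * h2

theorem cob_deltaCup {n : ℕ} (b : Y → ZMod 2) (F : (Fin (n + 1) → Y) → ZMod 2)
    (y : Fin (n + 3) → Y) : cob (deltaCup b F) y = deltaCup b (cob F) y := by
  have h2 : (2 : ZMod 2) = 0 := rfl
  simp only [cob, deltaCup, Fin.sum_univ_succ (n := n + 2), Fin.sum_univ_succ (n := n + 1)]
  have h : ∀ p : Fin (n + 1), (y ∘ p.succ.succ.succAbove) 0 = y 0 := fun p => by simp
  have h₁ : ∀ p : Fin (n + 1), (y ∘ p.succ.succ.succAbove) 1 = y 1 := fun p => by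
    simp only [Function.comp]
    congr 1
  have h₂ : ∀ p : Fin (n + 1), Fin.tail (y ∘ p.succ.succ.succAbove) =
      Fin.tail y ∘ p.succ.succAbove := fun p => by
    funext i
    simp [Fin.tail]
  have h₃ : Fin.tail (y ∘ (0 : Fin (n + 3)).succAbove) =
      Fin.tail y ∘ (0 : Fin (n + 2)).succAbove := by
    funext i
    simp [Fin.tail]
  have h₄ : Fin.tail (y ∘ (Fin.succ 0 : Fin (n + 3)).succAbove) =
      Fin.tail y ∘ (0 : Fin (n + 2)).succAbove := by
    funext i
    simp [Fin.tail]
  simp only [h, h₁, h₂, h₃, h₄, ← Finset.mul_sum]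
  have e₁ : (y ∘ (0 : Fin (n + 3)).succAbove) 0 = y 1 := rfl
  have e₂ : (y ∘ (0 : Fin (n + 3)).succAbove) 1 = y 2 := rfl
  have e₃ : (y ∘ (Fin.succ 0 : Fin (n + 3)).succAbove) 0 = y 0 := rfl
  have e₄ : (y ∘ (Fin.succ 0 : Fin (n + 3)).succAbove) 1 = y 2 := rfl
  rw [e₁, e₂, e₃, e₄]
  linear_combination (b (y 2) * F (Fin.tail y ∘ (0 : Fin (n + 2)).succAbove)) * h2

/-- The cup product of `a` copies of `δ b₀` followed by `n - a` copies of `δ b₁`; it is zero if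
`n < a`. -/
def cupPow (b₀ b₁ : Y → ZMod 2) : (n a : ℕ) → (Fin (n + 1) → Y) → ZMod 2
  | 0, 0, _ => 1
  | 0, _ + 1, _ => 0
  | n + 1, 0, y => deltaCup b₁ (cupPow b₀ b₁ n 0) y
  | n + 1, a + 1, y => deltaCup b₀ (cupPow b₀ b₁ n a) y

/-- The cup product of `a` copies of `δ b₀`, the function `1 + b₁` and `n - a` copies of `δ b₁`. -/
def cupPow₁ (b₀ b₁ : Y → ZMod 2) : (n a : ℕ) → (Fin (n + 1) → Y) → ZMod 2
  | n, 0, y => (1 + b₁ (y 0)) * cupPow b₀ b₁ n 0 y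
  | 0, _ + 1, _ => 0
  | n + 1, a + 1, y => deltaCup b₀ (cupPow₁ b₀ b₁ n a) y

/-- The cup product of `1 + b₀`, `a` copies of `δ b₀`, the function `1 + b₁` and `n - a` copies of
`δ b₁`. -/
def cupPow₂ (b₀ b₁ : Y → ZMod 2) (n a : ℕ) (y : Fin (n + 1) → Y) : ZMod 2 :=
  (1 + b₀ (y 0)) * cupPow₁ b₀ b₁ n a y

variable (b₀ b₁ : Y → ZMod 2)

theorem cob_cupPow : ∀ (n a : ℕ) (y : Fin (n + 2) → Y), cob (cupPow b₀ b₁ n a) y = 0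
  | 0, 0, y => by simp [cob, cupPow]; decide
  | 0, a + 1, y => by simp [cob, cupPow]
  | n + 1, 0, y => by
    change cob (deltaCup b₁ (cupPow b₀ b₁ n 0)) y = 0
    rw [cob_deltaCup, deltaCup, cob_cupPow n 0, mul_zero]
  | n + 1, a + 1, y => by
    change cob (deltaCup b₀ (cupPow b₀ b₁ n a)) y = 0
    rw [cob_deltaCup, deltaCup, cob_cupPow n a, mul_zero]

theorem deltaCup_one_add (b : Y → ZMod 2) {n : ℕ} (F : (Fin (n + 1) → Y) → ZMod 2) :
    deltaCup (fun y => 1 + b y) F = deltaCup b F := by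
  funext y
  have h2 : (2 : ZMod 2) = 0 := rfl
  simp only [deltaCup]
  linear_combination F (Fin.tail y) * h2

theorem cupPow₁_zero (n : ℕ) (y : Fin (n + 1) → Y) :
    cupPow₁ b₀ b₁ n 0 y = (1 + b₁ (y 0)) * cupPow b₀ b₁ n 0 y := by
  cases n <;> rfl

/-- All factors are cocycles except `1 + b₁`, whose coboundary supplies one more copy of `δ b₁`. -/
theorem cob_cupPow₁ : ∀ (n a : ℕ) (_ : a ≤ n) (y : Fin (n + 2) → Y),
    cob (cupPow₁ b₀ b₁ n a) y = cupPow b₀ b₁ (n + 1) a y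
  | n, 0, _, y => by
    rw [funext (cupPow₁_zero b₀ b₁ n), cob_mul (fun y => 1 + b₁ y), cob_cupPow, deltaCup_one_add,
      mul_zero, zero_add]
    rfl
  | n + 1, a + 1, h, y => by
    change cob (deltaCup b₀ (cupPow₁ b₀ b₁ n a)) y = deltaCup b₀ (cupPow b₀ b₁ (n + 1) a) y
    rw [cob_deltaCup, deltaCup, deltaCup, cob_cupPow₁ n a (by omega)]

theorem cob_cupPow₂ (n a : ℕ) (h : a ≤ n) (y : Fin (n + 2) → Y) :
    cob (cupPow₂ b₀ b₁ n a) y =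
      (1 + b₀ (y 0)) * cupPow b₀ b₁ (n + 1) a y + cupPow₁ b₀ b₁ (n + 1) (a + 1) y := by
  change cob (fun y => (1 + b₀ (y 0)) * cupPow₁ b₀ b₁ n a y) y = _
  rw [cob_mul (fun y => 1 + b₀ y), cob_cupPow₁ _ _ _ _ h, deltaCup_one_add]
  rfl

theorem deltaCup_comp (f : Y → Y) (b : Y → ZMod 2) (r : ZMod 2) (hb : ∀ y, b (f y) = b y + r)
    {n : ℕ} {F F' : (Fin (n + 1) → Y) → ZMod 2} (y : Fin (n + 2) → Y)
    (hF : F (f ∘ Fin.tail y) = F' (Fin.tail y)) :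
    deltaCup b F (f ∘ y) = deltaCup b F' y := by
  have h2 : (2 : ZMod 2) = 0 := rfl
  have : Fin.tail (f ∘ y) = f ∘ Fin.tail y := rfl
  simp only [deltaCup, Function.comp_apply, hb, this, hF]
  linear_combination r * F' (Fin.tail y) * h2

theorem cupPow_comp (f : Y → Y) (r₀ r₁ : ZMod 2) (h₀ : ∀ y, b₀ (f y) = b₀ y + r₀)
    (h₁ : ∀ y, b₁ (f y) = b₁ y + r₁) :
    ∀ (n a : ℕ) (y : Fin (n + 1) → Y), cupPow b₀ b₁ n a (f ∘ y) = cupPow b₀ b₁ n a y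
  | 0, 0, _ => rfl
  | 0, _ + 1, _ => rfl
  | n + 1, 0, y => deltaCup_comp f b₁ r₁ h₁ y (cupPow_comp f r₀ r₁ h₀ h₁ n 0 _)
  | n + 1, a + 1, y => deltaCup_comp f b₀ r₀ h₀ y (cupPow_comp f r₀ r₁ h₀ h₁ n a _)

theorem cupPow₁_comp (f : Y → Y) (r₀ : ZMod 2) (h₀ : ∀ y, b₀ (f y) = b₀ y + r₀)
    (h₁ : ∀ y, b₁ (f y) = b₁ y) :
    ∀ (n a : ℕ) (y : Fin (n + 1) → Y), cupPow₁ b₀ b₁ n a (f ∘ y) = cupPow₁ b₀ b₁ n a y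
  | n, 0, y => by
    rw [cupPow₁_zero, cupPow₁_zero, cupPow_comp b₀ b₁ f r₀ 0 h₀ (by simpa using h₁),
      Function.comp_apply, h₁]
  | 0, a + 1, y => rfl
  | n + 1, a + 1, y => deltaCup_comp f b₀ r₀ h₀ y (cupPow₁_comp f r₀ h₀ h₁ n a _)

/-- The translation changes only the factor `1 + b₁`, by one; the coboundaries do not see constants.
-/
theorem cupPow₁_add_comp (f : Y → Y) (h₀ : ∀ y, b₀ (f y) = b₀ y) (h₁ : ∀ y, b₁ (f y) = b₁ y + 1) :
    ∀ (n a : ℕ) (y : Fin (n + 1) → Y),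
      cupPow₁ b₀ b₁ n a y + cupPow₁ b₀ b₁ n a (f ∘ y) = cupPow b₀ b₁ n a y
  | n, 0, y => by
    have h2 : (2 : ZMod 2) = 0 := rfl
    rw [cupPow₁_zero, cupPow₁_zero, cupPow_comp b₀ b₁ f 0 1 (by simpa using h₀) h₁,
      Function.comp_apply, h₁]
    linear_combination (1 + b₁ (y 0)) * cupPow b₀ b₁ n 0 y * h2
  | 0, a + 1, y => rfl
  | n + 1, a + 1, y => by
    have ih := cupPow₁_add_comp f h₀ h₁ n a (Fin.tail y)
    have : Fin.tail (f ∘ y) = f ∘ Fin.tail y := rfl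
    simp only [cupPow₁, cupPow, deltaCup, Function.comp_apply, h₀, this, ← mul_add, ih]

theorem cupPow₂_add_comp (f : Y → Y) (h₀ : ∀ y, b₀ (f y) = b₀ y + 1) (h₁ : ∀ y, b₁ (f y) = b₁ y)
    (n a : ℕ) (y : Fin (n + 1) → Y) :
    cupPow₂ b₀ b₁ n a y + cupPow₂ b₀ b₁ n a (f ∘ y) = cupPow₁ b₀ b₁ n a y := by
  have h2 : (2 : ZMod 2) = 0 := rfl
  rw [cupPow₂, cupPow₂, cupPow₁_comp b₀ b₁ f 1 h₀ h₁, Function.comp_apply, h₀]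
  linear_combination (1 + b₀ (y 0)) * cupPow₁ b₀ b₁ n a y * h2

end Tuples

end

section

open StdComplex IsMaurerCartan MvPolynomial

/-! ### The alternating group on four letters

The letters are the vectors of `𝔽₂²`, on which the group acts by affine maps. -/

namespace AltFour

/-- The alternating group on four letters. -/
abbrev A4 : Type := alternatingGroup (Fin 4)

/-- The polynomial ring in two variables over the field with two elements. -/
abbrev Poly : Type := MvPolynomial (Fin 2) (ZMod 2)

/-- The first coordinate of a letter. -/
def b₀ : Fin 4 → ZMod 2 := ![0, 0, 1, 1]

/-- The second coordinate of a letter. -/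
def b₁ : Fin 4 → ZMod 2 := ![0, 1, 0, 1]

/-- The translation along the first coordinate. -/
def s : A4 := ⟨Equiv.swap 0 2 * Equiv.swap 1 3, Equiv.Perm.mem_alternatingGroup.2 (by decide)⟩

/-- The translation along the second coordinate. -/
def t : A4 := ⟨Equiv.swap 0 1 * Equiv.swap 2 3, Equiv.Perm.mem_alternatingGroup.2 (by decide)⟩

/-- A linear automorphism of order three. -/
def c : A4 := ⟨Equiv.swap 1 3 * Equiv.swap 3 2, Equiv.Perm.mem_alternatingGroup.2 (by decide)⟩

/-- The action on a letter. -/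
def ap (g : A4) (x : Fin 4) : Fin 4 := (g : Equiv.Perm (Fin 4)) x

theorem b₀_s (x : Fin 4) : b₀ (ap s x) = b₀ x + 1 := by revert x; decide
theorem b₁_s (x : Fin 4) : b₁ (ap s x) = b₁ x := by revert x; decide
theorem b₀_t (x : Fin 4) : b₀ (ap t x) = b₀ x := by revert x; decide
theorem b₁_t (x : Fin 4) : b₁ (ap t x) = b₁ x + 1 := by revert x; decide

/-- The decomposition of the group as a product of the translations and the linear maps. -/
def dec (i : Fin 3 × Fin 2 × Fin 2) : A4 := s ^ (i.2.1 : ℕ) * (t ^ (i.2.2 : ℕ) * c ^ (i.1 : ℕ))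

theorem dec_bijective : Function.Bijective dec := by decide +kernel

/-- The bracketing pairs elements differing by `t` and then by `s`, as needed for summing `cupPow₂`
over the translations. -/
theorem sum_eq {M : Type} [AddCommMonoid M] (F : A4 → M) :
    ∑ g, F g = ∑ i : Fin 3, ((F (c ^ (i : ℕ)) + F (t * c ^ (i : ℕ))) +
      (F (s * c ^ (i : ℕ)) + F (s * (t * c ^ (i : ℕ))))) := by
  rw [← (Equiv.ofBijective dec dec_bijective).sum_comp, Fintype.sum_prod_type]
  refine Finset.sum_congr rfl fun i _ => ?_
  rw [Fintype.sum_prod_type]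
  simp [Fin.sum_univ_two, dec]

/-- The Maurer-Cartan element `x₁ (s + 1) + x₂ (t + 1)`. -/
noncomputable def u : A4 → Poly :=
  Pi.single (M := fun _ => Poly) 1 (X 0 + X 1) +
    (Pi.single (M := fun _ => Poly) s (X 0) + Pi.single (M := fun _ => Poly) t (X 1))

theorem sum_u_smul {M : Type} [AddCommMonoid M] (F : A4 → Poly → M) (hF : ∀ g, F g 0 = 0) :
    ∑ g, F g (u g) = F 1 (X 0 + X 1) + (F s (X 0) + F t (X 1)) := by
  have h1 : u 1 = X 0 + X 1 := by simp [u, show (1 : A4) ≠ s by decide, show (1 : A4) ≠ t by decide]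
  have h2 : u s = X 0 := by simp [u, show s ≠ 1 by decide, show s ≠ t by decide]
  have h3 : u t = X 1 := by simp [u, show t ≠ 1 by decide, show t ≠ s by decide]
  rw [← Finset.sum_subset (Finset.subset_univ {1, s, t}), Finset.sum_insert (by decide),
    Finset.sum_insert (by decide), Finset.sum_singleton, h1, h2, h3]
  intro g _ hg
  simp only [Finset.mem_insert, Finset.mem_singleton, not_or] at hg
  simp [u, hg.1, hg.2.1, hg.2.2, hF]

theorem two_eq_zero : (2 : Poly) = 0 := by
  rw [← map_ofNat (C : ZMod 2 →+* Poly) 2, show (OfNat.ofNat 2 : ZMod 2) = 0 from rfl, map_zero]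

/-- In characteristic two the square is `x₁²(s² + 1) + x₂²(t² + 1)`, the mixed terms cancelling
because `s` and `t` commute; it vanishes since both are involutions. -/
theorem u_isMaurerCartan : IsMaurerCartan u where
  sum_eq_zero := by
    rw [sum_u_smul (fun _ p => p) fun _ => rfl]
    linear_combination (X 0 + X 1) * two_eq_zero
  sum_mul_eq_zero g := by
    rw [sum_u_smul (fun a p => p * u (a⁻¹ * g)) fun _ => zero_mul _]
    -- Products of two elements of the support `{1, s, t}` of `u` are translations; for any other
    -- `g` all terms are zero.
    have h : ∀ g : A4, g = 1 ∨ g = s ∨ g = t ∨ g = s * t ∨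
        ((g ≠ 1 ∧ g ≠ s ∧ g ≠ t) ∧ (s⁻¹ * g ≠ 1 ∧ s⁻¹ * g ≠ s ∧ s⁻¹ * g ≠ t) ∧
          t⁻¹ * g ≠ 1 ∧ t⁻¹ * g ≠ s ∧ t⁻¹ * g ≠ t) := by decide +kernel
    have d₁ : s ≠ 1 := by decide
    have d₂ : t ≠ 1 := by decide
    have d₃ : s ≠ t := by decide
    have d₄ : s * t ≠ 1 := by decide
    have d₅ : s * t ≠ s := by decide
    have d₆ : s * t ≠ t := by decide
    have d₇ : s⁻¹ = s := by decide
    have d₈ : t⁻¹ = t := by decide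
    have d₉ : s * s = 1 := by decide
    have d₀ : t * t = 1 := by decide
    have dc : t * s = s * t := by decide
    rcases h g with rfl | rfl | rfl | rfl | ⟨⟨h1, h2, h3⟩, ⟨h4, h5, h6⟩, h7, h8, h9⟩
    · simp only [u, Pi.add_apply, Pi.single_apply, d₇, d₈, mul_one, inv_one, d₁, d₂, d₃, d₁.symm,
        d₂.symm, d₃.symm, if_true, if_false]
      linear_combination (X 0 * X 0 + X 0 * X 1 + X 1 * X 1) * two_eq_zero
    · simp only [u, Pi.add_apply, Pi.single_apply, d₇, d₈, one_mul, inv_one, d₁, d₂, d₃, d₁.symm,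
        d₂.symm, d₃.symm, d₄, d₅, d₆, d₉, dc, if_true, if_false]
      linear_combination (X 0 * X 0 + X 0 * X 1) * two_eq_zero
    · simp only [u, Pi.add_apply, Pi.single_apply, d₇, d₈, one_mul, inv_one, d₁, d₂, d₁.symm,
        d₂.symm, d₃.symm, d₄, d₅, d₆, d₀, if_true, if_false]
      linear_combination (X 1 * X 1 + X 0 * X 1) * two_eq_zero
    · have e₁ : s * (s * t) = t := by decide
      have e₂ : t * (s * t) = s := by decide
      simp only [u, Pi.add_apply, Pi.single_apply, d₇, d₈, one_mul, inv_one, d₁, d₂, d₃,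
        d₃.symm, d₄, d₅, d₆, e₁, e₂, if_true, if_false]
      linear_combination (X 0 * X 1) * two_eq_zero
    · simp only [u, Pi.add_apply, Pi.single_apply, inv_one, one_mul, h1, h2, h3, h4, h5, h6, h7,
        h8, h9, if_false]
      ring

/-- The exponent of the monomial `x₁ᵃ x₂ᵇ`. -/
noncomputable def mon (a b : ℕ) : Fin 2 →₀ ℕ := Finsupp.single 0 a + Finsupp.single 1 b

theorem mon_apply_zero (a b : ℕ) : mon a b 0 = a := by simp [mon]

theorem mon_apply_one (a b : ℕ) : mon a b 1 = b := by simp [mon]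

theorem eq_mon (m : Fin 2 →₀ ℕ) : m = mon (m 0) (m 1) := by
  ext i
  fin_cases i
  · exact (mon_apply_zero _ _).symm
  · exact (mon_apply_one _ _).symm

theorem coeff_X_zero_mul (a b : ℕ) (p : Poly) : coeff (mon (a + 1) b) (X 0 * p) = coeff (mon a b) p := by
  rw [← coeff_X_mul (mon a b) 0 p]
  congr 1
  rw [eq_mon (Finsupp.single 0 1 + mon a b)]
  simp [mon_apply_zero, mon_apply_one, add_comm]

theorem coeff_X_one_mul (a b : ℕ) (p : Poly) : coeff (mon a (b + 1)) (X 1 * p) = coeff (mon a b) p := by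
  rw [← coeff_X_mul (mon a b) 1 p]
  congr 1
  rw [eq_mon (Finsupp.single 1 1 + mon a b)]
  simp [mon_apply_zero, mon_apply_one, add_comm]

theorem coeff_X_zero_mul_zero (b : ℕ) (p : Poly) : coeff (mon 0 b) (X 0 * p) = 0 := by
  rw [coeff_X_mul', if_neg]
  simp [mon_apply_zero]

theorem coeff_X_one_mul_zero (a : ℕ) (p : Poly) : coeff (mon a 0) (X 1 * p) = 0 := by
  rw [coeff_X_mul', if_neg]
  simp [mon_apply_one]

/-- The letters to which the elements of a tuple send the zero vector. -/
def orb {n : ℕ} (x : Fin n → A4) (i : Fin n) : Fin 4 := ap (x i) 0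

/-- The twisting datum on the standard resolution. -/
noncomputable def stdTwist (d : ℕ) (x : Fin (d + 1) → A4) : Poly →ₗ[ZMod 2] ZMod 2 :=
  ∑ a ∈ Finset.range (d + 1), cupPow₂ b₀ b₁ d a (orb x) • lcoeff (ZMod 2) (mon a (d - a))

theorem stdTwist_apply (d : ℕ) (x : Fin (d + 1) → A4) (p : Poly) :
    stdTwist d x p =
      ∑ a ∈ Finset.range (d + 1), cupPow₂ b₀ b₁ d a (orb x) * coeff (mon a (d - a)) p := by
  simp [stdTwist]

theorem stdTwist_X_zero_mul (d : ℕ) (x : Fin (d + 2) → A4) (p : Poly) :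
    stdTwist (d + 1) x (X 0 * p) =
      ∑ a ∈ Finset.range (d + 1),
        cupPow₂ b₀ b₁ (d + 1) (a + 1) (orb x) * coeff (mon a (d - a)) p := by
  rw [stdTwist_apply, Finset.sum_range_succ', coeff_X_zero_mul_zero, mul_zero, add_zero]
  refine Finset.sum_congr rfl fun a _ => ?_
  rw [show d + 1 - (a + 1) = d - a by omega, coeff_X_zero_mul]

theorem stdTwist_X_one_mul (d : ℕ) (x : Fin (d + 2) → A4) (p : Poly) :
    stdTwist (d + 1) x (X 1 * p) =
      ∑ a ∈ Finset.range (d + 1),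
        cupPow₂ b₀ b₁ (d + 1) a (orb x) * coeff (mon a (d - a)) p := by
  rw [stdTwist_apply, Finset.sum_range_succ, show d + 1 - (d + 1) = 0 by omega,
    coeff_X_one_mul_zero, mul_zero, add_zero]
  refine Finset.sum_congr rfl fun a ha => ?_
  have := Finset.mem_range.1 ha
  rw [show d + 1 - a = d - a + 1 by omega, coeff_X_one_mul]

theorem stdTwist_isTwisting (N : ℕ) : (stdCells A4).IsTwisting N u stdTwist where
  augmented x _ := by
    change Fin 1 → A4 at x
    change ∑ g : A4, stdTwist 0 (fun i => g * x i) 1 = 1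
    have h : ∀ g : A4, stdTwist 0 (fun i => g * x i) 1 =
        (1 + b₀ (ap (g * x 0) 0)) * (1 + b₁ (ap (g * x 0) 0)) := by
      intro g
      rw [stdTwist_apply]
      simp [cupPow₂, cupPow₁, cupPow, mon, orb]
    simp only [h]
    refine (Equiv.sum_comp (Equiv.mulRight (x 0)) fun g =>
      (1 + b₀ (ap g 0)) * (1 + b₁ (ap g 0))).trans ?_
    -- The summand is one exactly on the stabiliser of the letter `0`, which has order three.
    decide +kernel
  boundary d _ x _ p := by
    change Fin (d + 2) → A4 at x
    change ∑ j : Fin (d + 2), stdTwist d (x ∘ j.succAbove) p =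
      ∑ v, stdTwist (d + 1) (fun i => v * x i) (u v * p)
    rw [sum_u_smul (fun v q => stdTwist (d + 1) (fun i => v * x i) (q * p)) fun v => by simp]
    have e₀ : (fun i => (1 : A4) * x i) = x := by simp
    have es : orb (fun i => s * x i) = ap s ∘ orb x := rfl
    have et : orb (fun i => t * x i) = ap t ∘ orb x := rfl
    rw [e₀, add_mul, map_add, add_add_add_comm, stdTwist_X_zero_mul, stdTwist_X_zero_mul,
      stdTwist_X_one_mul, stdTwist_X_one_mul, es, et]
    simp only [stdTwist_apply]
    rw [Finset.sum_comm, ← Finset.sum_add_distrib, ← Finset.sum_add_distrib,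
      ← Finset.sum_add_distrib]
    refine Finset.sum_congr rfl fun a ha => ?_
    have ha' : a ≤ d := by
      have := Finset.mem_range.1 ha
      omega
    -- On the coefficient of `x₁ᵃ x₂^(d-a)`, adding the translate by `s` leaves `cupPow₁` with index
    -- `a + 1`, and adding the translate by `t` leaves `1 + b₀` times `cupPow`. These are the two
    -- terms of `cob_cupPow₂`.
    rw [← Finset.sum_mul, ← add_mul, ← add_mul, ← add_mul,
      cupPow₂_add_comp b₀ b₁ (ap s) b₀_s b₁_s, cupPow₂, cupPow₂, Function.comp_apply, b₀_t,
      ← mul_add, cupPow₁_add_comp b₀ b₁ (ap t) b₀_t b₁_t, add_comm (cupPow₁ _ _ _ _ _)]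
    congr 1
    exact cob_cupPow₂ b₀ b₁ d a ha' (orb x)

end AltFour

end

/-! ### The cohomology embeds in the polynomial ring, with image in the traces. -/

section

open StdComplex IsMaurerCartan MvPolynomial

namespace AltFour

/-- The cochain on the standard resolution defined by a polynomial. -/
noncomputable def stdCochain (n : ℕ) (q : Poly) (w : Fin n → A4) : ZMod 2 :=
  ∑ g, stdTwist n (fun i => g * Fin.partialProd w i) q

theorem evalL_of_invariant {n : ℕ} (f : (Fin (n + 1) → A4) → ZMod 2)
    (hf : ∀ (g : A4) v, f (fun i => g * v i) = f v) (v : Fin (n + 1) → A4) :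
    evalL (fun w => f (Fin.partialProd w)) (.single v 1) = f v := by
  rw [evalL, linExt_single, one_smul]
  conv_rhs => rw [eq_smul_partialProd v, hf]

theorem cd_of_invariant {n : ℕ} (f : (Fin (n + 1) → A4) → ZMod 2)
    (hf : ∀ (g : A4) v, f (fun i => g * v i) = f v) (w : Fin (n + 1) → A4) :
    GroupCup.cd n (fun w => f (Fin.partialProd w)) w =
      ∑ p : Fin (n + 2), f (Fin.partialProd w ∘ p.succAbove) := by
  rw [← evalL_partialProd (GroupCup.cd n _) w, ← evalL_bd, bd_single, map_sum]
  simp only [evalL_of_invariant f hf]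

theorem sum_stdTwist_smul (n : ℕ) (q : Poly) (h : A4) (v : Fin (n + 1) → A4) :
    ∑ g, stdTwist n (fun i => g * (h * v i)) q = ∑ g, stdTwist n (fun i => g * v i) q := by
  refine Eq.trans ?_ (Equiv.sum_comp (Equiv.mulRight h) fun g => stdTwist n (fun i => g * v i) q)
  simp [mul_assoc]

/-- After summation over the group the translations by `v` in the twisting identity are invisible,
and the coboundary becomes multiplication of `q` by the augmentation of `u`. -/
theorem stdCochain_mem (n : ℕ) (q : Poly) : stdCochain n q ∈ GroupCup.Z (ZMod 2) A4 n := by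
  change GroupCup.cd n _ = 0
  funext w
  refine (cd_of_invariant (fun v => ∑ g, stdTwist n (fun i => g * v i) q)
    (fun h v => sum_stdTwist_smul n q h v) w).trans ?_
  rw [Finset.sum_comm]
  have h : ∀ g : A4, ∑ p : Fin (n + 2), stdTwist n
      (fun i => g * (Fin.partialProd w ∘ p.succAbove) i) q =
      ∑ v, stdTwist (n + 1) (fun i => v * (g * Fin.partialProd w i)) (u v * q) := fun g =>
    (stdTwist_isTwisting (n + 1)).boundary n (by omega) (fun i => g * Fin.partialProd w i) trivial q
  simp only [h]
  rw [Finset.sum_comm]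
  have h' : ∀ v : A4, ∑ g, stdTwist (n + 1) (fun i => v * (g * Fin.partialProd w i)) (u v * q) =
      ∑ g, stdTwist (n + 1) (fun i => g * Fin.partialProd w i) (u v * q) := by
    intro v
    refine Eq.trans ?_ (Equiv.sum_comp (Equiv.mulLeft v)
      fun g => stdTwist (n + 1) (fun i => g * Fin.partialProd w i) (u v * q))
    simp [mul_assoc]
  simp only [h']
  rw [Finset.sum_comm]
  refine Finset.sum_eq_zero fun g _ => ?_
  rw [← map_sum, ← Finset.sum_mul, u_isMaurerCartan.sum_eq_zero, zero_mul, map_zero]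

/-- The cocycle defined by a polynomial. -/
noncomputable def stdCocycle (n : ℕ) (q : Poly) : GroupCup.Z (ZMod 2) A4 n :=
  ⟨stdCochain n q, stdCochain_mem n q⟩

/-- The identity and the map given by `stdTwist` are both augmented chain maps of the standard
resolution to itself, so the pull-backs of `z` along them are cohomologous. -/
theorem cls_eq_cls_stdCocycle {n : ℕ} (z : GroupCup.Z (ZMod 2) A4 n) :
    GroupCup.cls (ZMod 2) A4 n z = GroupCup.cls (ZMod 2) A4 n (stdCocycle n (phi u n z.1)) := by
  have hid := stdCells_isMap_single A4 n
  have hpsi := (stdTwist_isTwisting n).isMap u_isMaurerCartan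
  have e : ∀ w, evalL z.1 (CellComplex.psi (C := stdCells A4) u stdTwist n (Fin.partialProd w)) =
      stdCochain n (phi u n z.1) w := fun w => CellComplex.evalL_psi _ _ _
  obtain _ | n := n
  · congr 1
    refine Subtype.ext (funext fun w => ?_)
    rw [← evalL_partialProd z.1 w]
    exact (CellComplex.evalL_eq_zero hid hpsi z (Fin.partialProd w) trivial).trans (e w)
  · obtain ⟨f, hf, h⟩ := CellComplex.exists_evalL_eq_succ (stdCells_isComplex A4 (n + 1)) hid hpsi n
      le_rfl z
    change (Fin (n + 1) → A4) → ZMod 2 at f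
    rw [← sub_eq_zero, ← map_sub, GroupCup.cls_eq_zero_iff]
    refine Or.inr ⟨n, rfl, fun w => f (Fin.partialProd w), funext fun w => ?_⟩
    refine Eq.trans ?_ (cd_of_invariant f (fun g v => hf g v trivial) w).symm
    have := h (Fin.partialProd w) trivial
    rw [e, evalL_partialProd] at this
    exact sub_eq_iff_eq_add'.2 this

theorem phiH_injective (n : ℕ) : Function.Injective (u_isMaurerCartan.phiH n) := by
  rw [injective_iff_map_eq_zero]
  intro c hc
  obtain ⟨z, rfl⟩ := GroupCup.cls_surjective _ _ _ c
  rw [phiH_cls] at hc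
  rw [cls_eq_cls_stdCocycle, hc]
  have : stdCocycle n 0 = 0 := by
    refine Subtype.ext (funext fun w => ?_)
    simp [stdCocycle, stdCochain]
  rw [this, map_zero]

theorem wt_isHomogeneous {n : ℕ} (w : Fin n → A4) : (wt u w).IsHomogeneous n := by
  have hu : ∀ g, (u g).IsHomogeneous 1 := by
    intro g
    have h : ∀ (h : A4) (p : Poly), p.IsHomogeneous 1 →
        (Pi.single (M := fun _ => Poly) h p g).IsHomogeneous 1 := by
      intro h p hp
      rw [Pi.single_apply]
      split_ifs
      · exact hp
      · exact isHomogeneous_zero _ _ _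
    exact ((h _ _ ((isHomogeneous_X _ _).add (isHomogeneous_X _ _))).add
      ((h _ _ (isHomogeneous_X _ _)).add (h _ _ (isHomogeneous_X _ _))))
  have := IsHomogeneous.prod Finset.univ (fun i => u (w i)) (fun _ => 1) fun i _ => hu _
  simpa [wt] using this

theorem phi_isHomogeneous {n : ℕ} (z : (Fin n → A4) → ZMod 2) : (phi u n z).IsHomogeneous n := by
  refine IsHomogeneous.sum _ _ _ fun w _ => ?_
  rw [smul_eq_C_mul]
  simpa using (isHomogeneous_C (Fin 2) (z w)).mul (wt_isHomogeneous w)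

theorem eq_sum_of_isHomogeneous {n : ℕ} {q : Poly} (hq : q.IsHomogeneous n) :
    q = ∑ a ∈ Finset.range (n + 1), coeff (mon a (n - a)) q • (X 0 ^ a * X 1 ^ (n - a)) := by
  have hm : ∀ a b : ℕ, (X 0 ^ a * X 1 ^ b : Poly) = monomial (mon a b) 1 := by
    intro a b
    rw [mon, X_pow_eq_monomial, X_pow_eq_monomial, monomial_mul, one_mul]
  ext m
  rw [coeff_sum]
  simp only [hm, coeff_smul, coeff_monomial, smul_eq_mul, mul_ite, mul_one, mul_zero]
  by_cases h : m 0 + m 1 = n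
  · have e : m = mon (m 0) (n - m 0) := by
      conv_lhs => rw [eq_mon m]
      congr 1
      omega
    rw [Finset.sum_eq_single (m 0)]
    · rw [if_pos e.symm, ← e]
    · intro b _ hb
      rw [if_neg]
      rintro rfl
      exact hb (mon_apply_zero _ _).symm
    · intro hb
      exact absurd (Finset.mem_range.2 (by omega)) hb
  · rw [hq.coeff_eq_zero, Finset.sum_eq_zero]
    · intro a ha
      rw [if_neg]
      rintro rfl
      have := Finset.mem_range.1 ha
      rw [mon_apply_zero, mon_apply_one] at h
      omega
    · rw [Finsupp.degree_eq_sum]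
      simpa using h

/-- The translations. -/
def IsTrans (v : A4) : Prop := v = 1 ∨ v = s ∨ v = t ∨ v = s * t

instance : DecidablePred IsTrans := fun v => by unfold IsTrans; infer_instance

theorem isTrans_mul (v : A4) (hv : IsTrans v) : IsTrans (v * 1) ∧ IsTrans (v * s) ∧ IsTrans (v * t) := by
  revert v
  decide +kernel

/-- Each factor `δ b` contributes a linear form. Only the letters `1`, `s`, `t` have weight, and the
increment of `b` along such a letter is `0` for `1` and independent of the translation `v`
otherwise. All `v` are needed because splitting off the first letter `g` replaces `v` by `v * g`. -/
theorem sum_cupPow (i : Fin 3) (n a : ℕ) (h : a ≤ n) (v : A4) (hv : IsTrans v) :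
    ∑ w : Fin n → A4, cupPow b₀ b₁ n a (orb fun j => c ^ (i : ℕ) * (v * Fin.partialProd w j)) •
      wt u w =
    (b₀ (ap (c ^ (i : ℕ) * s) 0) • X 0 + b₀ (ap (c ^ (i : ℕ) * t) 0) • X 1) ^ a *
      (b₁ (ap (c ^ (i : ℕ) * s) 0) • X 0 + b₁ (ap (c ^ (i : ℕ) * t) 0) • X 1) ^ (n - a) := by
  have hb : ∀ b ∈ ({b₀, b₁} : Set (Fin 4 → ZMod 2)), ∀ (i : Fin 3) (v : A4), IsTrans v →
      b (ap (c ^ (i : ℕ) * (v * 1)) 0) + b (ap (c ^ (i : ℕ) * (v * 1)) 0) = 0 ∧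
      b (ap (c ^ (i : ℕ) * (v * 1)) 0) + b (ap (c ^ (i : ℕ) * (v * s)) 0) =
        b (ap (c ^ (i : ℕ) * s) 0) ∧
      b (ap (c ^ (i : ℕ) * (v * 1)) 0) + b (ap (c ^ (i : ℕ) * (v * t)) 0) =
        b (ap (c ^ (i : ℕ) * t) 0) := by
    rintro b (rfl | rfl) <;> decide +kernel
  have key : ∀ b ∈ ({b₀, b₁} : Set (Fin 4 → ZMod 2)), ∀ (m a : ℕ) (Q : Poly) (v : A4),
      IsTrans v → (∀ v, IsTrans v → ∑ w : Fin m → A4, cupPow b₀ b₁ m a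
        (orb fun j => c ^ (i : ℕ) * (v * Fin.partialProd w j)) • wt u w = Q) →
      ∑ w : Fin (m + 1) → A4, deltaCup b (cupPow b₀ b₁ m a)
        (orb fun j => c ^ (i : ℕ) * (v * Fin.partialProd w j)) • wt u w =
      (b (ap (c ^ (i : ℕ) * s) 0) • X 0 + b (ap (c ^ (i : ℕ) * t) 0) • X 1) * Q := by
    intro b hbm m a Q v hv ih
    rw [Fin.sum_univ_cons]
    have e : ∀ (g : A4) (w : Fin m → A4), deltaCup b (cupPow b₀ b₁ m a)
        (orb fun j => c ^ (i : ℕ) * (v * Fin.partialProd (Fin.cons g w : Fin (m + 1) → A4) j)) =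
        (b (ap (c ^ (i : ℕ) * (v * 1)) 0) + b (ap (c ^ (i : ℕ) * (v * g)) 0)) *
          cupPow b₀ b₁ m a (orb fun j => c ^ (i : ℕ) * (v * g * Fin.partialProd w j)) := by
      intro g w
      have e₁ : ∀ j : Fin (m + 1), Fin.partialProd (Fin.cons g w : Fin (m + 1) → A4) j.succ =
          g * Fin.partialProd w j := by
        intro j
        rw [Fin.partialProd_succ']
        rfl
      rw [deltaCup]
      congr 1
      · congr 2
        simp only [orb]
        rw [show (1 : Fin (m + 2)) = Fin.succ 0 from rfl, e₁, Fin.partialProd_zero, mul_one]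
      · congr 1
        funext j
        simp only [Fin.tail, orb, e₁, mul_assoc]
    simp only [e, wt_cons]
    have e₂ : ∀ g : A4, ∑ w : Fin m → A4,
        ((b (ap (c ^ (i : ℕ) * (v * 1)) 0) + b (ap (c ^ (i : ℕ) * (v * g)) 0)) *
          cupPow b₀ b₁ m a (orb fun j => c ^ (i : ℕ) * (v * g * Fin.partialProd w j))) •
            (u g * wt u w) =
        u g * ((b (ap (c ^ (i : ℕ) * (v * 1)) 0) + b (ap (c ^ (i : ℕ) * (v * g)) 0)) •
          ∑ w : Fin m → A4,
            cupPow b₀ b₁ m a (orb fun j => c ^ (i : ℕ) * (v * g * Fin.partialProd w j)) •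
              wt u w) := by
      intro g
      rw [Finset.smul_sum, Finset.mul_sum]
      refine Finset.sum_congr rfl fun w _ => ?_
      rw [mul_smul, mul_smul_comm, mul_smul_comm]
    simp only [e₂]
    obtain ⟨t₁, t₂, t₃⟩ := isTrans_mul v hv
    obtain ⟨f₁, f₂, f₃⟩ := hb b hbm i v hv
    rw [sum_u_smul (fun g p => p * ((b (ap (c ^ (i : ℕ) * (v * 1)) 0) +
      b (ap (c ^ (i : ℕ) * (v * g)) 0)) • ∑ w : Fin m → A4,
        cupPow b₀ b₁ m a (orb fun j => c ^ (i : ℕ) * (v * g * Fin.partialProd w j)) • wt u w))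
      fun g => zero_mul _, ih _ t₁, ih _ t₂, ih _ t₃, f₁, f₂, f₃, zero_smul, mul_zero, zero_add]
    simp only [smul_eq_C_mul]
    ring
  induction n generalizing a v with
  | zero =>
    obtain rfl : a = 0 := by omega
    simp [cupPow, wt]
  | succ n ih =>
    obtain _ | a := a
    · refine (key b₁ (by simp) n 0 _ v hv fun v hv => ih 0 (by omega) v hv).trans ?_
      simp only [pow_zero, one_mul, Nat.sub_zero]
      ring
    · refine (key b₀ (by simp) n a _ v hv fun v hv => ih a (by omega) v hv).trans ?_
      rw [show n + 1 - (a + 1) = n - a by omega]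
      ring

/-- The trace of the action of the cyclic group of order three. -/
noncomputable def trace (q : Poly) : Poly := q + (cyclicShift q + cyclicShift (cyclicShift q))

theorem stdCochain_apply (n : ℕ) (q : Poly) (w : Fin n → A4) :
    stdCochain n q w = ∑ a ∈ Finset.range (n + 1), ∑ i : Fin 3,
      coeff (mon a (n - a)) q *
        cupPow b₀ b₁ n a (orb fun j => c ^ (i : ℕ) * (1 * Fin.partialProd w j)) := by
  simp only [stdCochain, stdTwist_apply]
  rw [Finset.sum_comm]
  refine Finset.sum_congr rfl fun a _ => ?_
  rw [← Finset.sum_mul, sum_eq, Finset.sum_mul]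
  refine Finset.sum_congr rfl fun i _ => ?_
  have h : ∀ g h : A4, (orb fun j => g * h * Fin.partialProd w j) =
      ap g ∘ orb fun j => h * Fin.partialProd w j := fun g h => rfl
  have h' : (orb fun j => s * (t * c ^ (i : ℕ)) * Fin.partialProd w j) =
      ap s ∘ ap t ∘ orb fun j => c ^ (i : ℕ) * Fin.partialProd w j := rfl
  rw [h', h t, h s, add_add_add_comm, cupPow₂_add_comp b₀ b₁ (ap s) b₀_s b₁_s,
    cupPow₂_add_comp b₀ b₁ (ap s) b₀_s b₁_s, cupPow₁_add_comp b₀ b₁ (ap t) b₀_t b₁_t, mul_comm]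
  simp only [one_mul]

/-- For the three powers of `c` the linear forms of `sum_cupPow` are `(x₁, x₂)`, `(x₂, x₁ + x₂)` and
`(x₁ + x₂, x₁)`, the iterates of `cyclicShift` on the variables. -/
theorem phi_stdCochain (n : ℕ) (q : Poly) (hq : q.IsHomogeneous n) :
    phi u n (stdCochain n q) = trace q := by
  have e₀ : ∀ b : Fin 4 → ZMod 2, ∀ x y : Fin 4, ∀ p r : Poly,
      b x • p + b y • r = C (b x) * p + C (b y) * r := fun b x y p r => by
    rw [smul_eq_C_mul, smul_eq_C_mul]
  have x0 : cyclicShift (X 0) = X 1 := by simp [cyclicShift]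
  have x1 : cyclicShift (X 1) = X 0 + X 1 := by simp [cyclicShift]
  have key : ∀ a ≤ n, ∑ w : Fin n → A4, ∑ i : Fin 3,
      cupPow b₀ b₁ n a (orb fun j => c ^ (i : ℕ) * (1 * Fin.partialProd w j)) • wt u w =
      trace (X 0 ^ a * X 1 ^ (n - a)) := by
    intro a ha
    rw [Finset.sum_comm]
    simp only [sum_cupPow _ n a ha 1 (Or.inl rfl)]
    rw [Fin.sum_univ_three, trace, map_mul, map_pow, map_pow, x0, x1, map_mul, map_pow, map_pow,
      map_add, x0, x1]
    have f₁ : b₀ (ap (c ^ ((0 : Fin 3) : ℕ) * s) 0) = 1 := by decide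
    have f₂ : b₀ (ap (c ^ ((0 : Fin 3) : ℕ) * t) 0) = 0 := by decide
    have f₃ : b₁ (ap (c ^ ((0 : Fin 3) : ℕ) * s) 0) = 0 := by decide
    have f₄ : b₁ (ap (c ^ ((0 : Fin 3) : ℕ) * t) 0) = 1 := by decide
    have f₅ : b₀ (ap (c ^ ((1 : Fin 3) : ℕ) * s) 0) = 0 := by decide
    have f₆ : b₀ (ap (c ^ ((1 : Fin 3) : ℕ) * t) 0) = 1 := by decide
    have f₇ : b₁ (ap (c ^ ((1 : Fin 3) : ℕ) * s) 0) = 1 := by decide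
    have f₈ : b₁ (ap (c ^ ((1 : Fin 3) : ℕ) * t) 0) = 1 := by decide
    have f₉ : b₀ (ap (c ^ ((2 : Fin 3) : ℕ) * s) 0) = 1 := by decide
    have g₁ : b₀ (ap (c ^ ((2 : Fin 3) : ℕ) * t) 0) = 1 := by decide
    have g₂ : b₁ (ap (c ^ ((2 : Fin 3) : ℕ) * s) 0) = 1 := by decide
    have g₃ : b₁ (ap (c ^ ((2 : Fin 3) : ℕ) * t) 0) = 0 := by decide
    have g₄ : (X 1 + (X 0 + X 1) : Poly) = X 0 := by linear_combination X 1 * two_eq_zero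
    rw [f₁, f₂, f₃, f₄, f₅, f₆, f₇, f₈, f₉, g₁, g₂, g₃, g₄]
    simp only [one_smul, zero_smul, add_zero, zero_add]
    ring
  have htr : ∀ (r : ZMod 2) (p : Poly), trace (r • p) = r • trace p := by
    intro r p
    simp [trace]
  have htr' : ∀ (S : Finset ℕ) (f : ℕ → Poly), trace (∑ a ∈ S, f a) = ∑ a ∈ S, trace (f a) := by
    intro S f
    simp [trace, Finset.sum_add_distrib]
  conv_rhs => rw [eq_sum_of_isHomogeneous hq]
  rw [htr', phi_apply]
  simp only [stdCochain_apply, Finset.sum_smul, mul_smul]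
  rw [Finset.sum_comm]
  refine Finset.sum_congr rfl fun a ha => ?_
  rw [htr, ← key a (by have := Finset.mem_range.1 ha; omega), Finset.smul_sum]
  simp only [Finset.smul_sum]

/-- The image of a class under `phi` is its own trace. -/
theorem trace_phi {n : ℕ} (z : GroupCup.Z (ZMod 2) A4 n) : trace (phi u n z.1) = phi u n z.1 := by
  have h := congrArg (u_isMaurerCartan.phiH n) (cls_eq_cls_stdCocycle z)
  rw [phiH_cls, phiH_cls] at h
  exact (phi_stdCochain n _ (phi_isHomogeneous z.1)).symm.trans h.symm

end AltFour

end

section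

open MvPolynomial

namespace AltFour

/-! ### The ring of invariants -/

/-- The invariant of degree two. -/
noncomputable def qA : Poly := X 0 ^ 2 + X 0 * X 1 + X 1 ^ 2

/-- The first invariant of degree three. -/
noncomputable def qBp : Poly := X 0 ^ 3 + X 0 ^ 2 * X 1 + X 1 ^ 3

/-- The second invariant of degree three. -/
noncomputable def qBm : Poly := X 0 ^ 3 + X 0 * X 1 ^ 2 + X 1 ^ 3

/-- The Dickson invariant of degree three. -/
noncomputable def qD : Poly := X 0 ^ 2 * X 1 + X 0 * X 1 ^ 2

theorem qD_eq : qD = qBp + qBm := by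
  simp only [qD, qBp, qBm]
  linear_combination (-X 0 ^ 3 - X 1 ^ 3 : Poly) * two_eq_zero

theorem qBp_mul_qBm : qBp * qBm = qBp ^ 2 + qBm ^ 2 + qA ^ 3 := by
  have h2 := two_eq_zero
  simp only [qA, qBp, qBm]
  grind

theorem cyclicShift_X_zero : cyclicShift (X 0) = X 1 := by simp [cyclicShift]

theorem cyclicShift_X_one : cyclicShift (X 1) = X 0 + X 1 := by simp [cyclicShift]

theorem cyclicShift_qA : cyclicShift qA = qA := by
  have h2 := two_eq_zero
  simp only [qA, map_add, map_mul, map_pow, cyclicShift_X_zero, cyclicShift_X_one]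
  grind

theorem cyclicShift_qBp : cyclicShift qBp = qBp := by
  have h2 := two_eq_zero
  simp only [qBp, map_add, map_mul, map_pow, cyclicShift_X_zero, cyclicShift_X_one]
  grind

theorem cyclicShift_qBm : cyclicShift qBm = qBm := by
  have h2 := two_eq_zero
  simp only [qBm, map_add, map_mul, map_pow, cyclicShift_X_zero, cyclicShift_X_one]
  grind

theorem trace_of_cyclicShift {q : Poly} (h : cyclicShift q = q) : trace q = q := by
  rw [trace, h, h]
  linear_combination q * two_eq_zero

theorem cyclicShift_trace (q : Poly) : cyclicShift (trace q) = trace q := by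
  have h3 : (cyclicShift.comp (cyclicShift.comp cyclicShift)) = AlgHom.id (ZMod 2) Poly := by
    refine MvPolynomial.algHom_ext fun i => ?_
    fin_cases i
    · change cyclicShift (cyclicShift (cyclicShift (X 0))) = X 0
      rw [cyclicShift_X_zero, cyclicShift_X_one, map_add, cyclicShift_X_zero, cyclicShift_X_one]
      linear_combination (X 1 : Poly) * two_eq_zero
    · change cyclicShift (cyclicShift (cyclicShift (X 1))) = X 1
      rw [cyclicShift_X_one, map_add, map_add, cyclicShift_X_zero, cyclicShift_X_one, map_add,
        cyclicShift_X_zero, cyclicShift_X_one]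
      linear_combination (X 0 + X 1 : Poly) * two_eq_zero
  have h4 : cyclicShift (cyclicShift (cyclicShift q)) = q := AlgHom.congr_fun h3 q
  rw [trace, map_add, map_add, h4]
  ring

/-- The polynomials in the two Dickson invariants. -/
noncomputable abbrev dickson : Subalgebra (ZMod 2) Poly := Algebra.adjoin (ZMod 2) {qA, qD}

/-- The span is closed under the variables because `x₁³ = qA x₁ + qD`, `x₂² = qA + x₁² + x₁x₂` and
`x₁x₂² = x₁²x₂ + qD`. Only spanning is needed, not freeness. -/
theorem exists_dickson_coeffs (p : Poly) : ∃ c₀ ∈ dickson, ∃ c₁ ∈ dickson, ∃ c₂ ∈ dickson,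
    ∃ c₃ ∈ dickson, ∃ c₄ ∈ dickson, ∃ c₅ ∈ dickson,
      p = c₀ + c₁ * X 0 + c₂ * X 1 + c₃ * X 0 ^ 2 + c₄ * (X 0 * X 1) + c₅ * (X 0 ^ 2 * X 1) := by
  have hA : qA ∈ dickson := Algebra.subset_adjoin (by simp)
  have hD : qD ∈ dickson := Algebra.subset_adjoin (by simp)
  have h2 := two_eq_zero
  induction p using MvPolynomial.induction_on with
  | C r =>
    have hr : (C r : Poly) ∈ dickson := dickson.algebraMap_mem r
    exact ⟨C r, hr, 0, zero_mem _, 0, zero_mem _, 0, zero_mem _, 0, zero_mem _, 0, zero_mem _,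
      by ring⟩
  | add p q hp hq =>
    obtain ⟨c₀, h₀, c₁, h₁, c₂, h₂, c₃, h₃, c₄, h₄, c₅, h₅, rfl⟩ := hp
    obtain ⟨d₀, k₀, d₁, k₁, d₂, k₂, d₃, k₃, d₄, k₄, d₅, k₅, rfl⟩ := hq
    exact ⟨_, add_mem h₀ k₀, _, add_mem h₁ k₁, _, add_mem h₂ k₂, _, add_mem h₃ k₃, _,
      add_mem h₄ k₄, _, add_mem h₅ k₅, by ring⟩
  | mul_X p i hp =>
    obtain ⟨c₀, h₀, c₁, h₁, c₂, h₂, c₃, h₃, c₄, h₄, c₅, h₅, rfl⟩ := hp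
    fin_cases i
    · refine ⟨_, mul_mem h₃ hD, _, add_mem h₀ (mul_mem h₃ hA), _, mul_mem h₅ hD, _, h₁, _,
        add_mem h₂ (mul_mem h₅ hA), _, h₄, ?_⟩
      simp only [qA, qD, Fin.zero_eta]
      grind
    · refine ⟨_, add_mem (mul_mem h₂ hA) (mul_mem h₄ hD), _, mul_mem h₅ hD, _,
        add_mem h₀ (mul_mem h₅ hD), _, h₂, _, add_mem (add_mem h₁ h₂) (mul_mem h₅ hA), _,
        add_mem h₃ h₄, ?_⟩
      simp only [qA, qD, Fin.mk_one]
      grind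

theorem cyclicShift_of_mem_dickson {p : Poly} (hp : p ∈ dickson) : cyclicShift p = p := by
  have : dickson ≤ AlgHom.equalizer cyclicShift (AlgHom.id (ZMod 2) Poly) := by
    refine Algebra.adjoin_le ?_
    rintro x (rfl | rfl)
    · exact cyclicShift_qA
    · change cyclicShift qD = qD
      rw [qD_eq, map_add, cyclicShift_qBp, cyclicShift_qBm]
  exact this hp

theorem dickson_le : dickson ≤ Algebra.adjoin (ZMod 2) {qA, qBp, qBm} := by
  refine Algebra.adjoin_le ?_
  rintro x (rfl | rfl)
  · exact Algebra.subset_adjoin (by simp)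
  · rw [qD_eq]
    exact add_mem (Algebra.subset_adjoin (by simp)) (Algebra.subset_adjoin (by simp))

/-- The ring of invariants is generated by `qA`, `qBp` and `qBm`. -/
theorem invariantsC3_eq : invariantsC3 = Algebra.adjoin (ZMod 2) {qA, qBp, qBm} := by
  apply le_antisymm
  · intro p hp
    have hp' : cyclicShift p = p := hp
    rw [← trace_of_cyclicShift hp']
    obtain ⟨c₀, h₀, c₁, h₁, c₂, h₂, c₃, h₃, c₄, h₄, c₅, h₅, e⟩ := exists_dickson_coeffs p
    -- The trace is linear over the Dickson algebra. It kills `x₁`, `x₂`, `x₁²`, fixes `1`, and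
    -- sends `x₁x₂` to `qA` and `x₁²x₂` to `qBp`.
    have h : trace p = c₀ + c₄ * qA + c₅ * qBp := by
      have k2 := two_eq_zero
      rw [trace, e]
      simp only [map_add, map_mul, map_pow, cyclicShift_X_zero, cyclicShift_X_one,
        cyclicShift_of_mem_dickson h₀, cyclicShift_of_mem_dickson h₁,
        cyclicShift_of_mem_dickson h₂, cyclicShift_of_mem_dickson h₃,
        cyclicShift_of_mem_dickson h₄, cyclicShift_of_mem_dickson h₅, qA, qBp]
      clear e h₀ h₁ h₂ h₃ h₄ h₅
      grind
    rw [h]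
    exact add_mem (add_mem (dickson_le h₀) (mul_mem (dickson_le h₄)
      (Algebra.subset_adjoin (by simp)))) (mul_mem (dickson_le h₅) (Algebra.subset_adjoin (by simp)))
  · refine Algebra.adjoin_le ?_
    rintro x (rfl | rfl | rfl)
    · exact cyclicShift_qA
    · exact cyclicShift_qBp
    · exact cyclicShift_qBm

/-- The polynomial ring has transcendence degree two and is integral over the subalgebra generated
by these two elements. -/
theorem algebraicIndependent_dickson : AlgebraicIndependent (ZMod 2) ![qA, qD] := by
  have hr : Set.range ![qA, qD] = {qA, qD} := by
    simp [Matrix.range_cons, Set.pair_comm]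
  have hA : qA ∈ dickson := Algebra.subset_adjoin (by simp)
  have hD : qD ∈ dickson := Algebra.subset_adjoin (by simp)
  have hint : ∀ i : Fin 2, IsIntegral dickson (X i : Poly) := by
    intro i
    -- This is the product of `T + ℓ` over the nonzero linear forms `ℓ = x₁, x₂, x₁ + x₂`.
    refine ⟨Polynomial.X ^ 3 + (Polynomial.C ⟨qA, hA⟩ * Polynomial.X + Polynomial.C ⟨qD, hD⟩), ?_,
      ?_⟩
    · monicity!
    · have h2 := two_eq_zero
      simp only [Polynomial.eval₂_add, Polynomial.eval₂_pow, Polynomial.eval₂_X,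
        Polynomial.eval₂_mul, Polynomial.eval₂_C]
      change X i ^ 3 + (qA * X i + qD) = 0
      simp only [qA, qD]
      fin_cases i
      · simp only [Fin.zero_eta]
        grind
      · simp only [Fin.mk_one]
        grind
  have hall : Algebra.IsIntegral dickson Poly := ⟨fun p => by
    induction p using MvPolynomial.induction_on with
    | C r => exact isIntegral_algebraMap (A := Poly) (x := (⟨C r, dickson.algebraMap_mem r⟩ : dickson))
    | add p q hp hq => exact hp.add hq
    | mul_X p i hp => exact hp.mul (hint i)⟩
  have halg : Algebra.IsAlgebraic (Algebra.adjoin (ZMod 2) (Set.range ![qA, qD])) Poly := by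
    rw [hr]
    infer_instance
  refine (Algebra.IsAlgebraic.isTranscendenceBasis_of_le_trdeg_of_finite (ZMod 2) ![qA, qD] ?_).1
  rw [MvPolynomial.trdeg_of_isDomain]
  simp

/-- The relation between the generators. -/
noncomputable def rel : MvPolynomial (Fin 3) (ZMod 2) :=
  X 1 * X 2 - (X 1 ^ 2 + X 2 ^ 2 + X 0 ^ 3)

/-- The evaluation at the generators. -/
noncomputable def evGen : MvPolynomial (Fin 3) (ZMod 2) →ₐ[ZMod 2] Poly := aeval ![qA, qBp, qBm]

/-- The embedding of the polynomials in the Dickson invariants. -/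
noncomputable def dicksonEmb : Poly →ₐ[ZMod 2] MvPolynomial (Fin 3) (ZMod 2) :=
  aeval ![X 0, X 1 + X 2]

/-- With `D = B₊ + B₋` the relation reads `B₊² = D B₊ + D² + A³`, which reduces every polynomial to
degree at most one in `B₊`. -/
theorem exists_normal_form (P : MvPolynomial (Fin 3) (ZMod 2)) : ∃ p q : Poly,
    P - (dicksonEmb p + dicksonEmb q * X 1) ∈ Ideal.span {rel} := by
  have h2 : (2 : MvPolynomial (Fin 3) (ZMod 2)) = 0 := by
    rw [← map_ofNat (C : ZMod 2 →+* MvPolynomial (Fin 3) (ZMod 2)) 2,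
      show (OfNat.ofNat 2 : ZMod 2) = 0 from rfl, map_zero]
  have e0 : dicksonEmb (X 0) = X 0 := by simp [dicksonEmb]
  have e1 : dicksonEmb (X 1) = X 1 + X 2 := by simp [dicksonEmb]
  induction P using MvPolynomial.induction_on with
  | C r => exact ⟨C r, 0, by simp [dicksonEmb]⟩
  | add P Q hP hQ =>
    obtain ⟨p, q, h⟩ := hP
    obtain ⟨p', q', h'⟩ := hQ
    refine ⟨p + p', q + q', ?_⟩
    convert add_mem h h' using 1
    simp only [map_add]
    ring
  | mul_X P i hP =>
    obtain ⟨p, q, h⟩ := hP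
    obtain ⟨r, h⟩ := Ideal.mem_span_singleton.1 h
    have hP : P = rel * r + (dicksonEmb p + dicksonEmb q * X 1) := by rw [← h]; ring
    fin_cases i
    · refine ⟨p * X 0, q * X 0, Ideal.mem_span_singleton.2 ⟨r * X 0, ?_⟩⟩
      simp only [map_mul, e0, hP, Fin.zero_eta]
      ring
    · refine ⟨q * (X 1 ^ 2 + X 0 ^ 3), p + q * X 1,
        Ideal.mem_span_singleton.2 ⟨r * X 1 + dicksonEmb q, ?_⟩⟩
      simp only [map_mul, map_add, map_pow, e0, e1, hP, Fin.mk_one, rel]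
      linear_combination (-2 * dicksonEmb q * X 1 * X 2) * h2
    · refine ⟨q * (X 1 ^ 2 + X 0 ^ 3) + p * X 1, p + q * X 1 + q * X 1,
        Ideal.mem_span_singleton.2 ⟨r * X 2 + dicksonEmb q, ?_⟩⟩
      simp only [map_mul, map_add, map_pow, e0, e1, hP, Fin.reduceFinMk, rel]
      grind

theorem evGen_dicksonEmb (p : Poly) : evGen (dicksonEmb p) = aeval ![qA, qD] p := by
  have : evGen.comp dicksonEmb = aeval ![qA, qD] := by
    refine MvPolynomial.algHom_ext fun i => ?_
    fin_cases i <;> simp [evGen, dicksonEmb, qD_eq]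
  exact AlgHom.congr_fun this p

theorem swap_aeval (p : Poly) :
    aeval ![X 1, X 0] (aeval ![qA, qD] p : Poly) = (aeval ![qA, qD] p : Poly) := by
  have : (aeval ![X 1, X 0] : Poly →ₐ[ZMod 2] Poly).comp (aeval ![qA, qD]) = aeval ![qA, qD] := by
    refine MvPolynomial.algHom_ext fun i => ?_
    fin_cases i
    · simp [qA]
      ring
    · simp [qD]
      ring
  exact AlgHom.congr_fun this p

theorem qD_ne_zero : qD ≠ 0 := by
  have := algebraicIndependent_dickson.ne_zero 1
  simpa using this

/-- The relation generates the ideal of relations between the generators. -/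
theorem ker_evGen : RingHom.ker evGen = Ideal.span {rel} := by
  apply le_antisymm
  · intro P hP
    obtain ⟨p, q, h⟩ := exists_normal_form P
    have hrel : evGen rel = 0 := by
      simp [rel, evGen, qBp_mul_qBm]
    have hmem : ∀ Q ∈ Ideal.span {rel}, evGen Q = 0 := by
      intro Q hQ
      obtain ⟨r, rfl⟩ := Ideal.mem_span_singleton.1 hQ
      rw [map_mul, hrel, zero_mul]
    have h0 := hmem _ h
    have hX : evGen (X 1) = qBp := by simp [evGen]
    rw [map_sub, (RingHom.mem_ker).1 hP, zero_sub, neg_eq_zero, map_add, map_mul,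
      evGen_dicksonEmb, evGen_dicksonEmb, hX] at h0
    -- Exchanging the variables fixes `qA` and `qD` and interchanges `qBp` and `qBm`. Adding the two
    -- equations leaves `q(qA, qD) qD = 0`.
    have h1 := congrArg (aeval ![X 1, X 0] : Poly →ₐ[ZMod 2] Poly) h0
    have hsw : (aeval ![X 1, X 0] : Poly →ₐ[ZMod 2] Poly) qBp = qBm := by
      simp [qBp, qBm]
      ring
    rw [map_add, map_mul, swap_aeval, swap_aeval, hsw, map_zero] at h1
    have h3 : aeval ![qA, qD] q * qD = 0 := by
      linear_combination h0 + h1 - (aeval ![qA, qD] p : Poly) * two_eq_zero +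
        (aeval ![qA, qD] q : Poly) * qD_eq
    have hq : aeval ![qA, qD] q = 0 := (mul_eq_zero.1 h3).resolve_right qD_ne_zero
    rw [hq, zero_mul, add_zero] at h0
    have hp := (map_eq_zero_iff _ algebraicIndependent_dickson).1 h0
    have hq := (map_eq_zero_iff _ algebraicIndependent_dickson).1 hq
    rwa [hp, hq, map_zero, zero_mul, add_zero, sub_zero] at h
  · rw [Ideal.span_singleton_le_iff_mem, RingHom.mem_ker]
    simp [rel, evGen, qBp_mul_qBm]

theorem range_evGen : evGen.range = invariantsC3 := by
  rw [invariantsC3_eq, evGen, ← Algebra.adjoin_range_eq_range_aeval]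
  refine congrArg _ (Set.ext fun x => ?_)
  simp only [Matrix.range_cons, Matrix.range_empty, Set.mem_union, Set.mem_singleton_iff,
    Set.mem_insert_iff, Set.union_empty]

end AltFour

end

section

open MvPolynomial StdComplex

namespace FoxNeuwirth

/-! ### The incidences of cells of configurations of four points -/

/-- The minimum of the entries between the points `p < q`, for a configuration of four points. -/
def minEntry (Γ : Fin 3 → ℕ) (p q : Fin 4) : ℕ :=
  match p, q with
  | 0, 1 => Γ 0
  | 1, 2 => Γ 1
  | 2, 3 => Γ 2
  | 0, 2 => min (Γ 0) (Γ 1)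
  | 1, 3 => min (Γ 1) (Γ 2)
  | 0, 3 => min (Γ 0) (min (Γ 1) (Γ 2))
  | _, _ => 0

theorem shared_eq (Γ : Fin 3 → ℕ) (p q : Fin 4) (h : p < q) :
    shared Γ p q = (minEntry Γ p q : WithTop ℕ) := by
  have h1 : min p q = p := min_eq_left h.le
  have h2 : max p q = q := max_eq_right h.le
  have e : ∀ S : Finset (Fin 3), (Finset.univ.filter fun j : Fin 3 =>
      min p q ≤ j.castSucc ∧ j.succ ≤ max p q) = S → shared Γ p q = S.inf fun j => (Γ j : WithTop ℕ) :=
    fun S hS => by rw [shared, hS]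
  rw [h1, h2] at e
  fin_cases p <;> fin_cases q <;> try exact absurd h (by decide)
  · exact (e {0} (by decide)).trans (by simp [minEntry])
  · exact (e {0, 1} (by decide)).trans (by simp [minEntry, (Nat.mono_cast (α := WithTop ℕ)).map_min])
  · exact (e {0, 1, 2} (by decide)).trans (by simp [minEntry, (Nat.mono_cast (α := WithTop ℕ)).map_min])
  · exact (e {1} (by decide)).trans (by simp [minEntry])
  · exact (e {1, 2} (by decide)).trans (by simp [minEntry, (Nat.mono_cast (α := WithTop ℕ)).map_min])
  · exact (e {2} (by decide)).trans (by simp [minEntry])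

theorem shared_comm {m : ℕ} (Γ : Fin m → ℕ) (p q : Fin (m + 1)) : shared Γ p q = shared Γ q p := by
  rw [shared, shared, min_comm, max_comm]

/-- A decidable form of the relation `IsTerm`. -/
def TermCond (Γ : Fin 3 → ℕ) (i : Fin 3) (π : Equiv.Perm (Fin 4)) (Γ' : Fin 3 → ℕ) : Prop :=
  (∀ p q, p < q → π q < π p → p ≤ i.castSucc ∧ i.succ ≤ q ∧ Γ i < minEntry (bump Γ i) p q) ∧
    (∀ j : Fin 3, Γ i + 1 < bump Γ i j → (π j.succ : ℕ) = (π j.castSucc : ℕ) + 1) ∧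
      ∀ p q, p < q → ∀ j : Fin 3,
        ((π p = j.castSucc ∧ π q = j.succ) ∨ (π q = j.castSucc ∧ π p = j.succ)) →
          Γ' j = minEntry (bump Γ i) p q

instance (Γ : Fin 3 → ℕ) (i : Fin 3) (π : Equiv.Perm (Fin 4)) (Γ' : Fin 3 → ℕ) :
    Decidable (TermCond Γ i π Γ') := by
  unfold TermCond
  infer_instance

/-- Distinct points share a finite number of coordinates, so `WithTop ℕ` and the inverse permutation
can be avoided, leaving a condition that evaluates. -/
theorem isTerm_iff (Γ : Fin 3 → ℕ) (i : Fin 3) (π : Equiv.Perm (Fin 4)) (Γ' : Fin 3 → ℕ) :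
    IsTerm Γ i π Γ' ↔ TermCond Γ i π Γ' := by
  constructor
  · rintro ⟨h, h'⟩
    refine ⟨fun p q hpq hπ => ?_, h.block, fun p q hpq j hj => ?_⟩
    · have := h.order p q hpq hπ
      rw [shared_eq _ _ _ hpq] at this
      exact_mod_cast this
    · have e := h' j
      rcases hj with ⟨h1, h2⟩ | ⟨h1, h2⟩
      · rw [← h1, ← h2, Equiv.symm_apply_apply, Equiv.symm_apply_apply, shared_eq _ _ _ hpq] at e
        exact_mod_cast e
      · rw [← h1, ← h2, Equiv.symm_apply_apply, Equiv.symm_apply_apply, shared_comm,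
          shared_eq _ _ _ hpq] at e
        exact_mod_cast e
  · rintro ⟨h1, h2, h3⟩
    refine ⟨⟨fun p q hpq hπ => ?_, h2⟩, fun j => ?_⟩
    · rw [shared_eq _ _ _ hpq]
      exact_mod_cast h1 p q hpq hπ
    · have hne : π.symm j.castSucc ≠ π.symm j.succ :=
        fun h => (Fin.castSucc_lt_succ (i := j)).ne (π.symm.injective h)
      rcases lt_or_gt_of_ne hne with h | h
      · rw [shared_eq _ _ _ h]
        exact_mod_cast h3 _ _ h j (Or.inl (by simp))
      · rw [shared_comm, shared_eq _ _ _ h]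
        exact_mod_cast h3 _ _ h j (Or.inr (by simp))

/-- The set of incidences of a cell, in a form that can be evaluated. -/
def incFin (Γ' : Fin 3 → ℕ) : Finset ((Fin 3 → ℕ) × Fin 3 × Equiv.Perm (Fin 4)) :=
  ((Finset.Nat.antidiagonalTuple 3 (deg Γ' - 1)) ×ˢ Finset.univ ×ˢ Finset.univ).filter
    fun t => TermCond t.1 t.2.1 t.2.2 Γ'

theorem incidences_eq (Γ' : Fin 3 → ℕ) : incidences Γ' = incFin Γ' := by
  rw [incidences, incFin, Finset.piAntidiag_univ_fin_eq_antidiagonalTuple]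
  ext t
  simp only [Finset.mem_filter, isTerm_iff]

theorem deg_of_mem_incidences {Γ' : Fin 3 → ℕ} {t : (Fin 3 → ℕ) × Fin 3 × Equiv.Perm (Fin 4)}
    (ht : t ∈ incidences Γ') : deg t.1 = deg Γ' - 1 := by
  rw [incidences_eq, incFin, Finset.mem_filter, Finset.mem_product,
    Finset.Nat.mem_antidiagonalTuple] at ht
  exact ht.1.1

end FoxNeuwirth

end

/-! ### Boundary tables in degrees one to three. -/

section

open MvPolynomial StdComplex

namespace FoxNeuwirth

/-- The number with the entries of a sequence as digits. -/
def seqCode (Γ : Fin 3 → ℕ) : ℕ := 100 * Γ 0 + (10 * Γ 1 + Γ 2)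

/-- The boundary of the cells of degree one, two and three with the identity labelling, as lists of
sequences and labellings. -/
def boundaryTable (Γ : Fin 3 → ℕ) : List ((Fin 3 → ℕ) × (Fin 4 → Fin 4)) :=
  match seqCode Γ with
  | 1 => [(![0, 0, 0], ![0, 1, 2, 3]), (![0, 0, 0], ![0, 1, 3, 2])]
  | 10 => [(![0, 0, 0], ![0, 1, 2, 3]), (![0, 0, 0], ![0, 2, 1, 3])]
  | 100 => [(![0, 0, 0], ![0, 1, 2, 3]), (![0, 0, 0], ![1, 0, 2, 3])]
  | 2 => [(![0, 0, 1], ![0, 1, 2, 3]), (![0, 0, 1], ![0, 1, 3, 2])]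
  | 11 => [(![0, 0, 1], ![0, 1, 2, 3]), (![0, 0, 1], ![0, 2, 1, 3]), (![0, 0, 1], ![0, 3, 1, 2]),
      (![0, 1, 0], ![0, 1, 2, 3]), (![0, 1, 0], ![0, 1, 3, 2]), (![0, 1, 0], ![0, 2, 3, 1])]
  | 20 => [(![0, 1, 0], ![0, 1, 2, 3]), (![0, 1, 0], ![0, 2, 1, 3])]
  | 101 => [(![0, 0, 1], ![0, 1, 2, 3]), (![0, 0, 1], ![1, 0, 2, 3]), (![1, 0, 0], ![0, 1, 2, 3]),
      (![1, 0, 0], ![0, 1, 3, 2])]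
  | 110 => [(![0, 1, 0], ![0, 1, 2, 3]), (![0, 1, 0], ![1, 0, 2, 3]), (![0, 1, 0], ![2, 0, 1, 3]),
      (![1, 0, 0], ![0, 1, 2, 3]), (![1, 0, 0], ![0, 2, 1, 3]), (![1, 0, 0], ![1, 2, 0, 3])]
  | 200 => [(![1, 0, 0], ![0, 1, 2, 3]), (![1, 0, 0], ![1, 0, 2, 3])]
  | 3 => [(![0, 0, 2], ![0, 1, 2, 3]), (![0, 0, 2], ![0, 1, 3, 2])]
  | 12 => [(![0, 0, 2], ![0, 1, 2, 3]), (![0, 1, 1], ![0, 1, 2, 3]), (![0, 1, 1], ![0, 1, 3, 2]),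
      (![0, 2, 0], ![0, 2, 3, 1])]
  | 21 => [(![0, 0, 2], ![0, 3, 1, 2]), (![0, 1, 1], ![0, 1, 2, 3]), (![0, 1, 1], ![0, 2, 1, 3]),
      (![0, 2, 0], ![0, 1, 2, 3])]
  | 30 => [(![0, 2, 0], ![0, 1, 2, 3]), (![0, 2, 0], ![0, 2, 1, 3])]
  | 102 => [(![0, 0, 2], ![0, 1, 2, 3]), (![0, 0, 2], ![1, 0, 2, 3]), (![1, 0, 1], ![0, 1, 2, 3]),
      (![1, 0, 1], ![0, 1, 3, 2])]
  | 111 => [(![0, 1, 1], ![0, 1, 2, 3]), (![0, 1, 1], ![1, 0, 2, 3]), (![0, 1, 1], ![2, 0, 1, 3]),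
      (![0, 1, 1], ![3, 0, 1, 2]), (![1, 0, 1], ![0, 1, 2, 3]), (![1, 0, 1], ![0, 2, 1, 3]),
      (![1, 0, 1], ![0, 3, 1, 2]), (![1, 0, 1], ![1, 2, 0, 3]), (![1, 0, 1], ![1, 3, 0, 2]),
      (![1, 0, 1], ![2, 3, 0, 1]), (![1, 1, 0], ![0, 1, 2, 3]), (![1, 1, 0], ![0, 1, 3, 2]),
      (![1, 1, 0], ![0, 2, 3, 1]), (![1, 1, 0], ![1, 2, 3, 0])]
  | 120 => [(![0, 2, 0], ![0, 1, 2, 3]), (![1, 1, 0], ![0, 1, 2, 3]), (![1, 1, 0], ![0, 2, 1, 3]),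
      (![2, 0, 0], ![1, 2, 0, 3])]
  | 201 => [(![1, 0, 1], ![0, 1, 2, 3]), (![1, 0, 1], ![1, 0, 2, 3]), (![2, 0, 0], ![0, 1, 2, 3]),
      (![2, 0, 0], ![0, 1, 3, 2])]
  | 210 => [(![0, 2, 0], ![2, 0, 1, 3]), (![1, 1, 0], ![0, 1, 2, 3]), (![1, 1, 0], ![1, 0, 2, 3]),
      (![2, 0, 0], ![0, 1, 2, 3])]
  | 300 => [(![2, 0, 0], ![0, 1, 2, 3]), (![2, 0, 0], ![1, 0, 2, 3])]
  -- The codes separate sequences of degree at most three; the table is appealed to only for degrees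
  -- one to three.
  | _ => []

theorem incFin_eq_boundaryTable : ∀ d ∈ Finset.range 3, ∀ Γ ∈ Finset.Nat.antidiagonalTuple 3 (d + 1),
    (incFin Γ).val.map (fun t => (t.1, (t.2.2 : Fin 4 → Fin 4))) = ↑(boundaryTable Γ) := by
  decide +kernel

theorem sum_incidences {d : ℕ} (hd : d < 3) {Γ : Fin 3 → ℕ} (hΓ : deg Γ = d + 1) {M : Type}
    [AddCommMonoid M] (F : (Fin 3 → ℕ) × (Fin 4 → Fin 4) → M) :
    ∑ t ∈ incidences Γ, F (t.1, t.2.2) = ((boundaryTable Γ).map F).sum := by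
  rw [incidences_eq]
  have := incFin_eq_boundaryTable d (Finset.mem_range.2 hd) Γ
    (Finset.Nat.mem_antidiagonalTuple.2 hΓ)
  rw [← Multiset.sum_coe, ← Multiset.map_coe, ← this, Multiset.map_map]
  rfl

/-- The boundary of the boundary. -/
def boundarySq (Γ : Fin 3 → ℕ) : List ((Fin 3 → ℕ) × (Fin 4 → Fin 4)) :=
  (boundaryTable Γ).flatMap fun t => (boundaryTable t.1).map fun t' => (t'.1, t.2 ∘ t'.2)

/-- This is `∂² = 0` modulo two. The identity labelling suffices because the boundary commutes with
relabelling. -/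
theorem even_count_boundarySq : ∀ d ∈ Finset.range 2,
    ∀ Γ ∈ Finset.Nat.antidiagonalTuple 3 (d + 2), ∀ x ∈ boundarySq Γ, Even ((boundarySq Γ).count x) := by
  decide +kernel

theorem sum_eq_zero_of_even_count {ι : Type} [i : BEq ι] [LawfulBEq ι] (l : List ι)
    (h : ∀ x ∈ l, Even (l.count x)) (F : ι → ZMod 2) : (l.map F).sum = 0 := by
  classical
  obtain rfl : i = instBEqOfDecidableEq := lawful_beq_subsingleton _ _
  rw [Finset.sum_list_map_count]
  refine Finset.sum_eq_zero fun x hx => ?_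
  obtain ⟨k, hk⟩ := h x (List.mem_toFinset.1 hx)
  rw [hk, add_smul, CharTwo.add_self_eq_zero]

end FoxNeuwirth

end

section

open MvPolynomial StdComplex AltFour

namespace FoxNeuwirth

/-! ### The complex of cells -/

/-- The even one of `σ` and `σ (0 1)`. -/
def evenPart (σ : Equiv.Perm (Fin 4)) : A4 :=
  if h : Equiv.Perm.sign σ = 1 then ⟨σ, Equiv.Perm.mem_alternatingGroup.2 h⟩
  else ⟨σ * Equiv.swap 0 1, Equiv.Perm.mem_alternatingGroup.2 (by
    rw [map_mul, Equiv.Perm.sign_swap (by decide), (Int.units_eq_one_or _).resolve_left h]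
    decide)⟩

theorem sign_coe_mul (g : A4) (σ : Equiv.Perm (Fin 4)) :
    Equiv.Perm.sign ((g : Equiv.Perm (Fin 4)) * σ) = Equiv.Perm.sign σ := by
  rw [map_mul, Equiv.Perm.mem_alternatingGroup.1 g.2, one_mul]

/-- The complex of labelled cells of configurations of four points. -/
noncomputable def cells : CellComplex A4 where
  X _ := Cell 3
  P d x := deg x.1 = d
  act _ g x := (x.1, (g : Equiv.Perm (Fin 4)) * x.2)
  J _ := (Fin 3 → ℕ) × Fin 3 × Equiv.Perm (Fin 4)
  I _ x := incidences x.1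
  face _ x t := (t.1, x.2 * t.2.2)
  ρ _ x := evenPart x.2
  P_act _ _ _ h := h
  P_face d x h t ht := by
    change deg t.1 = d
    rw [deg_of_mem_incidences ht, h]
    rfl
  mul_act _ g h x := by rw [Subgroup.coe_mul, mul_assoc]
  I_act _ _ _ := rfl
  face_act _ _ _ _ := by rw [mul_assoc]
  ρ_act _ g x := by
    change evenPart ((g : Equiv.Perm (Fin 4)) * x.2) = g * evenPart x.2
    by_cases h : Equiv.Perm.sign x.2 = 1
    · rw [evenPart, evenPart, dif_pos h, dif_pos ((sign_coe_mul g x.2).trans h)]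
      rfl
    · rw [evenPart, evenPart, dif_neg h, dif_neg (by rwa [sign_coe_mul g x.2])]
      exact Subtype.ext (mul_assoc _ _ _)

/-- A function on words of letters, from a function on permutations. -/
noncomputable def onWords (F : Equiv.Perm (Fin 4) → ZMod 2) (w : Fin 4 → Fin 4) : ZMod 2 :=
  open Classical in if h : Function.Bijective w then F (Equiv.ofBijective w h) else 0

theorem onWords_coe (F : Equiv.Perm (Fin 4) → ZMod 2) (σ : Equiv.Perm (Fin 4)) : onWords F σ = F σ := by
  rw [onWords, dif_pos σ.bijective]
  exact congrArg F (Equiv.ext fun _ => rfl)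

theorem cells_isComplex : cells.IsComplex 3 := by
  intro d hd x hx F
  change ∑ t ∈ incidences x.1, ∑ t' ∈ incidences t.1, F (t'.1, x.2 * t.2.2 * t'.2.2) = 0
  have hx : deg x.1 = d + 2 := hx
  have e₁ : ∀ t ∈ incidences x.1, ∑ t' ∈ incidences t.1, F (t'.1, x.2 * t.2.2 * t'.2.2) =
      ((boundaryTable t.1).map fun y =>
        onWords (fun τ => F (y.1, x.2 * τ)) ((t.2.2 : Fin 4 → Fin 4) ∘ y.2)).sum := by
    intro t ht
    rw [← sum_incidences (d := d) (by omega)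
      (by rw [deg_of_mem_incidences ht, hx]; rfl) fun y =>
        onWords (fun τ => F (y.1, x.2 * τ)) ((t.2.2 : Fin 4 → Fin 4) ∘ y.2)]
    refine Finset.sum_congr rfl fun t' _ => ?_
    rw [← Equiv.Perm.coe_mul, onWords_coe, mul_assoc]
  -- The labelling `x.2` is moved into the function being summed, so that only the boundary of
  -- identity-labelled cells remains.
  rw [Finset.sum_congr rfl e₁, sum_incidences (d := d + 1) (by omega) hx fun y =>
    ((boundaryTable y.1).map fun y' => onWords (fun τ => F (y'.1, x.2 * τ)) (y.2 ∘ y'.2)).sum]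
  have := sum_eq_zero_of_even_count (boundarySq x.1) (even_count_boundarySq d
    (Finset.mem_range.2 (by omega)) x.1 (Finset.Nat.mem_antidiagonalTuple.2 hx))
    fun y => onWords (fun τ => F (y.1, x.2 * τ)) y.2
  rw [← this, boundarySq, List.map_flatMap, List.flatMap_def, List.sum_flatten, List.map_map]
  simp only [Function.comp_def, List.map_map]

theorem isMap_of_isComparison {n : ℕ}
    {ψ : (d : ℕ) → Cell 3 → MonoidAlgebra (ZMod 2) (Fin (d + 1) → A4)}
    (h : IsComparison n ψ) : cells.IsMap n ψ where
  equivariant d hd x hx g := by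
    apply MonoidAlgebra.coeff_injective
    ext v
    have e₁ := h.equivariant d hd x hx g fun i => g⁻¹ * v i
    have e₂ := coeff_act g (ψ d x) fun i => g⁻¹ * v i
    simp only [mul_inv_cancel_left] at e₁ e₂
    exact e₁.trans e₂.symm
  augmented x hx := by
    have := h.augmented x hx
    simpa [aug, linExt_apply] using this
  boundary d hd x hx := h.boundary d hd x hx

theorem isComparison_of_isMap {n : ℕ}
    {ψ : (d : ℕ) → Cell 3 → MonoidAlgebra (ZMod 2) (Fin (d + 1) → A4)}
    (h : cells.IsMap n ψ) : IsComparison n ψ where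
  equivariant d hd x hx g v := by
    have := h.equivariant d hd x hx g
    change ψ d (x.1, (g : Equiv.Perm (Fin 4)) * x.2) = act g (ψ d x) at this
    exact (congrArg (fun c => c.coeff fun i => g * v i) this).trans (coeff_act g (ψ d x) v)
  augmented x hx := by
    have := h.augmented x hx
    simpa [aug, linExt_apply] using this
  boundary d hd x hx := h.boundary d hd x hx

/-- The labelling with a given charge. -/
def labelling (ε : ℤˣ) : Equiv.Perm (Fin 4) := if ε = 1 then 1 else Equiv.swap 0 1

theorem sign_labelling (ε : ℤˣ) : Equiv.Perm.sign (labelling ε) = ε := by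
  rcases Int.units_eq_one_or ε with rfl | rfl <;> decide

/-- An invariant function on cells is given by a cochain on charged sequences. -/
theorem exists_cochain {n : ℕ} {f : Cell 3 → ZMod 2}
    (hf : ∀ g x, cells.P n x → f (cells.act n g x) = f x) :
    ∃ h : Cochain 3, ∀ x : Cell 3, deg x.1 = n → f x = h (x.1, Equiv.Perm.sign x.2) := by
  -- The labellings of a given sign form one orbit of the alternating group, so one representative
  -- per charge determines an invariant function.
  refine ⟨fun y => f (y.1, labelling y.2), fun x hx => ?_⟩
  have hg : x.2 * (labelling (Equiv.Perm.sign x.2))⁻¹ ∈ alternatingGroup (Fin 4) := by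
    rw [Equiv.Perm.mem_alternatingGroup, map_mul, map_inv, sign_labelling, mul_inv_cancel]
  refine Eq.trans ?_ (hf ⟨_, hg⟩ (x.1, labelling (Equiv.Perm.sign x.2)) hx)
  change f x = f (x.1, x.2 * (labelling (Equiv.Perm.sign x.2))⁻¹ * labelling (Equiv.Perm.sign x.2))
  rw [inv_mul_cancel_right]

theorem sum_face_eq_delta {n : ℕ} {f : Cell 3 → ZMod 2} {h : Cochain 3}
    (hf : ∀ x : Cell 3, deg x.1 = n → f x = h (x.1, Equiv.Perm.sign x.2)) (x : Cell 3)
    (hx : deg x.1 = n + 1) :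
    ∑ t ∈ incidences x.1, f (t.1, x.2 * t.2.2) = delta h (x.1, Equiv.Perm.sign x.2) := by
  refine Finset.sum_congr rfl fun t ht => ?_
  rw [hf _ (by rw [deg_of_mem_incidences ht, hx]; rfl), map_mul]

/-- The sign of a word of letters, the parity of its number of inversions. -/
def wordSign (w : Fin 4 → Fin 4) : ℤˣ :=
  (-1) ^ (((Finset.univ : Finset (Fin 4 × Fin 4)).filter fun p => p.1 < p.2 ∧ w p.2 < w p.1).card)

theorem sign_eq_wordSign : ∀ σ : Equiv.Perm (Fin 4), Equiv.Perm.sign σ = wordSign σ := by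
  decide +kernel

theorem delta_eq {d : ℕ} (hd : d < 3) {Γ : Fin 3 → ℕ} (hΓ : deg Γ = d + 1) (h : Cochain 3) (ε : ℤˣ) :
    delta h (Γ, ε) = ((boundaryTable Γ).map fun y => h (y.1, ε * wordSign y.2)).sum := by
  rw [← sum_incidences hd hΓ fun y => h (y.1, ε * wordSign y.2)]
  exact Finset.sum_congr rfl fun t _ => by rw [sign_eq_wordSign]

/-- The boundary of a charged sequence, as a list of charged sequences. -/
def chargedBoundary (x : (Fin 3 → ℕ) × ℤˣ) : List ((Fin 3 → ℕ) × ℤˣ) :=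
  (boundaryTable x.1).map fun y => (y.1, x.2 * wordSign y.2)

/-- Each of `[1,1,1]⁺` and `[1,1,1]⁻` is a cycle modulo two once labels are reduced to charges;
hence coboundaries vanish on it. -/
theorem even_count_chargedBoundary_one_one_one (ε : ℤˣ) : ∀ x ∈ chargedBoundary (![1, 1, 1], ε),
    Even ((chargedBoundary (![1, 1, 1], ε)).count x) := by
  rcases Int.units_eq_one_or ε with rfl | rfl <;> decide +kernel

theorem delta_one_one_one (h : Cochain 3) (ε : ℤˣ) : delta h (![1, 1, 1], ε) = 0 := by
  rw [delta_eq (d := 2) (by omega) rfl,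
    ← sum_eq_zero_of_even_count _ (even_count_chargedBoundary_one_one_one ε) h, chargedBoundary,
    List.map_map]
  rfl

/-- The sum of these three charged sequences is a cycle: the boundary of `[1,0,1]⁺` is `[0,0,1]ᵒ +
[1,0,0]ᵒ`, and the other two bound the two summands. -/
theorem delta_add_delta_add_delta (h : Cochain 3) :
    delta h (![1, 0, 1], 1) + (delta h (![0, 0, 2], 1) + delta h (![2, 0, 0], 1)) = 0 := by
  have := sum_eq_zero_of_even_count (chargedBoundary (![1, 0, 1], 1) ++
    (chargedBoundary (![0, 0, 2], 1) ++ chargedBoundary (![2, 0, 0], 1))) (by decide +kernel) h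
  rw [delta_eq (d := 1) (by omega) rfl, delta_eq (d := 1) (by omega) rfl,
    delta_eq (d := 1) (by omega) rfl, ← this, List.map_append, List.map_append, List.sum_append,
    List.sum_append, chargedBoundary, chargedBoundary, chargedBoundary, List.map_map, List.map_map,
    List.map_map]
  rfl

end FoxNeuwirth

end

section

open MvPolynomial StdComplex IsMaurerCartan AltFour

namespace FoxNeuwirth

/-! ### The twisting datum on cells -/

/-- The number with the letters of a word as digits. -/
def wordCode (w : Fin 4 → Fin 4) : ℕ :=
  1000 * (w 0 : ℕ) + (100 * (w 1 : ℕ) + (10 * (w 2 : ℕ) + (w 3 : ℕ)))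

/-- The cells on which the component of bidegree `(a, b)` of the twisting datum does not vanish. -/
def twistSupport (a b : ℕ) : List (ℕ × ℕ) :=
  match a, b with
  -- These are all words ending in the letter `3`, a leading letter `0` being invisible in the code:
  -- `123` stands for `0123`.
  | 0, 0 => [(0, 123), (0, 213), (0, 1023), (0, 1203), (0, 2013), (0, 2103)]
  | 0, 1 => [(1, 3012), (1, 3021), (1, 3201), (1, 3210)]
  | 1, 0 => [(1, 2013), (1, 2031), (1, 2301), (1, 2310), (1, 3012), (1, 3021), (1, 3201), (1, 3210)]
  | 0, 2 => [(101, 3012), (101, 3021), (101, 3201), (101, 3210)]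
  | 1, 1 => [(101, 2103), (101, 2130)]
  | 2, 0 => [(101, 2013), (101, 2031), (101, 2103), (101, 2130)]
  | 0, 3 => [(111, 3012), (111, 3210), (201, 3012), (201, 3021), (201, 3201), (201, 3210)]
  | 1, 2 => [(111, 2103), (111, 2130), (111, 2310), (111, 3012), (111, 3210), (201, 2103),
      (201, 2130)]
  | 2, 1 => [(111, 2013), (111, 2031), (111, 2103), (201, 3012), (201, 3021)]
  | 3, 0 => [(111, 2013), (111, 2031), (111, 2103), (111, 3012), (111, 3021), (111, 3102),
      (201, 2013), (201, 2031), (201, 3012), (201, 3021)]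
  | _, _ => []

/-- The component of bidegree `(a, b)` of the twisting datum. -/
def twistCoeff (a b : ℕ) (x : (Fin 3 → ℕ) × (Fin 4 → Fin 4)) : ZMod 2 :=
  if (seqCode x.1, wordCode x.2) ∈ twistSupport a b then 1 else 0

/-- The translation of the letters along the first coordinate. -/
def wordS : Fin 4 → Fin 4 := ![2, 3, 0, 1]

/-- The translation of the letters along the second coordinate. -/
def wordT : Fin 4 → Fin 4 := ![1, 0, 3, 2]

/-- The twisting identity, read off at the monomial `x₁ᵃ x₂^(d-a)`: the terms of the right-hand side
come from the coefficients of `u` at `1`, `s` and `t`. -/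
theorem sum_twistCoeff_boundary : ∀ d ∈ Finset.range 3,
    ∀ Γ ∈ Finset.Nat.antidiagonalTuple 3 (d + 1), ∀ a ∈ Finset.range (d + 1), ∀ σ : Equiv.Perm (Fin 4),
      ((boundaryTable Γ).map fun y => twistCoeff a (d - a) (y.1, σ ∘ y.2)).sum =
        (twistCoeff (a + 1) (d - a) (Γ, σ) + twistCoeff a (d - a + 1) (Γ, σ)) +
          (twistCoeff (a + 1) (d - a) (Γ, wordS ∘ σ) + twistCoeff a (d - a + 1) (Γ, wordT ∘ σ)) := by
  decide +kernel

/-- The twisting datum on cells. -/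
noncomputable def cellTwist (d : ℕ) (x : cells.X d) : Poly →ₗ[ZMod 2] ZMod 2 :=
  ∑ a ∈ Finset.range (d + 1), twistCoeff a (d - a) (x.1, x.2) • MvPolynomial.lcoeff (ZMod 2) (mon a (d - a))

theorem cellTwist_apply (d : ℕ) (x : cells.X d) (p : Poly) : cellTwist d x p =
    ∑ a ∈ Finset.range (d + 1), twistCoeff a (d - a) (x.1, x.2) * coeff (mon a (d - a)) p := by
  simp [cellTwist]

theorem cellTwist_X_zero_mul (d : ℕ) (x : cells.X (d + 1)) (p : Poly) :
    cellTwist (d + 1) x (X 0 * p) = ∑ a ∈ Finset.range (d + 1),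
      twistCoeff (a + 1) (d - a) (x.1, x.2) * coeff (mon a (d - a)) p := by
  rw [cellTwist_apply, Finset.sum_range_succ', coeff_X_zero_mul_zero, mul_zero, add_zero]
  refine Finset.sum_congr rfl fun a _ => ?_
  rw [coeff_X_zero_mul, Nat.add_sub_add_right]

theorem cellTwist_X_one_mul (d : ℕ) (x : cells.X (d + 1)) (p : Poly) :
    cellTwist (d + 1) x (X 1 * p) = ∑ a ∈ Finset.range (d + 1),
      twistCoeff a (d - a + 1) (x.1, x.2) * coeff (mon a (d - a)) p := by
  rw [cellTwist_apply, Finset.sum_range_succ, Nat.sub_self, coeff_X_one_mul_zero, mul_zero, add_zero]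
  refine Finset.sum_congr rfl fun a ha => ?_
  rw [Nat.succ_sub (Finset.mem_range_succ_iff.1 ha), coeff_X_one_mul]

theorem coe_s : ((s : Equiv.Perm (Fin 4)) : Fin 4 → Fin 4) = wordS := by decide

theorem coe_t : ((t : Equiv.Perm (Fin 4)) : Fin 4 → Fin 4) = wordT := by decide

theorem eq_zero_of_deg {Γ : Fin 3 → ℕ} (h : deg Γ = 0) : Γ = 0 := by
  funext j
  exact Finset.sum_eq_zero_iff.1 h j (Finset.mem_univ j)

/-- Among the words of a given sign exactly three end in the letter `3`. -/
theorem sum_twistCoeff_zero : ∀ σ : Equiv.Perm (Fin 4),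
    ∑ g : A4, twistCoeff 0 0 (0, (g : Equiv.Perm (Fin 4)) ∘ σ) = 1 := by
  decide +kernel

theorem cellTwist_isTwisting : cells.IsTwisting 3 u cellTwist where
  augmented x hx := by
    have hx : deg x.1 = 0 := hx
    rw [← sum_twistCoeff_zero x.2]
    refine Finset.sum_congr rfl fun g _ => ?_
    rw [cellTwist_apply, Finset.sum_range_one, ← eq_zero_of_deg hx]
    change _ * coeff (mon 0 0) (1 : Poly) = _
    rw [show mon 0 0 = 0 by simp [mon], coeff_zero_one, mul_one]
    rfl
  boundary d hd x hx p := by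
    have hx : deg x.1 = d + 1 := hx
    rw [sum_u_smul (fun v r => cellTwist (d + 1) (cells.act (d + 1) v x) (r * p))
      fun v => by rw [zero_mul, map_zero], add_mul, map_add, cellTwist_X_zero_mul,
      cellTwist_X_one_mul, cellTwist_X_zero_mul, cellTwist_X_one_mul, ← Finset.sum_add_distrib,
      ← Finset.sum_add_distrib, ← Finset.sum_add_distrib]
    refine (Finset.sum_congr rfl fun t _ => cellTwist_apply d _ p).trans ?_
    rw [Finset.sum_comm]
    refine Finset.sum_congr rfl fun a ha => ?_
    have e := sum_twistCoeff_boundary d (Finset.mem_range.2 hd) x.1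
      (Finset.Nat.mem_antidiagonalTuple.2 hx) a ha x.2
    rw [← sum_incidences hd hx fun y => twistCoeff a (d - a) (y.1, x.2 ∘ y.2), ← coe_s, ← coe_t] at e
    rw [← Finset.sum_mul]
    refine (congrArg (· * coeff (mon a (d - a)) p) e).trans ?_
    rw [add_mul, add_mul, add_mul]
    rfl

/-- The chain map to the standard resolution given by the twisting datum on cells. -/
noncomputable def comparison : ∀ d, cells.X d → Chain A4 d := cells.psi u cellTwist

theorem comparison_isMap : cells.IsMap 3 comparison := cellTwist_isTwisting.isMap u_isMaurerCartan

/-- The Fox-Neuwirth cochain of a monomial. -/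
def monCochain (a b : ℕ) (x : (Fin 3 → ℕ) × (Fin 4 → Fin 4)) : ZMod 2 :=
  ∑ g : A4, twistCoeff a b (x.1, (g : Equiv.Perm (Fin 4)) ∘ x.2)

theorem evalL_comparison (n : ℕ) (x : Cell 3) (z : (Fin n → A4) → ZMod 2) :
    evalL z (comparison n x) = ∑ a ∈ Finset.range (n + 1),
      monCochain a (n - a) (x.1, x.2) * coeff (mon a (n - a)) (phi u n z) := by
  refine (CellComplex.evalL_psi (C := cells) cellTwist x z).trans ?_
  refine (Finset.sum_congr rfl fun g _ => cellTwist_apply n _ _).trans ?_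
  rw [Finset.sum_comm]
  refine Finset.sum_congr rfl fun a _ => ?_
  rw [← Finset.sum_mul]
  rfl

theorem charged_apply (Γ : Fin 3 → ℕ) (ε : ℤˣ) (x : (Fin 3 → ℕ) × ℤˣ) :
    charged Γ ε x = if x = (Γ, ε) then 1 else 0 := Pi.single_apply _ _ _

/-- The left side adds up the monomials of `qA`, so this identifies its pull-back with `[1,0,1]ᵒ` on
the nose. The next two statements do the same for `qBp` and `qBm`. -/
theorem monCochain_two : ∀ Γ ∈ Finset.Nat.antidiagonalTuple 3 2, ∀ σ : Equiv.Perm (Fin 4),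
    monCochain 0 2 (Γ, σ) + monCochain 1 1 (Γ, σ) + monCochain 2 0 (Γ, σ) =
      if Γ = ![1, 0, 1] then 1 else 0 := by
  decide +kernel

theorem monCochain_three_plus : ∀ Γ ∈ Finset.Nat.antidiagonalTuple 3 3, ∀ σ : Equiv.Perm (Fin 4),
    monCochain 0 3 (Γ, σ) + monCochain 2 1 (Γ, σ) + monCochain 3 0 (Γ, σ) =
      (if Γ = ![1, 1, 1] ∧ wordSign σ = 1 then 1 else 0) + if Γ = ![2, 0, 1] then 1 else 0 := by
  decide +kernel

theorem monCochain_three_minus : ∀ Γ ∈ Finset.Nat.antidiagonalTuple 3 3, ∀ σ : Equiv.Perm (Fin 4),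
    monCochain 0 3 (Γ, σ) + monCochain 1 2 (Γ, σ) + monCochain 3 0 (Γ, σ) =
      (if Γ = ![1, 1, 1] ∧ wordSign σ = -1 then 1 else 0) + if Γ = ![2, 0, 1] then 1 else 0 := by
  decide +kernel

end FoxNeuwirth

end

/-! ### Invariants of degree two and three. -/

section

open MvPolynomial StdComplex IsMaurerCartan AltFour

namespace AltFour

theorem coeff_mon_mul (a b c d : ℕ) :
    coeff (mon a b) (X 0 ^ c * X 1 ^ d : Poly) = if c = a ∧ d = b then 1 else 0 := by
  rw [X_pow_eq_monomial, X_pow_eq_monomial, monomial_mul, one_mul, coeff_monomial]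
  change (if mon c d = mon a b then _ else _) = _
  refine if_congr ⟨fun h => ⟨?_, ?_⟩, fun h => by rw [h.1, h.2]⟩ rfl rfl
  · simpa [mon_apply_zero] using DFunLike.congr_fun h 0
  · simpa [mon_apply_one] using DFunLike.congr_fun h 1

theorem qA_eq_mon : qA = X 0 ^ 0 * X 1 ^ 2 + X 0 ^ 1 * X 1 ^ 1 + X 0 ^ 2 * X 1 ^ 0 := by
  rw [qA]
  ring

theorem qBp_eq_mon : qBp = X 0 ^ 0 * X 1 ^ 3 + X 0 ^ 2 * X 1 ^ 1 + X 0 ^ 3 * X 1 ^ 0 := by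
  rw [qBp]
  ring

theorem qBm_eq_mon : qBm = X 0 ^ 0 * X 1 ^ 3 + X 0 ^ 1 * X 1 ^ 2 + X 0 ^ 3 * X 1 ^ 0 := by
  rw [qBm]
  ring

theorem isHomogeneous_mon (a b : ℕ) : (X 0 ^ a * X 1 ^ b : Poly).IsHomogeneous (a + b) :=
  (isHomogeneous_X_pow (R := ZMod 2) (0 : Fin 2) a).mul (isHomogeneous_X_pow (1 : Fin 2) b)

theorem qA_isHomogeneous : qA.IsHomogeneous 2 := by
  rw [qA_eq_mon]
  exact ((isHomogeneous_mon 0 2).add (isHomogeneous_mon 1 1)).add (isHomogeneous_mon 2 0)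

theorem qBp_isHomogeneous : qBp.IsHomogeneous 3 := by
  rw [qBp_eq_mon]
  exact ((isHomogeneous_mon 0 3).add (isHomogeneous_mon 2 1)).add (isHomogeneous_mon 3 0)

theorem qBm_isHomogeneous : qBm.IsHomogeneous 3 := by
  rw [qBm_eq_mon]
  exact ((isHomogeneous_mon 0 3).add (isHomogeneous_mon 1 2)).add (isHomogeneous_mon 3 0)

theorem cyclicShift_C (r : ZMod 2) : cyclicShift (C r) = C r := by simp [cyclicShift]

/-- The traces of degree two. -/
theorem exists_trace_eq_two {q : Poly} (hq : q.IsHomogeneous 2) : ∃ r : ZMod 2, trace q = r • qA := by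
  -- Squares of variables have trace zero, and `x₁x₂` has trace `qA`.
  refine ⟨coeff (mon 1 1) q, ?_⟩
  have h2 := two_eq_zero
  conv_lhs => rw [eq_sum_of_isHomogeneous hq]
  simp only [Finset.sum_range_succ, Finset.sum_range_zero, smul_eq_C_mul, trace, map_add, map_mul,
    map_pow, cyclicShift_X_zero, cyclicShift_X_one, cyclicShift_C, map_zero, qA]
  grind

/-- The traces of degree three. -/
theorem exists_trace_eq_three {q : Poly} (hq : q.IsHomogeneous 3) :
    ∃ r r' : ZMod 2, trace q = r • qBp + r' • qBm := by
  -- Cubes of variables have trace `qD = qBp + qBm`, while `x₁²x₂` has trace `qBp` and `x₁x₂²` has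
  -- trace `qBm`.
  refine ⟨coeff (mon 0 3) q + coeff (mon 2 1) q + coeff (mon 3 0) q,
    coeff (mon 0 3) q + coeff (mon 1 2) q + coeff (mon 3 0) q, ?_⟩
  have h2 := two_eq_zero
  conv_lhs => rw [eq_sum_of_isHomogeneous hq]
  simp only [Finset.sum_range_succ, Finset.sum_range_zero, smul_eq_C_mul, trace, map_add, map_mul,
    map_pow, cyclicShift_X_zero, cyclicShift_X_one, cyclicShift_C, map_zero, qBp, qBm]
  grind

theorem phiH_stdCocycle {n : ℕ} {q : Poly} (hq : q.IsHomogeneous n) (h : cyclicShift q = q) :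
    u_isMaurerCartan.phiH n (GroupCup.cls (ZMod 2) A4 n (stdCocycle n q)) = q := by
  rw [phiH_cls]
  exact (phi_stdCochain n q hq).trans (trace_of_cyclicShift h)

theorem phiH_isHomogeneous {n : ℕ} (c : GroupCup.H (ZMod 2) A4 n) :
    (u_isMaurerCartan.phiH n c).IsHomogeneous n := by
  obtain ⟨z, rfl⟩ := GroupCup.cls_surjective _ _ _ c
  rw [phiH_cls]
  exact phi_isHomogeneous z.1

theorem trace_phiH {n : ℕ} (c : GroupCup.H (ZMod 2) A4 n) :
    trace (u_isMaurerCartan.phiH n c) = u_isMaurerCartan.phiH n c := by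
  obtain ⟨z, rfl⟩ := GroupCup.cls_surjective _ _ _ c
  rw [phiH_cls]
  exact trace_phi z

end AltFour

namespace FoxNeuwirth

/-! ### The classes represented by Fox-Neuwirth cochains -/

/-- The value on a cell of the Fox-Neuwirth cochain of a polynomial. -/
noncomputable def polyCochain (n : ℕ) (x : Cell 3) : Poly →ₗ[ZMod 2] ZMod 2 :=
  ∑ a ∈ Finset.range (n + 1), monCochain a (n - a) (x.1, x.2) • MvPolynomial.lcoeff (ZMod 2) (mon a (n - a))

theorem polyCochain_apply (n : ℕ) (x : Cell 3) (q : Poly) : polyCochain n x q =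
    ∑ a ∈ Finset.range (n + 1), monCochain a (n - a) (x.1, x.2) * coeff (mon a (n - a)) q := by
  simp [polyCochain]

theorem evalL_comparison_eq (n : ℕ) (x : Cell 3) (z : GroupCup.Z (ZMod 2) A4 n) :
    evalL z.1 (comparison n x) =
      polyCochain n x (u_isMaurerCartan.phiH n (GroupCup.cls (ZMod 2) A4 n z)) := by
  rw [polyCochain_apply, phiH_cls]
  exact evalL_comparison n x z.1

theorem isMap_mono {N N' : ℕ} (h : N' ≤ N) {ψ : ∀ d, cells.X d → Chain A4 d}
    (hψ : cells.IsMap N ψ) : cells.IsMap N' ψ where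
  equivariant d hd := hψ.equivariant d (hd.trans h)
  augmented := hψ.augmented
  boundary d hd := hψ.boundary d (hd.trans_le h)

theorem represents_stdCocycle {n : ℕ} (hn : n ≤ 3) {q : Poly} (hq : q.IsHomogeneous n)
    (h : cyclicShift q = q) {f : Cochain 3}
    (hf : ∀ x : Cell 3, deg x.1 = n → polyCochain n x q = f (x.1, Equiv.Perm.sign x.2)) :
    Represents f (GroupCup.cls (ZMod 2) A4 n (stdCocycle n q)) := by
  refine ⟨comparison, isComparison_of_isMap (isMap_mono hn comparison_isMap),
    stdCocycle n q, rfl, 0, fun x hx => ?_⟩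
  refine (evalL_apply _ _).symm.trans ((evalL_comparison_eq n x _).trans ?_)
  rw [phiH_stdCocycle hq h, hf x hx]
  simp [delta]

/-- The comparison map in the definition of `Represents` is homotopic to `comparison`; changing to
the latter adds only a Fox–Neuwirth coboundary. -/
theorem Represents.exists_delta {n : ℕ} (hn : n + 1 ≤ 3) {f : Cochain 3}
    {c : GroupCup.H (ZMod 2) A4 (n + 1)} (hc : Represents f c) :
    ∃ h : Cochain 3, ∀ x : Cell 3, deg x.1 = n + 1 →
      polyCochain (n + 1) x (u_isMaurerCartan.phiH (n + 1) c) =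
        f (x.1, Equiv.Perm.sign x.2) + delta h (x.1, Equiv.Perm.sign x.2) := by
  obtain ⟨ψ, hψ, z, rfl, h, hh⟩ := hc
  obtain ⟨k, hk, hk'⟩ := CellComplex.exists_evalL_eq_succ
    (fun d hd => cells_isComplex d (hd.trans hn))
    (isMap_mono hn comparison_isMap) (isMap_of_isComparison hψ) n le_rfl z
  obtain ⟨k', hkk⟩ := exists_cochain hk
  refine ⟨h + k', fun x hx => ?_⟩
  rw [← evalL_comparison_eq, hk' x hx]
  refine (congrArg₂ (· + ·) ((evalL_apply _ _).trans (hh x hx)) (sum_face_eq_delta hkk x hx)).trans ?_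
  simp only [delta, Pi.add_apply, Finset.sum_add_distrib]
  ring

theorem polyCochain_qA (x : Cell 3) (hx : deg x.1 = 2) : polyCochain 2 x qA =
    (charged ![1, 0, 1] 1 + charged ![1, 0, 1] (-1)) (x.1, Equiv.Perm.sign x.2) := by
  have := monCochain_two x.1 (Finset.Nat.mem_antidiagonalTuple.2 hx) x.2
  have h : polyCochain 2 x qA = monCochain 0 2 (x.1, x.2) + monCochain 1 1 (x.1, x.2) +
      monCochain 2 0 (x.1, x.2) := by
    simp only [polyCochain_apply, qA_eq_mon, Finset.sum_range_succ, Finset.sum_range_zero, coeff_add,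
      coeff_mon_mul]
    norm_num
  rw [h, this, Pi.add_apply, charged_apply, charged_apply]
  rcases Int.units_eq_one_or (Equiv.Perm.sign x.2) with e | e <;> simp [e]

theorem polyCochain_qBp (x : Cell 3) (hx : deg x.1 = 3) : polyCochain 3 x qBp =
    (charged ![1, 1, 1] 1 + (charged ![2, 0, 1] 1 + charged ![2, 0, 1] (-1)))
      (x.1, Equiv.Perm.sign x.2) := by
  have := monCochain_three_plus x.1 (Finset.Nat.mem_antidiagonalTuple.2 hx) x.2
  have h : polyCochain 3 x qBp = monCochain 0 3 (x.1, x.2) + monCochain 2 1 (x.1, x.2) +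
      monCochain 3 0 (x.1, x.2) := by
    simp only [polyCochain_apply, qBp_eq_mon, Finset.sum_range_succ, Finset.sum_range_zero, coeff_add,
      coeff_mon_mul]
    norm_num
  rw [h, this, Pi.add_apply, Pi.add_apply, charged_apply, charged_apply, charged_apply,
    ← sign_eq_wordSign]
  rcases Int.units_eq_one_or (Equiv.Perm.sign x.2) with e | e <;> simp [e]

theorem polyCochain_qBm (x : Cell 3) (hx : deg x.1 = 3) : polyCochain 3 x qBm =
    (charged ![1, 1, 1] (-1) + (charged ![2, 0, 1] 1 + charged ![2, 0, 1] (-1)))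
      (x.1, Equiv.Perm.sign x.2) := by
  have := monCochain_three_minus x.1 (Finset.Nat.mem_antidiagonalTuple.2 hx) x.2
  have h : polyCochain 3 x qBm = monCochain 0 3 (x.1, x.2) + monCochain 1 2 (x.1, x.2) +
      monCochain 3 0 (x.1, x.2) := by
    simp only [polyCochain_apply, qBm_eq_mon, Finset.sum_range_succ, Finset.sum_range_zero, coeff_add,
      coeff_mon_mul]
    norm_num
  rw [h, this, Pi.add_apply, Pi.add_apply, charged_apply, charged_apply, charged_apply,
    ← sign_eq_wordSign]
  rcases Int.units_eq_one_or (Equiv.Perm.sign x.2) with e | e <;> simp [e]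

theorem phiH_of_represents_two {c : GroupCup.H (ZMod 2) A4 2}
    (hc : Represents (m := 3) (charged ![1, 0, 1] 1 + charged ![1, 0, 1] (-1)) c) :
    u_isMaurerCartan.phiH 2 c = qA := by
  obtain ⟨h, hh⟩ := hc.exists_delta (n := 1) (by omega)
  obtain ⟨r, hr⟩ := exists_trace_eq_two (phiH_isHomogeneous c)
  rw [trace_phiH] at hr
  have e : ∀ Γ : Fin 3 → ℕ, deg Γ = 2 → r * (charged ![1, 0, 1] 1 + charged ![1, 0, 1] (-1)) (Γ, 1) =
      (charged ![1, 0, 1] 1 + charged ![1, 0, 1] (-1)) (Γ, 1) + delta h (Γ, 1) := by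
    intro Γ hΓ
    have := hh (Γ, 1) hΓ
    rwa [hr, map_smul, polyCochain_qA _ hΓ, Equiv.Perm.sign_one] at this
  have e₁ := e ![1, 0, 1] rfl
  have e₂ := e ![0, 0, 2] rfl
  have e₃ := e ![2, 0, 0] rfl
  -- The coboundary vanishes on `[0,0,2]⁺` and `[2,0,0]⁺`, where both cochains are zero, hence also
  -- on `[1,0,1]⁺`; this forces `r = 1`.
  have e₄ := delta_add_delta_add_delta h
  simp [charged_apply] at e₁ e₂ e₃
  rw [← e₂, ← e₃, add_zero, add_zero] at e₄
  rw [hr, e₁, e₄, add_zero, one_smul]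

/-- The values on `[1,1,1]^±` are unaffected by coboundaries and are the coefficients of `qBp` and
`qBm`. -/
theorem phiH_of_represents_three {c : GroupCup.H (ZMod 2) A4 3} {f : Cochain 3} (hc : Represents f c) :
    u_isMaurerCartan.phiH 3 c = f (![1, 1, 1], 1) • qBp + f (![1, 1, 1], -1) • qBm := by
  obtain ⟨h, hh⟩ := hc.exists_delta (n := 2) (by omega)
  obtain ⟨r, r', hr⟩ := exists_trace_eq_three (phiH_isHomogeneous c)
  rw [trace_phiH] at hr
  have e₁ := hh (![1, 1, 1], 1) rfl
  have e₂ := hh (![1, 1, 1], Equiv.swap 0 1) rfl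
  rw [hr, map_add, map_smul, map_smul, polyCochain_qBp _ rfl, polyCochain_qBm _ rfl,
    delta_one_one_one, add_zero] at e₁ e₂
  have e : Equiv.Perm.sign (Equiv.swap (0 : Fin 4) 1) = -1 := Equiv.Perm.sign_swap (by decide)
  simp [charged_apply] at e₁ e₂
  rw [hr, e₁, e₂]

end FoxNeuwirth

end

open MvPolynomial IsMaurerCartan AltFour FoxNeuwirth

namespace AltFour

/-! ### The cohomology ring -/

/-- Since `phiH n` lands in degree `n`, different degrees cannot cancel, and injectivity passes from
each degree to the whole ring. -/
theorem phiH_eq_homogeneousComponent (y : GroupCup.HRing (ZMod 2) A4) (n : ℕ) :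
    u_isMaurerCartan.phiH n (y n) = homogeneousComponent n (u_isMaurerCartan.phiRing y) := by
  induction y using DirectSum.induction_on with
  | zero => simp
  | of i c =>
    rw [phiRing_of, homogeneousComponent_of_mem (phiH_isHomogeneous c)]
    split_ifs with h
    · subst h
      rw [DirectSum.of_eq_same]
    · rw [DirectSum.of_eq_of_ne _ _ _ (by tauto), map_zero]
  | add y z hy hz => rw [DirectSum.add_apply, map_add, hy, hz, map_add, map_add]

theorem phiRing_injective : Function.Injective u_isMaurerCartan.phiRing := by
  rw [injective_iff_map_eq_zero]
  intro y hy
  refine DFinsupp.ext fun n => phiH_injective n ?_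
  rw [phiH_eq_homogeneousComponent, hy, map_zero, DirectSum.zero_apply, map_zero]

/-- The class of degree two. -/
noncomputable def classA : GroupCup.H (ZMod 2) A4 2 := GroupCup.cls (ZMod 2) A4 2 (stdCocycle 2 qA)

/-- The first class of degree three. -/
noncomputable def classBp : GroupCup.H (ZMod 2) A4 3 := GroupCup.cls (ZMod 2) A4 3 (stdCocycle 3 qBp)

/-- The second class of degree three. -/
noncomputable def classBm : GroupCup.H (ZMod 2) A4 3 := GroupCup.cls (ZMod 2) A4 3 (stdCocycle 3 qBm)

theorem phiH_classA : u_isMaurerCartan.phiH 2 classA = qA :=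
  phiH_stdCocycle qA_isHomogeneous cyclicShift_qA

theorem phiH_classBp : u_isMaurerCartan.phiH 3 classBp = qBp :=
  phiH_stdCocycle qBp_isHomogeneous cyclicShift_qBp

theorem phiH_classBm : u_isMaurerCartan.phiH 3 classBm = qBm :=
  phiH_stdCocycle qBm_isHomogeneous cyclicShift_qBm

theorem phiRing_mem (y : GroupCup.HRing (ZMod 2) A4) : u_isMaurerCartan.phiRing y ∈ invariantsC3 := by
  induction y using DirectSum.induction_on with
  | zero => simp
  | of i c =>
    rw [phiRing_of, ← trace_phiH]
    exact cyclicShift_trace _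
  | add y z hy hz =>
    rw [map_add]
    exact add_mem hy hz

theorem range_phiRing : u_isMaurerCartan.phiRing.range = invariantsC3 := by
  apply le_antisymm
  · rintro _ ⟨y, rfl⟩
    exact phiRing_mem y
  · rw [invariantsC3_eq]
    refine Algebra.adjoin_le ?_
    rintro x (rfl | rfl | rfl)
    · exact ⟨_, (phiRing_of _ classA).trans phiH_classA⟩
    · exact ⟨_, (phiRing_of _ classBp).trans phiH_classBp⟩
    · exact ⟨_, (phiRing_of _ classBm).trans phiH_classBm⟩

/-- The isomorphism of the cohomology ring with the ring of invariants. -/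
noncomputable def ringEquiv : GroupCup.HRing (ZMod 2) A4 ≃ₐ[ZMod 2] invariantsC3 :=
  (AlgEquiv.ofInjective _ phiRing_injective).trans (Subalgebra.equivOfEq _ _ range_phiRing)

theorem coe_ringEquiv_classA :
    (ringEquiv (DirectSum.of (GroupCup.H (ZMod 2) A4) 2 classA) : Poly) = qA :=
  (phiRing_of _ classA).trans phiH_classA

theorem coe_ringEquiv_classBp :
    (ringEquiv (DirectSum.of (GroupCup.H (ZMod 2) A4) 3 classBp) : Poly) = qBp :=
  (phiRing_of _ classBp).trans phiH_classBp

theorem coe_ringEquiv_classBm :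
    (ringEquiv (DirectSum.of (GroupCup.H (ZMod 2) A4) 3 classBm) : Poly) = qBm :=
  (phiRing_of _ classBm).trans phiH_classBm

/-- The presentation of the cohomology ring. -/
noncomputable def presentation : (MvPolynomial (Fin 3) (ZMod 2) ⧸ Ideal.span {rel}) ≃ₐ[ZMod 2]
    GroupCup.HRing (ZMod 2) A4 :=
  (Ideal.quotientEquivAlgOfEq (ZMod 2) ker_evGen.symm).trans
    ((Ideal.quotientKerEquivRange evGen).trans
      ((Subalgebra.equivOfEq _ _ range_evGen).trans ringEquiv.symm))

theorem presentation_mk {P : MvPolynomial (Fin 3) (ZMod 2)} {y : GroupCup.HRing (ZMod 2) A4}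
    (h : evGen P = ringEquiv y) : presentation (Ideal.Quotient.mk _ P) = y := by
  change ringEquiv.symm _ = y
  rw [AlgEquiv.symm_apply_eq]
  exact Subtype.ext h

theorem adjoin_eq_top : Algebra.adjoin (ZMod 2) {DirectSum.of (GroupCup.H (ZMod 2) A4) 2 classA,
    DirectSum.of (GroupCup.H (ZMod 2) A4) 3 classBp,
    DirectSum.of (GroupCup.H (ZMod 2) A4) 3 classBm} = ⊤ := by
  refine eq_top_iff.2 fun y _ => ?_
  have h := phiRing_mem y
  rw [invariantsC3_eq, ← phiH_classA, ← phiH_classBp, ← phiH_classBm, ← phiRing_of, ← phiRing_of,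
    ← phiRing_of, ← Set.image_singleton, ← Set.image_insert_eq, ← Set.image_insert_eq,
    ← AlgHom.map_adjoin] at h
  obtain ⟨y', hy', e⟩ := h
  rwa [← phiRing_injective e]

end AltFour

theorem proposition5p3 :
    ∃ (γ : GroupCup.H (ZMod 2) (alternatingGroup (Fin 4)) 2)
      (γp γm : GroupCup.H (ZMod 2) (alternatingGroup (Fin 4)) 3)
      (a bp bm : GroupCup.HRing (ZMod 2) (alternatingGroup (Fin 4))),
      -- `γ` is the class represented by `[1,0,1]^o = [1,0,1]^+ + [1,0,1]^-`
      (∀ c : GroupCup.H (ZMod 2) (alternatingGroup (Fin 4)) 2,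
        FoxNeuwirth.Represents (m := 3)
          (FoxNeuwirth.charged ![1, 0, 1] 1 + FoxNeuwirth.charged ![1, 0, 1] (-1)) c ↔ c = γ) ∧
      -- `γp` is the class represented by `[1,1,1]^+ + [2,0,1]^o`
      (∀ c : GroupCup.H (ZMod 2) (alternatingGroup (Fin 4)) 3,
        FoxNeuwirth.Represents (m := 3)
          (FoxNeuwirth.charged ![1, 1, 1] 1 +
            (FoxNeuwirth.charged ![2, 0, 1] 1 + FoxNeuwirth.charged ![2, 0, 1] (-1))) c ↔
          c = γp) ∧
      -- `γm` is the class represented by `[1,1,1]^- + [2,0,1]^o`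
      (∀ c : GroupCup.H (ZMod 2) (alternatingGroup (Fin 4)) 3,
        FoxNeuwirth.Represents (m := 3)
          (FoxNeuwirth.charged ![1, 1, 1] (-1) +
            (FoxNeuwirth.charged ![2, 0, 1] 1 + FoxNeuwirth.charged ![2, 0, 1] (-1))) c ↔
          c = γm) ∧
      -- `a`, `bp`, `bm` are these classes as elements of the cohomology ring
      a = DirectSum.of (GroupCup.H (ZMod 2) (alternatingGroup (Fin 4))) 2 γ ∧
      bp = DirectSum.of (GroupCup.H (ZMod 2) (alternatingGroup (Fin 4))) 3 γp ∧
      bm = DirectSum.of (GroupCup.H (ZMod 2) (alternatingGroup (Fin 4))) 3 γm ∧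
      -- they generate the cohomology ring
      Algebra.adjoin (ZMod 2) {a, bp, bm} = ⊤ ∧
      -- they satisfy the relation
      bp * bm = bp ^ 2 + bm ^ 2 + a ^ 3 ∧
      -- there are no other relations
      (∃ e : (MvPolynomial (Fin 3) (ZMod 2) ⧸
            Ideal.span {(MvPolynomial.X 1 * MvPolynomial.X 2 -
              (MvPolynomial.X 1 ^ 2 + MvPolynomial.X 2 ^ 2 + MvPolynomial.X 0 ^ 3) :
                MvPolynomial (Fin 3) (ZMod 2))}) ≃ₐ[ZMod 2]
            GroupCup.HRing (ZMod 2) (alternatingGroup (Fin 4)),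
        e (Ideal.Quotient.mk _ (MvPolynomial.X 0)) = a ∧
        e (Ideal.Quotient.mk _ (MvPolynomial.X 1)) = bp ∧
        e (Ideal.Quotient.mk _ (MvPolynomial.X 2)) = bm) ∧
      -- the cohomology ring is isomorphic to the ring of invariants
      (∃ e : GroupCup.HRing (ZMod 2) (alternatingGroup (Fin 4)) ≃ₐ[ZMod 2] invariantsC3,
        (e a : MvPolynomial (Fin 2) (ZMod 2)) =
          MvPolynomial.X 0 ^ 2 + MvPolynomial.X 0 * MvPolynomial.X 1 + MvPolynomial.X 1 ^ 2 ∧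
        (e bp : MvPolynomial (Fin 2) (ZMod 2)) =
          MvPolynomial.X 0 ^ 3 + MvPolynomial.X 0 ^ 2 * MvPolynomial.X 1 +
            MvPolynomial.X 1 ^ 3 ∧
        (e bm : MvPolynomial (Fin 2) (ZMod 2)) =
          MvPolynomial.X 0 ^ 3 + MvPolynomial.X 0 * MvPolynomial.X 1 ^ 2 +
            MvPolynomial.X 1 ^ 3) := by
  refine ⟨classA, classBp, classBm, _, _, _, fun c => ⟨fun hc => ?_, ?_⟩, fun c => ⟨fun hc => ?_, ?_⟩,
    fun c => ⟨fun hc => ?_, ?_⟩, rfl, rfl, rfl, adjoin_eq_top, ?_,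
    ⟨presentation, presentation_mk ?_, presentation_mk ?_, presentation_mk ?_⟩,
    ⟨ringEquiv, coe_ringEquiv_classA, coe_ringEquiv_classBp, coe_ringEquiv_classBm⟩⟩
  · exact phiH_injective 2 ((phiH_of_represents_two hc).trans phiH_classA.symm)
  · rintro rfl
    exact represents_stdCocycle (by omega) qA_isHomogeneous cyclicShift_qA polyCochain_qA
  · refine phiH_injective 3 ((phiH_of_represents_three hc).trans (Eq.trans ?_ phiH_classBp.symm))
    simp [charged_apply]
  · rintro rfl
    exact represents_stdCocycle le_rfl qBp_isHomogeneous cyclicShift_qBp polyCochain_qBp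
  · refine phiH_injective 3 ((phiH_of_represents_three hc).trans (Eq.trans ?_ phiH_classBm.symm))
    simp [charged_apply]
  · rintro rfl
    exact represents_stdCocycle le_rfl qBm_isHomogeneous cyclicShift_qBm polyCochain_qBm
  · refine phiRing_injective ?_
    rw [map_mul, map_add, map_add, map_pow, map_pow, map_pow, phiRing_of, phiRing_of, phiRing_of]
    exact (congrArg₂ _ phiH_classBp phiH_classBm).trans (qBp_mul_qBm.trans
      (by rw [← phiH_classA, ← phiH_classBp, ← phiH_classBm]))
  · exact (aeval_X _ _).trans coe_ringEquiv_classA.symm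
  · exact (aeval_X _ _).trans coe_ringEquiv_classBp.symm
  · exact (aeval_X _ _).trans coe_ringEquiv_classBm.symm
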